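/- **Setting.** Let $V=\mathbb R^n$. A fan $\Delta$ in $V$ is a finite nonempty set of strictly convex polyhedral cones, closed under taking faces, any two of which intersect in a common face. It is complete if its cones cover $V$, and centrally symmetric if $-\sigma\in\Delta$ for every $\sigma\in\Delta$. Regard $\Delta$ as a topological space whose open sets are the subfans and the empty set. For $\sigma\in\Delta$ let $\langle\sigma\rangle$ be the subfan of faces of $\sigma$ and $\partial\sigma$ the subfan of its proper faces. Let $A=S(V^*)$ be the algebra of real polynomial functions on $V$, graded so that linear functions have degree $2$, and let $\mathfrak m\subset A$ be the ideal of polynomials without constant term. Let $\mathcal A$ be the sheaf of graded algebras on $\Delta$ for which $\mathcal A(\Lambda)=A_\Lambda$ is the algebra of conewise polynomial functions on $|\Lambda|=\bigcup_{\sigma\in\Lambda}\sigma$, and put $A_\sigma:=A_{\langle\sigma\rangle}$. For a sheaf $\mathcal E$ of ($\mathbb N$-)graded $\mathcal A$-modules write $E_\Lambda=\mathcal E(\Lambda)$, $E_\sigma=E_{\langle\sigma\rangle}$ and $\bar E_\Lambda=E_\Lambda/\mathfrak mE_\Lambda$. It is a *minimal extension sheaf* if $E_0\cong\mathbb R$,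 concentrated in degree $0$; each $E_\sigma$ is a free $A_\sigma$-module; and for each $\sigma\ne0$ in $\Delta$ the restriction $E_\sigma\to E_{\partial\sigma}$ induces an isomorphism $\bar E_\sigma\to\bar E_{\partial\sigma}$. Let $\Delta$ be centrally symmetric and $\varphi=-\mathrm{id}_V$. An action of $\varphi$ on $\mathcal E$ is a family of isomorphisms of graded real vector spaces $\varphi:E_\Lambda\to E_{-\Lambda}$, for all open $\Lambda$, which is compatible with the restriction maps, equivariant with respect to $A_\Lambda\to A_{-\Lambda}$, $f\mapsto f(-\,\cdot\,)$, satisfies $\varphi^2=\mathrm{id}$, and is the identity on $E_0$. It induces an involution of each $\bar E_\Delta^q$, whose eigenspaces for the eigenvalues $\pm1$ are denoted $(\bar E_\Delta^q)^\pm$. Let $G=\{\pm1\}$ and let $\chi\in\mathbb Z[G]$ be the element corresponding to $-1$. Put $$u_\Delta(t)=\sum_{q\ge0}\dim(\bar E_\Delta^q)\,t^q,\qquad u_\Delta^\varphi(t)=\sum_{q\ge0}\bigl(\dim(\bar E_\Delta^q)^+ +\dim(\bar E_\Delta^q)^-\,\chi\bigr)\,t^q .$$ **Proposition 3.1.** Let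 $\Delta$ be a centrally symmetric complete fan in $\mathbb R^n$, $\mathcal E$ a minimal extension sheaf on $\Delta$, and let $\varphi=-\mathrm{id}$ act on $\mathcal E$ as above. Then $\bar E_\Delta$ is finite-dimensional, and in $\mathbb Q[G][t]$ $$u_\Delta^\varphi(t)=\tfrac12\bigl(u_\Delta(t)+(1+t^2)^n\bigr)+\tfrac12\,\chi\,\bigl(u_\Delta(t)-(1+t^2)^n\bigr).$$ In particular $$\sum_{q\ge0}\dim\bigl((\bar E_\Delta^q)^-\bigr)\,t^q=\tfrac12\bigl(u_\Delta(t)-(1+t^2)^n\bigr).$$ -/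

import Mathlib

open scoped Pointwise
open TopologicalSpace (Opens)

universe u

/-- A fan in `ℝⁿ`: a finite nonempty set of strictly convex polyhedral (that is, finitely generated
and salient) cones, closed under taking faces, any two of which intersect in a common face. -/
structure ConvexFan (n : ℕ) where
  cones : Set (PointedCone ℝ (Fin n → ℝ))
  finite : cones.Finite
  nonempty : cones.Nonempty
  polyhedral : ∀ σ ∈ cones, Submodule.FG σ
  strictlyConvex : ∀ σ ∈ cones, (σ : ConvexCone ℝ (Fin n → ℝ)).Salient
  face_mem : ∀ σ ∈ cones, ∀ τ : PointedCone ℝ (Fin n → ℝ), τ.IsFaceOf σ → τ ∈ cones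
  inter_face : ∀ σ ∈ cones, ∀ τ ∈ cones, (σ ⊓ τ).IsFaceOf σ ∧ (σ ⊓ τ).IsFaceOf τ

namespace ConvexFan

variable {n : ℕ} (Δ : ConvexFan n)

/-- The points of the fan space: the cones of `Δ`. -/
abbrev Cone : Type := {σ : PointedCone ℝ (Fin n → ℝ) // σ ∈ Δ.cones}

/-- The fan topology: a set of cones of `Δ` is open iff it is closed under taking faces, i.e. iff it
is a subfan or empty. -/
instance fanTopology : TopologicalSpace Δ.Cone where
  IsOpen U := ∀ σ ∈ U, ∀ τ : Δ.Cone, τ.1.IsFaceOf σ.1 → τ ∈ U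
  isOpen_univ := fun _ _ _ _ => trivial
  isOpen_inter := fun _ _ hU hV σ hσ τ h => ⟨hU σ hσ.1 τ h, hV σ hσ.2 τ h⟩
  isOpen_sUnion := fun _ hS σ ⟨U, hU, hσ⟩ τ h => ⟨U, hU, hS U hU σ hσ τ h⟩

/-- `Δ` is complete: its cones cover `ℝⁿ`. -/
def IsComplete : Prop := ∀ x : Fin n → ℝ, ∃ σ ∈ Δ.cones, x ∈ σ

/-- `Δ` is centrally symmetric: with `σ` it contains `-σ`. -/
def IsCentrallySymmetric : Prop := ∀ σ ∈ Δ.cones, -σ ∈ Δ.cones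

/-- The subfan `{0}` consisting of the zero cone. -/
def zeroFan : Opens Δ.Cone where
  carrier := {σ | σ.1 = ⊥}
  is_open' := fun σ hσ τ h => by
    have h1 : σ.1 = ⊥ := hσ
    exact le_bot_iff.mp (h1 ▸ h.le)

variable {Δ}

/-- The affine subfan `⟨σ⟩` of the faces of `σ`. -/
def affineFan (σ : Δ.Cone) : Opens Δ.Cone where
  carrier := {τ | τ.1.IsFaceOf σ.1}
  is_open' := fun _ hτ _ h => h.trans hτ

/-- The boundary fan `∂σ` of the proper faces of `σ`. -/
def boundaryFan (σ : Δ.Cone) : Opens Δ.Cone where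
  carrier := {τ | τ.1.IsFaceOf σ.1 ∧ τ ≠ σ}
  is_open' := fun τ hτ ρ h => by
    refine ⟨h.trans hτ.1, ?_⟩
    rintro rfl
    exact hτ.2 (Subtype.ext (le_antisymm hτ.1.le h.le))

lemma boundaryFan_le (σ : Δ.Cone) : boundaryFan σ ≤ affineFan σ := fun _ h => h.1

/-- The support `|Λ|`, the union of the cones of `Λ`. -/
def support (Λ : Opens Δ.Cone) : Set (Fin n → ℝ) := {x | ∃ σ ∈ Λ, x ∈ σ.1}

lemma support_mono {Λ Λ' : Opens Δ.Cone} (h : Λ' ≤ Λ) : support Λ' ⊆ support Λ :=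
  fun _ ⟨σ, hσ, hx⟩ => ⟨σ, h hσ, hx⟩

/-- The algebra `A_Λ` of conewise polynomial functions on `Λ`: the real functions on `|Λ|` which on
each cone of `Λ` agree with a polynomial function. -/
def conewisePoly (Λ : Opens Δ.Cone) : Subalgebra ℝ (support Λ → ℝ) where
  carrier := {f | ∀ σ ∈ Λ, ∃ p : MvPolynomial (Fin n) ℝ,
    ∀ x : support Λ, x.1 ∈ σ.1 → f x = MvPolynomial.eval x.1 p}
  mul_mem' := fun {f g} hf hg σ hσ => by
    obtain ⟨p, hp⟩ := hf σ hσ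
    obtain ⟨q, hq⟩ := hg σ hσ
    exact ⟨p * q, fun x hx => by simp [hp x hx, hq x hx]⟩
  add_mem' := fun {f g} hf hg σ hσ => by
    obtain ⟨p, hp⟩ := hf σ hσ
    obtain ⟨q, hq⟩ := hg σ hσ
    exact ⟨p + q, fun x hx => by simp [hp x hx, hq x hx]⟩
  algebraMap_mem' := fun r σ _ => ⟨MvPolynomial.C r, fun x _ => by simp⟩

/-- `f ∈ A_Λ` is homogeneous of degree `q`, where linear functions have degree `2`. In odd degrees
only `0` is homogeneous. -/
def IsHomogeneousPoly {Λ : Opens Δ.Cone} (f : conewisePoly Λ) (q : ℕ) : Prop :=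
  ∀ σ ∈ Λ, ∃ p : MvPolynomial (Fin n) ℝ, p.IsWeightedHomogeneous (fun _ => 2) q ∧
    ∀ x : support Λ, x.1 ∈ σ.1 → f.1 x = MvPolynomial.eval x.1 p

/-- Restriction of conewise polynomial functions. -/
def polyRes {Λ Λ' : Opens Δ.Cone} (h : Λ' ≤ Λ) : conewisePoly Λ →ₐ[ℝ] conewisePoly Λ' where
  toFun f := ⟨fun x => f.1 ⟨x.1, support_mono h x.2⟩, fun σ hσ => by
    obtain ⟨p, hp⟩ := f.2 σ (h hσ)
    exact ⟨p, fun x hx => hp ⟨x.1, support_mono h x.2⟩ hx⟩⟩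
  map_one' := rfl
  map_mul' _ _ := rfl
  map_zero' := rfl
  map_add' _ _ := rfl
  commutes' _ := rfl

/-- The map `A = S(V^*) → A_Λ` which restricts polynomial functions on `V = ℝⁿ` to `|Λ|`. -/
noncomputable def ofPoly (Λ : Opens Δ.Cone) :
    MvPolynomial (Fin n) ℝ →ₐ[ℝ] conewisePoly Λ where
  toFun p := ⟨fun x => MvPolynomial.eval x.1 p, fun _ _ => ⟨p, fun _ _ => rfl⟩⟩
  map_one' := Subtype.ext (funext fun x => by simp)
  map_mul' _ _ := Subtype.ext (funext fun x => by simp)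
  map_zero' := Subtype.ext (funext fun x => by simp)
  map_add' _ _ := Subtype.ext (funext fun x => by simp)
  commutes' r := Subtype.ext (funext fun x => by
    simp only [MvPolynomial.algebraMap_eq, MvPolynomial.eval_C]; rfl)

/-- A sheaf of graded `𝒜`-modules on the fan space `Δ`, where `𝒜` is the sheaf `Λ ↦ A_Λ`. -/
structure GradedSheaf (Δ : ConvexFan n) where
  /-- the sections over `Λ` -/
  Sec : Opens Δ.Cone → Type u
  [addCommGroup : ∀ Λ, AddCommGroup (Sec Λ)]
  [moduleReal : ∀ Λ, Module ℝ (Sec Λ)]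
  [modulePoly : ∀ Λ, Module (conewisePoly Λ) (Sec Λ)]
  [tower : ∀ Λ, IsScalarTower ℝ (conewisePoly Λ) (Sec Λ)]
  /-- the homogeneous component of degree `q` -/
  gr : ∀ Λ, ℕ → Submodule ℝ (Sec Λ)
  gr_internal : ∀ Λ, DirectSum.IsInternal (gr Λ)
  smul_mem_gr : ∀ Λ (a : conewisePoly Λ) (s : Sec Λ) (p q : ℕ),
    IsHomogeneousPoly a p → s ∈ gr Λ q → a • s ∈ gr Λ (p + q)
  /-- the restriction homomorphisms -/
  res : ∀ {Λ Λ' : Opens Δ.Cone}, Λ' ≤ Λ → Sec Λ →ₗ[ℝ] Sec Λ'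
  res_smul : ∀ {Λ Λ' : Opens Δ.Cone} (h : Λ' ≤ Λ) (a : conewisePoly Λ) (s : Sec Λ),
    res h (a • s) = polyRes h a • res h s
  res_mem_gr : ∀ {Λ Λ' : Opens Δ.Cone} (h : Λ' ≤ Λ) (q : ℕ) (s : Sec Λ),
    s ∈ gr Λ q → res h s ∈ gr Λ' q
  res_id : ∀ (Λ : Opens Δ.Cone) (s : Sec Λ), res (le_refl Λ) s = s
  res_comp : ∀ {Λ Λ' Λ'' : Opens Δ.Cone} (h : Λ' ≤ Λ) (h' : Λ'' ≤ Λ') (s : Sec Λ),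
    res h' (res h s) = res (h'.trans h) s
  /-- the sheaf axiom: compatible sections on an open covering glue uniquely -/
  glue : ∀ {ι : Type} (U : ι → Opens Δ.Cone) (s : ∀ i, Sec (U i)),
    (∀ i j, res (inf_le_left : U i ⊓ U j ≤ U i) (s i) =
      res (inf_le_right : U i ⊓ U j ≤ U j) (s j)) →
    ∃! t : Sec (⨆ i, U i), ∀ i, res (le_iSup U i) t = s i

namespace GradedSheaf

attribute [instance] addCommGroup moduleReal modulePoly tower

variable (E : GradedSheaf.{u} Δ)

/-- The subspace `𝔪 E_Λ` of `E_Λ`, where `𝔪` is the homogeneous maximal ideal of `A = S(V^*)`, i.e.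
the ideal of the polynomials without constant term, which acts on `E_Λ` by restriction to `|Λ|`. -/
def maxSub (Λ : Opens Δ.Cone) : Submodule ℝ (E.Sec Λ) :=
  Submodule.span ℝ {y | ∃ p : MvPolynomial (Fin n) ℝ, p.constantCoeff = 0 ∧
    ∃ s : E.Sec Λ, y = ofPoly Λ p • s}

/-- The reduced space of sections `Ē_Λ = E_Λ / 𝔪 E_Λ`. -/
abbrev Red (Λ : Opens Δ.Cone) : Type u := E.Sec Λ ⧸ E.maxSub Λ

/-- The homogeneous component of degree `q` of `Ē_Λ`. -/
def redGr (Λ : Opens Δ.Cone) (q : ℕ) : Submodule ℝ (E.Red Λ) :=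
  (E.gr Λ q).map (E.maxSub Λ).mkQ

lemma maxSub_le_comap_res {Λ Λ' : Opens Δ.Cone} (h : Λ' ≤ Λ) :
    E.maxSub Λ ≤ (E.maxSub Λ').comap (E.res h) := by
  refine Submodule.span_le.mpr ?_
  rintro _ ⟨p, hp, s, rfl⟩
  exact Submodule.subset_span ⟨p, hp, E.res h s, E.res_smul h _ _⟩

/-- The map `Ē_Λ → Ē_Λ'` induced by restriction. -/
def redRes {Λ Λ' : Opens Δ.Cone} (h : Λ' ≤ Λ) : E.Red Λ →ₗ[ℝ] E.Red Λ' :=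
  (E.maxSub Λ).mapQ (E.maxSub Λ') (E.res h) (E.maxSub_le_comap_res h)

/-- `E` is a minimal extension sheaf: `E_0 ≃ ℝ` concentrated in degree `0`, every `E_σ` is free over
`A_σ`, and for `σ ≠ 0` the restriction `E_σ → E_∂σ` induces an isomorphism `Ē_σ → Ē_∂σ` (which
automatically respects the gradings). -/
structure IsMinimalExtension : Prop where
  zero_iso : Nonempty (E.Sec Δ.zeroFan ≃ₗ[ℝ] ℝ)
  zero_gr : E.gr Δ.zeroFan 0 = ⊤
  free : ∀ σ : Δ.Cone, Module.Free (conewisePoly (affineFan σ)) (E.Sec (affineFan σ))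
  red_bijective : ∀ σ : Δ.Cone, σ.1 ≠ ⊥ → Function.Bijective (E.redRes (boundaryFan_le σ))

end GradedSheaf

section CentralSymmetry

variable (hs : Δ.IsCentrallySymmetric)

/-- The action `σ ↦ -σ` of `φ = -id` on the cones of `Δ`. -/
def negCone (σ : Δ.Cone) : Δ.Cone := ⟨-σ.1, hs σ.1 σ.2⟩

lemma isFaceOf_neg {τ σ : PointedCone ℝ (Fin n → ℝ)} (h : τ.IsFaceOf σ) :
    (-τ).IsFaceOf (-σ) where
  le := fun x hx => h.le (x := -x) hx
  mem_of_smul_add_mem := fun {x y a} hx hy ha hxy => by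
    refine h.mem_of_smul_add_mem (x := -x) (y := -y) (a := a) hx hy ha ?_
    have h2 : -(a • x + y) ∈ τ := hxy
    rwa [neg_add, ← smul_neg] at h2

/-- The subfan `-Λ = {-σ : σ ∈ Λ} = {σ : -σ ∈ Λ}`. -/
def negOpen (Λ : Opens Δ.Cone) : Opens Δ.Cone where
  carrier := {σ | negCone hs σ ∈ Λ}
  is_open' := fun σ hσ τ h => Λ.isOpen (negCone hs σ) hσ (negCone hs τ) (isFaceOf_neg h)

lemma negCone_negCone (σ : Δ.Cone) : negCone hs (negCone hs σ) = σ :=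
  Subtype.ext (neg_neg σ.1)

lemma negOpen_mono {Λ Λ' : Opens Δ.Cone} (h : Λ' ≤ Λ) : negOpen hs Λ' ≤ negOpen hs Λ :=
  fun _ hσ => h hσ

lemma le_negOpen_negOpen (Λ : Opens Δ.Cone) : Λ ≤ negOpen hs (negOpen hs Λ) := fun σ hσ => by
  change negCone hs (negCone hs σ) ∈ Λ
  rwa [negCone_negCone]

lemma top_le_negOpen_top : (⊤ : Opens Δ.Cone) ≤ negOpen hs ⊤ := fun _ _ => trivial

lemma zeroFan_le_negOpen : Δ.zeroFan ≤ negOpen hs Δ.zeroFan := fun σ hσ => by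
  have h1 : σ.1 = ⊥ := hσ
  change -σ.1 = ⊥
  simp [h1]

lemma neg_mem_support {Λ : Opens Δ.Cone} {x : Fin n → ℝ} (hx : x ∈ support (negOpen hs Λ)) :
    -x ∈ support Λ := by
  obtain ⟨σ, hσ, hx⟩ := hx
  refine ⟨negCone hs σ, hσ, ?_⟩
  change -(-x) ∈ σ.1
  rwa [neg_neg]

/-- The automorphism of `A = S(V^*)` induced by `-id`, i.e. `p ↦ (x ↦ p (-x))`. -/
noncomputable def polyNegVar (n : ℕ) : MvPolynomial (Fin n) ℝ →ₐ[ℝ] MvPolynomial (Fin n) ℝ :=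
  MvPolynomial.aeval fun i => -MvPolynomial.X i

lemma eval_polyNegVar (x : Fin n → ℝ) (p : MvPolynomial (Fin n) ℝ) :
    MvPolynomial.eval x (polyNegVar n p) = MvPolynomial.eval (-x) p := by
  have key : (MvPolynomial.eval x).comp (polyNegVar n).toRingHom = MvPolynomial.eval (-x) := by
    ext <;> simp [polyNegVar]
  exact RingHom.congr_fun key p

lemma constantCoeff_polyNegVar (p : MvPolynomial (Fin n) ℝ) :
    (polyNegVar n p).constantCoeff = p.constantCoeff := by
  have key : (MvPolynomial.constantCoeff).comp (polyNegVar n).toRingHom =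
      (MvPolynomial.constantCoeff : MvPolynomial (Fin n) ℝ →+* ℝ) := by
    ext <;> simp [polyNegVar]
  exact RingHom.congr_fun key p

/-- The action `A_Λ → A_{-Λ}` of `φ = -id` on conewise polynomial functions, `f ↦ (x ↦ f (-x))`. -/
noncomputable def polyNeg (Λ : Opens Δ.Cone) : conewisePoly Λ →ₐ[ℝ] conewisePoly (negOpen hs Λ) where
  toFun f := ⟨fun x => f.1 ⟨-x.1, neg_mem_support hs x.2⟩, fun σ hσ => by
    obtain ⟨p, hp⟩ := f.2 (negCone hs σ) hσ
    refine ⟨polyNegVar n p, fun x hx => ?_⟩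
    rw [eval_polyNegVar]
    exact hp ⟨-x.1, neg_mem_support hs x.2⟩ (by change -(-x.1) ∈ σ.1; rwa [neg_neg])⟩
  map_one' := rfl
  map_mul' _ _ := rfl
  map_zero' := rfl
  map_add' _ _ := rfl
  commutes' _ := rfl

/-- An action of the group `{±1}` generated by `φ = -id` on a sheaf of graded `𝒜`-modules, covering
the action on `Δ`: graded isomorphisms `φ : E_Λ → E_{-Λ}` which are equivariant for `A_Λ → A_{-Λ}`,
compatible with the restriction homomorphisms, involutive, and the identity on `E_0`. -/
structure CentralAction (E : GradedSheaf.{u} Δ) where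
  act : ∀ Λ, E.Sec Λ →ₗ[ℝ] E.Sec (negOpen hs Λ)
  act_mem_gr : ∀ Λ (q : ℕ) (s : E.Sec Λ), s ∈ E.gr Λ q → act Λ s ∈ E.gr (negOpen hs Λ) q
  act_smul : ∀ Λ (a : conewisePoly Λ) (s : E.Sec Λ), act Λ (a • s) = polyNeg hs Λ a • act Λ s
  act_res : ∀ {Λ Λ' : Opens Δ.Cone} (h : Λ' ≤ Λ) (s : E.Sec Λ),
    act Λ' (E.res h s) = E.res (negOpen_mono hs h) (act Λ s)
  act_act : ∀ Λ (s : E.Sec Λ),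
    E.res (le_negOpen_negOpen hs Λ) (act (negOpen hs Λ) (act Λ s)) = s
  act_zero : ∀ s : E.Sec Δ.zeroFan, E.res (zeroFan_le_negOpen hs) (act Δ.zeroFan s) = s

namespace CentralAction

variable {hs} {E : GradedSheaf.{u} Δ} (φ : CentralAction hs E)

/-- The automorphism `φ` of the module `E_Δ` of global sections (note `-Δ = Δ`). -/
def actTop : E.Sec ⊤ →ₗ[ℝ] E.Sec ⊤ := E.res (top_le_negOpen_top hs) ∘ₗ φ.act ⊤

lemma maxSub_le_comap_actTop : E.maxSub ⊤ ≤ (E.maxSub ⊤).comap φ.actTop := by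
  refine Submodule.span_le.mpr ?_
  rintro _ ⟨p, hp, s, rfl⟩
  refine Submodule.subset_span
    ⟨polyNegVar n p, (constantCoeff_polyNegVar p).trans hp, φ.actTop s, ?_⟩
  simp only [actTop, LinearMap.comp_apply, φ.act_smul, E.res_smul]
  congr 1
  exact Subtype.ext (funext fun x => (eval_polyNegVar x.1 p).symm)

/-- The induced automorphism of `Ē_Δ`. -/
def redAct : E.Red ⊤ →ₗ[ℝ] E.Red ⊤ :=
  (E.maxSub ⊤).mapQ (E.maxSub ⊤) φ.actTop φ.maxSub_le_comap_actTop

/-- The eigenspace of `φ` on `Ē_Δ^q` for the eigenvalue `ε`. -/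
def redEigen (ε : ℝ) (q : ℕ) : Submodule ℝ (E.Red ⊤) :=
  E.redGr ⊤ q ⊓ Module.End.eigenspace φ.redAct ε

end CentralAction

end CentralSymmetry

/-- The Poincaré polynomial `∑_q (dim W_q) t^q` of a family of finite-dimensional spaces, almost all
of which are zero. -/
noncomputable def poincarePoly {M : Type u} [AddCommGroup M] [Module ℝ M]
    (W : ℕ → Submodule ℝ M) : Polynomial ℤ :=
  ∑ᶠ q, Polynomial.monomial q (Module.finrank ℝ (W q) : ℤ)

/-- The element `χ` of the group ring `R[G]` of the character group `G = {±1}` that corresponds to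
`-1`. -/
noncomputable def chi (R : Type) [CommRing R] : MonoidAlgebra R ℤˣ := MonoidAlgebra.of R ℤˣ (-1)

/-- The refined Poincaré polynomial `∑_q (dim (Ē_Δ^q)⁺ + dim (Ē_Δ^q)⁻ χ) t^q` over `ℤ[G]`. -/
noncomputable def CentralAction.refinedPoincarePoly {hs : Δ.IsCentrallySymmetric}
    {E : GradedSheaf.{u} Δ} (φ : CentralAction hs E) : Polynomial (MonoidAlgebra ℤ ℤˣ) :=
  ∑ᶠ q, Polynomial.monomial q
    ((Module.finrank ℝ (φ.redEigen 1 q) : MonoidAlgebra ℤ ℤˣ) +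
      (Module.finrank ℝ (φ.redEigen (-1) q) : MonoidAlgebra ℤ ℤˣ) * chi ℤ)

end ConvexFan

-- Since `φ` is an involution, the dimensions of its two eigenspaces on Ē_Δ^q add up to dim Ē_Δ^q.
-- So it is enough to show that their difference, the trace of `φ`, is the coefficient of t^q in (1
-- + t²)^n (`finrank_redEigen_sub`).
--
-- On E_Δ the trace is 1 in degree 0 and 0 in all other degrees (`eigenTrace_gr`). The reason is
-- that a nonzero strictly convex cone differs from its negative. If S is a symmetric subfan and ±σ
-- are minimal outside S, the sections vanishing on S are spanned by those vanishing also on σ and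
-- those vanishing also on -σ. `φ` swaps these two spaces, so it has the same trace on their sum as
-- on their intersection (`eigenTrace_vanishing`). Enlarging S step by step shows that only E_0
-- contributes.
--
-- To pass from E_Δ to Ē_Δ one divides by the coordinates one at a time. `φ` anticommutes with each
-- coordinate, which has degree 2. If the coordinates form a regular sequence on E_Δ, each division
-- therefore multiplies the trace series by 1 + t² (`eigenTrace_varSub`).
--
-- Regularity comes from freeness of E_Δ over A (`exists_equiv_top`), which is where completeness
-- enters. The proof compares E with an auxiliary flabby system N. Refine Δ by a hyperplane
-- arrangement, put large free modules over the rings of polynomial functions on the closed cells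
-- (`exists_flabby_free`), and push forward to Δ. Cutting by the hyperplanes gives Mayer–Vietoris
-- sequences, from which sections of the cell system over a convex union of cells are projective
-- over the polynomial functions on that union (`relProjective_secs`). In particular the global
-- sections of N are projective over A. Local projectivity and flabbiness yield morphisms E → N → E
-- whose composite θ is the identity on E_0 (`exists_homs`). Minimality and Nakayama's lemma make θ
-- invertible near the origin (`endo_regular`). Hence, near the origin, E_Δ behaves like a direct
-- summand of the projective module of global sections of N, and a minimal system of generators of
-- E_Δ is a basis.

universe v w w' x

/-! ### Recursive constructions on finite posets -/

/-- A family on a finite poset satisfying a condition, which at `s` only depends on the values below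
`s`, can be extended from a lower set if it can be extended one element at a time. -/
theorem exists_extension_of_isLowerSet {P : Type*} [PartialOrder P] [Finite P] {X : P → Type*}
    (Q : P → (∀ t, X t) → Prop)
    (hQ : ∀ s x y, (∀ t ≤ s, x t = y t) → Q s x → Q s y)
    (step : ∀ s x, (∀ t < s, Q t x) → ∃ y, (∀ t, t ≠ s → y t = x t) ∧ Q s y)
    (D : Set P) (hD : IsLowerSet D) (x : ∀ t, X t) (hx : ∀ s ∈ D, Q s x) :
    ∃ y : ∀ t, X t, (∀ s ∈ D, y s = x s) ∧ ∀ s, Q s y := by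
  induction hk : Dᶜ.ncard using Nat.strong_induction_on generalizing D x with
  | _ k ih =>
    by_cases hne : (Dᶜ).Nonempty
    · obtain ⟨s, hs⟩ := (Set.toFinite Dᶜ).exists_minimal hne
      have hlt : ∀ t < s, t ∈ D := fun t ht => by
        by_contra h
        exact ht.not_ge (hs.2 h ht.le)
      obtain ⟨y, hy, hyQ⟩ := step s x (fun t ht => hx t (hlt t ht))
      have hyD : ∀ t ∈ D, y t = x t := fun t ht => hy t (fun h => hs.1 (h ▸ ht))
      have hD' : IsLowerSet (insert s D) := by
        rintro a b hab (rfl | ha)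
        · rcases hab.lt_or_eq with h | rfl
          · exact Or.inr (hlt _ h)
          · exact Or.inl rfl
        · exact Or.inr (hD hab ha)
      have hcard : (insert s D)ᶜ.ncard < k := by
        rw [← hk]
        refine Set.ncard_lt_ncard ⟨Set.compl_subset_compl.mpr (Set.subset_insert _ _), ?_⟩
          (Set.toFinite _)
        exact fun h => h hs.1 (Set.mem_insert _ _)
      obtain ⟨z, hz, hzQ⟩ := ih _ hcard (insert s D) hD' y (by
        rintro t (rfl | ht)
        · exact hyQ
        · exact hQ t x y (fun a ha => (hyD a (hD ha ht)).symm) (hx t ht)) rfl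
      exact ⟨z, fun t ht => (hz t (Or.inr ht)).trans (hyD t ht), hzQ⟩
    · rw [Set.not_nonempty_iff_eq_empty, Set.compl_empty_iff] at hne
      exact ⟨x, fun _ _ => rfl, fun s => hx s (hne ▸ trivial)⟩

/-! ### Relative projectivity -/

section RelProjective

variable {A : Type v} [CommRing A]

/-- `M` is a retract, as an `A`-module, of a free `A/I`-module. -/
def RelProjective.{y, z, t} {A : Type y} [CommRing A] (I : Ideal A) (M : Type z) [AddCommGroup M]
    [Module A M] : Prop :=
  ∃ (X : Type t) (i : M →ₗ[A] X →₀ A ⧸ I) (p : (X →₀ A ⧸ I) →ₗ[A] M), p ∘ₗ i = LinearMap.id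

variable {I J : Ideal A}

theorem smul_finsupp_quotient_eq_zero {X : Type*} {a : A} (ha : a ∈ I) (y : X →₀ A ⧸ I) :
    a • y = 0 := by
  ext x
  obtain ⟨b, hb⟩ := Ideal.Quotient.mk_surjective (y x)
  rw [Finsupp.smul_apply, ← hb, Finsupp.zero_apply]
  change Ideal.Quotient.mk I (a * b) = 0
  exact Ideal.Quotient.eq_zero_iff_mem.mpr (I.mul_mem_right b ha)

theorem RelProjective.smul_eq_zero {M : Type w} [AddCommGroup M] [Module A M]
    (h : RelProjective.{v, w, x} I M) {a : A} (ha : a ∈ I) (m : M) : a • m = 0 := by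
  obtain ⟨X, i, p, hip⟩ := h
  have h1 : m = p (i m) := (LinearMap.congr_fun hip m).symm
  rw [h1, ← map_smul, smul_finsupp_quotient_eq_zero ha, map_zero]

/-- The `A`-linear map from a free `A/I`-module with prescribed values on a basis. -/
noncomputable def finsuppQuotientLift {X : Type*} {Q : Type*} [AddCommGroup Q] [Module A Q]
    (hQ : ∀ a ∈ I, ∀ y : Q, a • y = 0) (f : X → Q) : (X →₀ A ⧸ I) →ₗ[A] Q :=
  Finsupp.lsum ℕ fun x => Submodule.liftQ I (LinearMap.toSpanSingleton A Q (f x))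
    fun a ha => by simpa using hQ a ha (f x)

theorem finsuppQuotientLift_single {X : Type*} {Q : Type*} [AddCommGroup Q] [Module A Q]
    (hQ : ∀ a ∈ I, ∀ y : Q, a • y = 0) (f : X → Q) (x : X) :
    finsuppQuotientLift hQ f (Finsupp.single x 1) = f x := by
  have h : (1 : A ⧸ I) = Submodule.Quotient.mk (1 : A) := rfl
  rw [finsuppQuotientLift, Finsupp.lsum_single, h, Submodule.liftQ_apply,
    LinearMap.toSpanSingleton_apply, one_smul]

theorem finsuppQuotient_hom_ext {X : Type*} {Q : Type*} [AddCommGroup Q] [Module A Q]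
    {f g : (X →₀ A ⧸ I) →ₗ[A] Q}
    (h : ∀ x, f (Finsupp.single x 1) = g (Finsupp.single x 1)) : f = g := by
  refine Finsupp.lhom_ext fun x b => ?_
  obtain ⟨a, rfl⟩ := Ideal.Quotient.mk_surjective b
  have h1 : Finsupp.single x (Ideal.Quotient.mk I a) = a • Finsupp.single x (1 : A ⧸ I) := by
    rw [Finsupp.smul_single]
    congr 1
    change _ = Ideal.Quotient.mk I (a * 1)
    rw [mul_one]
  rw [h1, map_smul, map_smul, h x]

theorem relProjective_finsupp (X : Type x) (I : Ideal A) {M : Type w} [AddCommGroup M] [Module A M]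
    (e : M ≃ₗ[A] X →₀ A ⧸ I) : RelProjective.{v, w, x} I M :=
  ⟨X, e, e.symm, by ext; simp⟩

theorem RelProjective.of_retract {M : Type w} {N : Type w'} [AddCommGroup M] [Module A M]
    [AddCommGroup N] [Module A N] (h : RelProjective.{v, w', x} I N) (i : M →ₗ[A] N) (p : N →ₗ[A] M)
    (hip : p ∘ₗ i = LinearMap.id) : RelProjective.{v, w, x} I M := by
  obtain ⟨X, j, q, hjq⟩ := h
  refine ⟨X, j ∘ₗ i, p ∘ₗ q, ?_⟩
  rw [LinearMap.comp_assoc, ← LinearMap.comp_assoc i, hjq, LinearMap.id_comp, hip]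

theorem RelProjective.prod {M : Type w} {N : Type w'} [AddCommGroup M] [Module A M]
    [AddCommGroup N] [Module A N] (hM : RelProjective.{v, w, x} I M)
    (hN : RelProjective.{v, w', x} I N) : RelProjective.{v, max w w', x} I (M × N) := by
  obtain ⟨X, j, q, hjq⟩ := hM
  obtain ⟨Y, j', q', hjq'⟩ := hN
  refine ⟨X ⊕ Y, (Finsupp.sumFinsuppLEquivProdFinsupp A).symm.toLinearMap ∘ₗ j.prodMap j',
    q.prodMap q' ∘ₗ (Finsupp.sumFinsuppLEquivProdFinsupp A).toLinearMap, ?_⟩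
  refine LinearMap.ext fun x => ?_
  have h1 := LinearMap.congr_fun hjq x.1
  have h2 := LinearMap.congr_fun hjq' x.2
  simp only [LinearMap.comp_apply, LinearMap.id_apply] at h1 h2
  simp [h1, h2]

/-- Relatively projective modules lift along surjections of modules killed by `I`. -/
theorem RelProjective.exists_lift {M : Type w} [AddCommGroup M] [Module A M]
    (h : RelProjective.{v, w, x} I M) {Q N : Type*} [AddCommGroup Q] [Module A Q] [AddCommGroup N]
    [Module A N] (hQ : ∀ a ∈ I, ∀ y : Q, a • y = 0) (q : Q →ₗ[A] N) (f : M →ₗ[A] N)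
    (hfq : ∀ x, f x ∈ LinearMap.range q) : ∃ k : M →ₗ[A] Q, ∀ x, q (k x) = f x := by
  obtain ⟨X, i, p, hip⟩ := h
  choose y hy using fun x : X => hfq (p (Finsupp.single x 1))
  refine ⟨finsuppQuotientLift hQ y ∘ₗ i, fun x => ?_⟩
  have h1 : q ∘ₗ finsuppQuotientLift hQ y = f ∘ₗ p := finsuppQuotient_hom_ext fun x => by
    simp [finsuppQuotientLift_single, hy]
  have h2 := LinearMap.congr_fun h1 (i x)
  simp only [LinearMap.comp_apply] at h2 ⊢
  rw [h2]
  exact congrArg f (LinearMap.congr_fun hip x)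

/-- The kernel of a surjection from a module which is projective relative to `I` onto a module which
is projective relative to `I + (ℓ)` is projective relative to `I`, if `ℓ` is regular modulo `I`. -/
theorem RelProjective.ker {ℓ : A} (hreg : ∀ a, ℓ * a ∈ I → a ∈ I) (hJ : J = I ⊔ Ideal.span {ℓ})
    {L M N : Type w} [AddCommGroup L] [Module A L] [AddCommGroup M] [Module A M] [AddCommGroup N]
    [Module A N] (hM : RelProjective.{v, w, x} I M) (hN : RelProjective.{v, w, x} J N)
    (ι : L →ₗ[A] M) (d : M →ₗ[A] N) (hι : Function.Injective ι) (hd : Function.Surjective d)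
    (hex : ∀ x, d x = 0 ↔ x ∈ LinearMap.range ι) : RelProjective.{v, w, x} I L := by
  obtain ⟨X, i, p, hip⟩ := hN
  have hIJ : I ≤ J := hJ ▸ le_sup_left
  have hℓJ : ℓ ∈ J := hJ ▸ Ideal.mem_sup_right (Ideal.mem_span_singleton_self ℓ)
  have hMI : ∀ a ∈ I, ∀ y : M, a • y = 0 := fun a ha y => hM.smul_eq_zero ha y
  have hJF : ∀ a ∈ I, ∀ y : X →₀ A ⧸ J, a • y = 0 := fun a ha y =>
    smul_finsupp_quotient_eq_zero (hIJ ha) y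
  let π : (X →₀ A ⧸ I) →ₗ[A] (X →₀ A ⧸ J) := finsuppQuotientLift hJF fun x => Finsupp.single x 1
  have hπ_single : ∀ (x : X) (a : A), π (Finsupp.single x (Ideal.Quotient.mk I a)) =
      Finsupp.single x (Ideal.Quotient.mk J a) := fun x a => by
    have h1 : Finsupp.single x (Ideal.Quotient.mk I a) = a • Finsupp.single x (1 : A ⧸ I) := by
      rw [Finsupp.smul_single]
      congr 1
      change _ = Ideal.Quotient.mk I (a * 1)
      rw [mul_one]
    rw [h1, map_smul, finsuppQuotientLift_single, Finsupp.smul_single]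
    congr 1
    change Ideal.Quotient.mk J (a * 1) = _
    rw [mul_one]
  have hπ_apply : ∀ (y : X →₀ A ⧸ I) (x : X), π y x = Ideal.Quotient.factor hIJ (y x) := fun y x => by
    induction y using Finsupp.induction_linear with
    | zero => rw [map_zero, Finsupp.zero_apply, Finsupp.zero_apply, map_zero]
    | add f g hf hg => rw [map_add, Finsupp.add_apply, hf, hg, Finsupp.add_apply, map_add]
    | single z b =>
      obtain ⟨a, rfl⟩ := Ideal.Quotient.mk_surjective b
      rw [hπ_single]
      by_cases hz : z = x
      · subst hz
        rw [Finsupp.single_eq_same, Finsupp.single_eq_same, Ideal.Quotient.factor_mk]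
      · rw [Finsupp.single_eq_of_ne (Ne.symm hz), Finsupp.single_eq_of_ne (Ne.symm hz), map_zero]
  have hπ_surj : Function.Surjective π := fun y => by
    induction y using Finsupp.induction_linear with
    | zero => exact ⟨0, map_zero _⟩
    | add f g hf hg =>
      obtain ⟨a, rfl⟩ := hf
      obtain ⟨b, rfl⟩ := hg
      exact ⟨a + b, map_add _ _ _⟩
    | single z b =>
      obtain ⟨a, rfl⟩ := Ideal.Quotient.mk_surjective b
      exact ⟨_, hπ_single z a⟩
  have hregQ : ∀ b : A ⧸ I, ℓ • b = 0 → b = 0 := fun b hb => by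
    obtain ⟨a, rfl⟩ := Ideal.Quotient.mk_surjective b
    have h1 : Ideal.Quotient.mk I (ℓ * a) = 0 := hb
    exact Ideal.Quotient.eq_zero_iff_mem.mpr (hreg a (Ideal.Quotient.eq_zero_iff_mem.mp h1))
  let mul : (X →₀ A ⧸ I) →ₗ[A] (X →₀ A ⧸ I) := LinearMap.lsmul A (X →₀ A ⧸ I) ℓ
  have hmul : Function.Injective mul := by
    rw [injective_iff_map_eq_zero]
    intro y hy
    ext x
    exact hregQ _ (DFunLike.congr_fun hy x)
  have hker : ∀ y : X →₀ A ⧸ I, π y = 0 → y ∈ LinearMap.range mul := fun y hy => by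
    -- Division by `ℓ` is carried out coordinatewise. The clause sending 0 to 0 keeps the supports
    -- finite.
    have h1 : ∀ b : A ⧸ I, ∃ c : A ⧸ I, (Ideal.Quotient.factor hIJ b = 0 → ℓ • c = b) ∧
        (b = 0 → c = 0) := fun b => by
      by_cases hb : Ideal.Quotient.factor hIJ b = 0
      · obtain ⟨a, rfl⟩ := Ideal.Quotient.mk_surjective b
        rw [Ideal.Quotient.factor_mk, Ideal.Quotient.eq_zero_iff_mem, hJ,
          Submodule.mem_sup] at hb
        obtain ⟨u, hu, v, hv, rfl⟩ := hb
        obtain ⟨c, rfl⟩ := Ideal.mem_span_singleton'.mp hv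
        have h2 : ℓ • Ideal.Quotient.mk I c = Ideal.Quotient.mk I (u + c * ℓ) := by
          rw [map_add, Ideal.Quotient.eq_zero_iff_mem.mpr hu, zero_add, mul_comm]
          rfl
        refine ⟨Ideal.Quotient.mk I c, fun _ => h2, fun h0 => hregQ _ (h2.trans h0)⟩
      · exact ⟨0, fun h => absurd h hb, fun _ => rfl⟩
    choose e he he0 using h1
    refine ⟨y.mapRange e (he0 0 rfl), ?_⟩
    ext x
    have h2 := DFunLike.congr_fun hy x
    rw [hπ_apply] at h2
    have h3 := he _ h2
    rwa [← Finsupp.mapRange_apply (hf := he0 0 rfl)] at h3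
  -- A Schanuel-type argument: `N` is a retract of a free `A/J`-module, whose cover by a free
  -- `A/I`-module has kernel ℓ·(free) ≅ free. The maps `a` and `b` compare this cover with `M`, over
  -- `p` and over `i` respectively.
  obtain ⟨a, ha⟩ := (relProjective_finsupp X I (LinearEquiv.refl A _)).exists_lift hMI d (p ∘ₗ π)
    (fun x => hd _)
  obtain ⟨b, hb⟩ := hM.exists_lift
    (fun c hc (y : X →₀ A ⧸ I) => smul_finsupp_quotient_eq_zero hc y) π (i ∘ₗ d) (fun x => hπ_surj _)
  have hb' : ∀ m : L, b (ι m) ∈ LinearMap.range mul := fun m => hker _ (by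
    rw [hb, LinearMap.comp_apply, (hex (ι m)).mpr ⟨m, rfl⟩, map_zero])
  let β : L →ₗ[A] (X →₀ A ⧸ I) := (LinearEquiv.ofInjective mul hmul).symm.toLinearMap ∘ₗ
    (b ∘ₗ ι).codRestrict (LinearMap.range mul) hb'
  have hβ : ∀ m, ℓ • β m = b (ι m) := fun m => by
    have h1 := congrArg Subtype.val
      ((LinearEquiv.ofInjective mul hmul).apply_symm_apply ⟨b (ι m), hb' m⟩)
    exact h1
  have h1 : ∀ m : M, m - a (b m) ∈ LinearMap.range ι := fun m => (hex _).mp (by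
    rw [map_sub, ha, LinearMap.comp_apply, hb, LinearMap.comp_apply]
    have h2 := LinearMap.congr_fun hip (d m)
    simp only [LinearMap.comp_apply, LinearMap.id_apply] at h2
    rw [h2, sub_self])
  have hN0 : ∀ y : N, ℓ • y = 0 := fun y =>
    RelProjective.smul_eq_zero.{v, w, x} (I := J) ⟨X, i, p, hip⟩ hℓJ y
  have h2 : ∀ y : X →₀ A ⧸ I, ℓ • a y ∈ LinearMap.range ι := fun y => (hex _).mp (by
    rw [map_smul, hN0])
  let e := (LinearEquiv.ofInjective ι hι).symm
  let r₁ : M →ₗ[A] L := e.toLinearMap ∘ₗ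
    (LinearMap.id - a ∘ₗ b).codRestrict (LinearMap.range ι) h1
  let r₂ : (X →₀ A ⧸ I) →ₗ[A] L := e.toLinearMap ∘ₗ (ℓ • a).codRestrict (LinearMap.range ι) h2
  have hr₁ : ∀ m, ι (r₁ m) = m - a (b m) := fun m =>
    congrArg Subtype.val ((LinearEquiv.ofInjective ι hι).apply_symm_apply ⟨m - a (b m), h1 m⟩)
  have hr₂ : ∀ y, ι (r₂ y) = ℓ • a y := fun y =>
    congrArg Subtype.val ((LinearEquiv.ofInjective ι hι).apply_symm_apply ⟨ℓ • a y, h2 y⟩)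
  -- `L` is a retract of `M` × (free): the term a(b(ιm)) subtracted by `r₁` is returned by `r₂`,
  -- because b(ιm) = ℓ·β(m).
  refine (hM.prod (relProjective_finsupp X I (LinearEquiv.refl A _))).of_retract (ι.prod β)
    (r₁.coprod r₂) (LinearMap.ext fun m => hι ?_)
  change ι (r₁ (ι m) + r₂ (β m)) = ι m
  rw [map_add, hr₁, hr₂, ← hβ, map_smul, sub_add_cancel]

end RelProjective

/-! ### Systems of modules on finite posets -/

/-- A sheaf of `A`-modules on a poset, whose open sets are the lower sets, given by its stalks. -/
structure PosetSystem (A : Type v) [CommRing A] (P : Type*) [PartialOrder P] where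
  obj : P → Type w
  [addCommGroup : ∀ s, AddCommGroup (obj s)]
  [module : ∀ s, Module A (obj s)]
  res : ∀ {s t : P}, t ≤ s → obj s →ₗ[A] obj t
  res_refl : ∀ s (y : obj s), res (le_refl s) y = y
  res_res : ∀ {s t u : P} (h : t ≤ s) (h' : u ≤ t) (y : obj s),
    res h' (res h y) = res (h'.trans h) y

namespace PosetSystem

attribute [instance] addCommGroup module

variable {A : Type v} [CommRing A] {P : Type*} [PartialOrder P] (M : PosetSystem.{v, w} A P)

/-- The family `y` is compatible with the restrictions from members of `D`. -/
def CompatOn (D : Set P) (y : ∀ s, M.obj s) : Prop :=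
  ∀ s ∈ D, ∀ t (h : t ≤ s), M.res h (y s) = y t

/-- Sections over the complement of the largest element of a basic open set extend. -/
def Flabby : Prop :=
  ∀ s (y : ∀ t, M.obj t), M.CompatOn (Set.Iio s) y → ∃ z : M.obj s, ∀ t (h : t < s), M.res h.le z = y t

variable {M}

/-- Flabbiness supplies a value at one new minimal element at a time. Families are total functions,
and values outside `D` are ignored until the recursion reaches them. -/
theorem Flabby.exists_extension [Finite P] (hM : M.Flabby) (D : Set P) (hD : IsLowerSet D)
    (y : ∀ s, M.obj s) (hy : M.CompatOn D y) :
    ∃ z : ∀ s, M.obj s, (∀ s ∈ D, z s = y s) ∧ M.CompatOn Set.univ z := by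
  classical
  obtain ⟨z, hz, hzQ⟩ := exists_extension_of_isLowerSet (X := M.obj)
    (fun s y => ∀ t (h : t ≤ s), M.res h (y s) = y t)
    (fun s y z h hs t hts => by rw [← h s le_rfl, ← h t hts, hs t hts])
    (fun s y hy => by
      obtain ⟨z, hz⟩ := hM s y (fun t ht => hy t ht)
      refine ⟨Function.update y s z, fun t ht => Function.update_of_ne ht _ _, fun t hts => ?_⟩
      rcases hts.lt_or_eq with h | rfl
      · rw [Function.update_self, Function.update_of_ne h.ne, hz t h]
      · rw [M.res_refl]) D hD y hy
  exact ⟨z, hz, fun s _ => hzQ s⟩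

variable (M)

/-- The sections over a set of elements of the poset. -/
def secs (D : Set P) : Submodule A (∀ s : D, M.obj s) where
  carrier := {y | ∀ (s t : D) (h : t.1 ≤ s.1), M.res h (y s) = y t}
  add_mem' := fun hy hz s t h => by rw [Pi.add_apply, map_add, hy s t h, hz s t h, Pi.add_apply]
  zero_mem' := fun s t h => by rw [Pi.zero_apply, map_zero, Pi.zero_apply]
  smul_mem' := fun a y hy s t h => by rw [Pi.smul_apply, map_smul, hy s t h, Pi.smul_apply]

/-- Restriction of sections. -/
def secsRes {D D' : Set P} (h : D' ⊆ D) : M.secs D →ₗ[A] M.secs D' where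
  toFun y := ⟨fun s => y.1 ⟨s.1, h s.2⟩, fun s t hst => y.2 ⟨s.1, h s.2⟩ ⟨t.1, h t.2⟩ hst⟩
  map_add' _ _ := rfl
  map_smul' _ _ := rfl

variable {M}

open Classical in
theorem exists_compatOn_of_secs {D : Set P} (hD : IsLowerSet D) (y : M.secs D) :
    ∃ z : ∀ s, M.obj s, (∀ s : D, z s = y.1 s) ∧ M.CompatOn D z := by
  refine ⟨fun s => if h : s ∈ D then y.1 ⟨s, h⟩ else 0, fun s => by simp, fun s hs t hts => ?_⟩
  have ht : t ∈ D := hD hts hs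
  simp only [hs, ht, dif_pos]
  exact y.2 ⟨s, hs⟩ ⟨t, ht⟩ hts

theorem Flabby.secsRes_surjective [Finite P] (hM : M.Flabby) {D D' : Set P} (h : D' ⊆ D)
    (hD' : IsLowerSet D') : Function.Surjective (M.secsRes h) := fun y => by
  obtain ⟨z, hz, hzc⟩ := exists_compatOn_of_secs hD' y
  obtain ⟨x, hx, hxc⟩ := hM.exists_extension D' hD' z hzc
  refine ⟨⟨fun s => x s, fun s t hst => hxc s trivial t hst⟩, Subtype.ext (funext fun s => ?_)⟩
  exact (hx s s.2).trans (hz s)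

/-- A morphism of systems. -/
structure Hom (M : PosetSystem.{v, w} A P) (N : PosetSystem.{v, w'} A P) where
  app : ∀ s, M.obj s →ₗ[A] N.obj s
  res_app : ∀ {s t : P} (h : t ≤ s) (y : M.obj s), N.res h (app s y) = app t (M.res h y)

/-- If `M` is locally projective and `N` flabby then morphisms extend from lower sets. -/
theorem exists_hom_extension [Finite P] {N : PosetSystem.{v, w'} A P} (I : P → Ideal A)
    (hM : ∀ s, RelProjective.{v, w, x} (I s) (M.obj s))
    (hNI : ∀ s, ∀ a ∈ I s, ∀ y : N.obj s, a • y = 0) (hN : N.Flabby)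
    (D : Set P) (hD : IsLowerSet D) (f : ∀ s, M.obj s →ₗ[A] N.obj s)
    (hf : ∀ s ∈ D, ∀ t (h : t ≤ s) (y : M.obj s), N.res h (f s y) = f t (M.res h y)) :
    ∃ g : Hom M N, ∀ s ∈ D, g.app s = f s := by
  classical
  obtain ⟨g, hg, hgQ⟩ := exists_extension_of_isLowerSet (X := fun s => M.obj s →ₗ[A] N.obj s)
    (fun s f => ∀ t (h : t ≤ s) (y : M.obj s), N.res h (f s y) = f t (M.res h y))
    (fun s y z h hs t hts => by rw [← h s le_rfl, ← h t hts]; exact hs t hts)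
    (fun s f hf => by
      -- The map sought at `s` must lift `φ` through the joint restriction `q`. Flabbiness of `N`
      -- puts each value of `φ` in the range of `q`, and projectivity of `M.obj s` makes the lift
      -- linear.
      let q : N.obj s →ₗ[A] ∀ t : Set.Iio s, N.obj t := LinearMap.pi fun t => N.res (le_of_lt t.2)
      let φ : M.obj s →ₗ[A] ∀ t : Set.Iio s, N.obj t :=
        LinearMap.pi fun t => f t ∘ₗ M.res (le_of_lt t.2)
      obtain ⟨k, hk⟩ := (hM s).exists_lift (hNI s) q φ (fun y => by
        obtain ⟨z, hz⟩ := hN s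
          (fun t => if h : t < s then f t (M.res h.le y) else 0) (fun t ht u hut => by
            have hus : u < s := hut.trans_lt ht
            have ht' : t < s := ht
            simp only [ht', hus, dif_pos]
            rw [hf t ht, M.res_res])
        refine ⟨z, funext fun t => ?_⟩
        have h1 := hz t t.2
        rw [dif_pos (show (t : P) < s from t.2)] at h1
        exact h1)
      refine ⟨Function.update f s k, fun t ht => Function.update_of_ne ht _ _, fun t hts y => ?_⟩
      rcases hts.lt_or_eq with h | rfl
      · rw [Function.update_self, Function.update_of_ne h.ne]
        exact congrFun (hk y) ⟨t, h⟩
      · rw [M.res_refl, N.res_refl]) D hD f hf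
  exact ⟨⟨g, fun {s t} h y => hgQ s t h y⟩, hg⟩

/-- On a finite poset with a compatible family of ideals `I s` there is a flabby system of free
`A / I s`-modules of large rank. -/
theorem exists_flabby_free {A P : Type v} [CommRing A] [PartialOrder P] [Finite P] [Infinite A]
    (I : P → Ideal A)
    (hI : ∀ s t, t ≤ s → I s ≤ I t) :
    ∃ M : PosetSystem.{v, v} A P, M.Flabby ∧ ∀ s, Nonempty (M.obj s ≃ₗ[A] A →₀ A ⧸ I s) := by
  classical
  -- A submodule of the finite product of these free modules has at most |A| elements. The rank |A|
  -- is therefore large enough for every surjection needed below.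
  have hcard : ∀ L : Submodule A (∀ t, A →₀ A ⧸ I t), ∃ g : A → L, Function.Surjective g := fun L => by
    have h1 : Cardinal.mk L ≤ Cardinal.mk A := by
      have h2 : Cardinal.mk (A →₀ A) = Cardinal.mk A := by
        rw [Cardinal.mk_finsupp_of_infinite, max_self]
      have h3 : Cardinal.mk (P → A →₀ A) ≤ Cardinal.mk A := by
        rw [← Cardinal.power_def, h2]
        exact Cardinal.pow_le (Cardinal.aleph0_le_mk A) (Cardinal.lt_aleph0_of_finite P)
      refine (Cardinal.mk_subtype_le _).trans (le_trans ?_ h3)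
      refine Cardinal.mk_le_of_surjective (f := fun (y : P → A →₀ A) t =>
        (y t).mapRange (Ideal.Quotient.mk (I t)) (map_zero _)) fun y => ?_
      choose z hz using fun t => Finsupp.mapRange_surjective (α := A) (Ideal.Quotient.mk (I t))
        (map_zero _) Ideal.Quotient.mk_surjective (y t)
      exact ⟨z, funext hz⟩
    obtain ⟨e⟩ := h1
    exact ⟨Function.invFun e, Function.invFun_surjective e.injective⟩
  obtain ⟨r, -, hr⟩ := exists_extension_of_isLowerSet
    (X := fun s => ∀ t, (A →₀ A ⧸ I s) →ₗ[A] (A →₀ A ⧸ I t))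
    (fun s r => r s s = LinearMap.id ∧ (∀ t ≤ s, ∀ u ≤ t, r t u ∘ₗ r s t = r s u) ∧
      ∀ y : ∀ t, A →₀ A ⧸ I t, (∀ t < s, ∀ u ≤ t, r t u (y t) = y u) →
        ∃ z, ∀ t < s, r s t z = y t)
    (fun s r r' h hs => by
      refine ⟨?_, fun t ht u hu => ?_, fun y hy => ?_⟩
      · rw [← h s le_rfl, hs.1]
      · rw [← h s le_rfl, ← h t ht, hs.2.1 t ht u hu]
      · rw [← h s le_rfl]
        exact hs.2.2 y fun t ht u hu => by rw [h t ht.le]; exact hy t ht u hu)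
    (fun s r hr => by
      -- `L` consists of the sections over the elements strictly below `s`, padded by 0. Mapping the
      -- new stalk onto `L` and restricting by coordinates is exactly flabbiness at `s`.
      let L : Submodule A (∀ t, A →₀ A ⧸ I t) :=
        { carrier := {y | (∀ t, t < s → ∀ u ≤ t, r t u (y t) = y u) ∧ ∀ t, ¬ t < s → y t = 0}
          add_mem' := fun {y z} hy hz => ⟨fun t ht u hu => by
              rw [Pi.add_apply, map_add, hy.1 t ht u hu, hz.1 t ht u hu, Pi.add_apply],
            fun t ht => by rw [Pi.add_apply, hy.2 t ht, hz.2 t ht, add_zero]⟩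
          zero_mem' := ⟨fun t _ u _ => map_zero _, fun t _ => rfl⟩
          smul_mem' := fun a y hy => ⟨fun t ht u hu => by
              rw [Pi.smul_apply, map_smul, hy.1 t ht u hu, Pi.smul_apply],
            fun t ht => by rw [Pi.smul_apply, hy.2 t ht, smul_zero]⟩ }
      obtain ⟨g, hg⟩ := hcard L
      have hL : ∀ a ∈ I s, ∀ y : L, a • y = 0 := fun a ha y => Subtype.ext (funext fun t => by
        change a • y.1 t = 0
        by_cases ht : t < s
        · exact smul_finsupp_quotient_eq_zero (hI s t ht.le ha) _
        · rw [y.2.2 t ht, smul_zero])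
      let k : (A →₀ A ⧸ I s) →ₗ[A] L := finsuppQuotientLift hL g
      have hk : Function.Surjective k := fun y => by
        obtain ⟨a, rfl⟩ := hg y
        exact ⟨_, finsuppQuotientLift_single hL g a⟩
      let v : ∀ t, (A →₀ A ⧸ I s) →ₗ[A] (A →₀ A ⧸ I t) :=
        Function.update (fun t => LinearMap.proj t ∘ₗ L.subtype ∘ₗ k) s LinearMap.id
      have hvs : v s = LinearMap.id := Function.update_self _ _ _
      have hvt : ∀ t, t < s → ∀ y, v t y = (k y).1 t := fun t ht y => by
        simp only [v, Function.update_of_ne ht.ne]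
        rfl
      refine ⟨Function.update r s v, fun t ht => Function.update_of_ne ht _ _, ?_, ?_, ?_⟩
      · rw [Function.update_self, hvs]
      · intro t hts u hut
        rcases hts.lt_or_eq with h | rfl
        · rw [Function.update_self, Function.update_of_ne h.ne]
          refine LinearMap.ext fun y => ?_
          rw [LinearMap.comp_apply, hvt t h, hvt u (hut.trans_lt h)]
          exact (k y).2.1 t h u hut
        · rw [Function.update_self, hvs, LinearMap.comp_id]
      · intro y hy
        obtain ⟨z, hz⟩ := hk ⟨fun t => if t < s then y t else 0, fun t ht u hu => by
          have h1 := hy t ht u hu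
          rw [Function.update_of_ne ht.ne] at h1
          simp only [if_pos ht, if_pos (hu.trans_lt ht), h1], fun t ht => if_neg ht⟩
        refine ⟨z, fun t ht => ?_⟩
        rw [Function.update_self, hvt t ht, hz]
        exact if_pos ht)
    ∅ (fun _ _ _ h => h) (fun _ _ => 0) (fun s hs => hs.elim)
  exact ⟨{ obj := fun s => A →₀ A ⧸ I s
           res := fun {s t} _ => r s t
           res_refl := fun s y => by rw [(hr s).1, LinearMap.id_apply]
           res_res := fun {s t u} h h' y => LinearMap.congr_fun ((hr s).2.1 t h u h') y },
    fun s y hy => (hr s).2.2 y hy, fun s => ⟨LinearEquiv.refl A _⟩⟩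

end PosetSystem

/-! ### Polynomials vanishing on cones -/

section Vanishing

variable {n : ℕ}

/-- The ideal of the polynomials which vanish on `K`. -/
def polyVanishing (K : Set (Fin n → ℝ)) : Ideal (MvPolynomial (Fin n) ℝ) where
  carrier := {p | ∀ z ∈ K, MvPolynomial.eval z p = 0}
  add_mem' := fun hp hq z hz => by rw [map_add, hp z hz, hq z hz, add_zero]
  zero_mem' := fun z _ => map_zero _
  smul_mem' := fun a p hp z hz => by rw [smul_eq_mul, map_mul, hp z hz, mul_zero]

theorem polyVanishing_anti {K L : Set (Fin n → ℝ)} (h : K ⊆ L) :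
    polyVanishing L ≤ polyVanishing K := fun _ hp z hz => hp z (h hz)

theorem polyVanishing_univ : polyVanishing (Set.univ : Set (Fin n → ℝ)) = ⊥ :=
  eq_bot_iff.mpr fun p hp => MvPolynomial.funext fun z => by rw [hp z trivial, map_zero]

/-- The linear form `z ↦ c ⬝ᵥ z`. -/
noncomputable def linPoly (c : Fin n → ℝ) : MvPolynomial (Fin n) ℝ :=
  ∑ i, MvPolynomial.C (c i) * MvPolynomial.X i

theorem eval_linPoly (c z : Fin n → ℝ) : MvPolynomial.eval z (linPoly c) = c ⬝ᵥ z := by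
  simp [linPoly, dotProduct]

/-- A polynomial which vanishes on a half line vanishes on its line. -/
theorem eval_eq_zero_of_halfLine (p : MvPolynomial (Fin n) ℝ) (z y : Fin n → ℝ) (T : ℝ)
    (h : ∀ t ≥ T, MvPolynomial.eval (z + t • y) p = 0) : MvPolynomial.eval z p = 0 := by
  let q : Polynomial ℝ :=
    MvPolynomial.aeval (fun i => Polynomial.C (z i) + Polynomial.X * Polynomial.C (y i)) p
  have hq : ∀ t, q.eval t = MvPolynomial.eval (z + t • y) p := fun t => by
    have key : ((Polynomial.evalRingHom t).comp (MvPolynomial.aeval (R := ℝ)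
        (fun i => Polynomial.C (z i) + Polynomial.X * Polynomial.C (y i))).toRingHom) =
        MvPolynomial.eval (z + t • y) := by
      ext
      · simp
      · simp
        ring
    exact RingHom.congr_fun key p
  have h0 : q = 0 := Polynomial.eq_zero_of_infinite_isRoot q
    ((Set.Ici_infinite T).mono fun t ht => (hq t).trans (h t ht))
  have h1 := hq 0
  rwa [h0, Polynomial.eval_zero, zero_smul, add_zero, eq_comm] at h1

/-- The half space `{z | 0 ≤ c ⬝ᵥ z}`. -/
def halfSpace (c : Fin n → ℝ) : PointedCone ℝ (Fin n → ℝ) where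
  carrier := {z | 0 ≤ c ⬝ᵥ z}
  add_mem' := fun {y z} hy hz => by
    change 0 ≤ c ⬝ᵥ (y + z)
    rw [dotProduct_add]
    exact add_nonneg hy hz
  zero_mem' := by change 0 ≤ c ⬝ᵥ 0; rw [dotProduct_zero]
  smul_mem' := fun r z hz => by
    change 0 ≤ c ⬝ᵥ (r.1 • z)
    rw [dotProduct_smul]
    exact mul_nonneg r.2 hz

theorem mem_halfSpace {c z : Fin n → ℝ} : z ∈ halfSpace c ↔ 0 ≤ c ⬝ᵥ z := Iff.rfl

theorem exists_le_forall_nonneg {c y : Fin n → ℝ} (hy : 0 < c ⬝ᵥ y) (z : Fin n → ℝ) :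
    ∃ T : ℝ, 0 ≤ T ∧ ∀ t ≥ T, 0 < c ⬝ᵥ (z + t • y) := by
  refine ⟨(|c ⬝ᵥ z| + 1) / (c ⬝ᵥ y), by positivity, fun t ht => ?_⟩
  have h1 : (|c ⬝ᵥ z| + 1) ≤ t * (c ⬝ᵥ y) := (div_le_iff₀ hy).mp ht
  rw [dotProduct_add, dotProduct_smul, smul_eq_mul]
  linarith [neg_abs_le (c ⬝ᵥ z)]

variable {K : PointedCone ℝ (Fin n → ℝ)} {c : Fin n → ℝ}

theorem add_smul_mem_cone {z y : Fin n → ℝ} (hz : z ∈ K) (hy : y ∈ K) {t : ℝ} (ht : 0 ≤ t) :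
    z + t • y ∈ K := K.add_mem hz (PointedCone.smul_mem K ht hy)

/-- From any z in K, the ray in direction y stays in K and eventually enters the region c > 0. A
polynomial vanishing on the far end of a ray vanishes at its start. -/
theorem eval_eq_zero_of_vanishing_pos {y : Fin n → ℝ} (hy : y ∈ K) (hcy : 0 < c ⬝ᵥ y)
    {p : MvPolynomial (Fin n) ℝ} (hp : ∀ z ∈ K, 0 < c ⬝ᵥ z → MvPolynomial.eval z p = 0) :
    p ∈ polyVanishing (K : Set (Fin n → ℝ)) := fun z hz => by
  obtain ⟨T, hT0, hT⟩ := exists_le_forall_nonneg hcy z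
  exact eval_eq_zero_of_halfLine p z y T fun t ht =>
    hp _ (add_smul_mem_cone hz hy (hT0.trans ht)) (hT t ht)

/-- Both halves of a cone properly cut by a hyperplane have the ideal of the whole cone, so the
middle term of the Mayer–Vietoris sequence lives over the same ring. -/
theorem polyVanishing_inf_halfSpace {y : Fin n → ℝ} (hy : y ∈ K) (hcy : 0 < c ⬝ᵥ y) :
    polyVanishing ((K ⊓ halfSpace c : PointedCone ℝ (Fin n → ℝ)) : Set (Fin n → ℝ)) =
      polyVanishing (K : Set (Fin n → ℝ)) :=
  le_antisymm (fun _ hp => eval_eq_zero_of_vanishing_pos hy hcy fun z hz hcz => hp z ⟨hz, hcz.le⟩)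
    (polyVanishing_anti fun _ hz => hz.1)

theorem linPoly_regular {y : Fin n → ℝ} (hy : y ∈ K) (hcy : 0 < c ⬝ᵥ y)
    (p : MvPolynomial (Fin n) ℝ) (hp : linPoly c * p ∈ polyVanishing (K : Set (Fin n → ℝ))) :
    p ∈ polyVanishing (K : Set (Fin n → ℝ)) :=
  eval_eq_zero_of_vanishing_pos hy hcy fun z hz hcz => by
    have h1 := hp z hz
    rw [map_mul, eval_linPoly] at h1
    exact (mul_eq_zero.mp h1).resolve_left hcz.ne'

/-- Project along u ∈ K, normalised by c·u = 1, onto the hyperplane c = 0. Points of K with c < 0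
are projected into K, so if p vanishes on the slice, its pullback vanishes on that part of K and
hence on K. The pullback differs from p by a multiple of the linear form. -/
theorem polyVanishing_hyperplane {y y' : Fin n → ℝ} (hy : y ∈ K) (hcy : 0 < c ⬝ᵥ y)
    (hy' : y' ∈ K) (hcy' : c ⬝ᵥ y' < 0) :
    polyVanishing ((K ⊓ halfSpace c ⊓ halfSpace (-c) : PointedCone ℝ (Fin n → ℝ)) :
      Set (Fin n → ℝ)) =
      polyVanishing (K : Set (Fin n → ℝ)) ⊔ Ideal.span {linPoly c} := by
  apply le_antisymm
  · intro p hp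
    let u : Fin n → ℝ := (c ⬝ᵥ y)⁻¹ • y
    have hu : u ∈ K := PointedCone.smul_mem K (inv_nonneg.mpr hcy.le) hy
    have hcu : c ⬝ᵥ u = 1 := by
      rw [dotProduct_smul, smul_eq_mul, inv_mul_cancel₀ hcy.ne']
    let π : MvPolynomial (Fin n) ℝ →ₐ[ℝ] MvPolynomial (Fin n) ℝ :=
      MvPolynomial.aeval fun i => MvPolynomial.X i - MvPolynomial.C (u i) * linPoly c
    have hπ : ∀ z q, MvPolynomial.eval z (π q) = MvPolynomial.eval (z - (c ⬝ᵥ z) • u) q :=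
      fun z q => by
        have key : (MvPolynomial.eval z).comp π.toRingHom =
            MvPolynomial.eval (z - (c ⬝ᵥ z) • u) := by
          ext
          · simp [π]
          · simp [π, eval_linPoly, mul_comm]
        exact RingHom.congr_fun key q
    have h1 : π p ∈ polyVanishing (K : Set (Fin n → ℝ)) := by
      refine eval_eq_zero_of_vanishing_pos (c := -c) hy' (by rw [neg_dotProduct]; linarith)
        fun z hz hcz => ?_
      rw [neg_dotProduct] at hcz
      rw [hπ]
      have h2 : c ⬝ᵥ (z - (c ⬝ᵥ z) • u) = 0 := by
        rw [dotProduct_sub, dotProduct_smul, hcu, smul_eq_mul, mul_one, sub_self]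
      refine hp _ ⟨⟨?_, h2.ge⟩, ?_⟩
      · have h3 := add_smul_mem_cone hz hu (neg_pos.mpr (neg_pos.mp hcz)).le
        rwa [neg_smul, ← sub_eq_add_neg] at h3
      · change 0 ≤ -c ⬝ᵥ _
        rw [neg_dotProduct, h2, neg_zero]
    have h2 : p - π p ∈ Ideal.span {linPoly c} := by
      rw [← Ideal.Quotient.eq_zero_iff_mem, map_sub, sub_eq_zero]
      have key : (Ideal.Quotient.mk (Ideal.span {linPoly c})) =
          (Ideal.Quotient.mk (Ideal.span {linPoly c})).comp π.toRingHom := by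
        refine MvPolynomial.ringHom_ext (fun r => ?_) fun i => ?_
        · simp [π]
        · have h4 : Ideal.Quotient.mk (Ideal.span {linPoly c}) (linPoly c) = 0 :=
            Ideal.Quotient.eq_zero_iff_mem.mpr (Ideal.mem_span_singleton_self _)
          simp [π, h4]
      exact RingHom.congr_fun key p
    have h3 : p = π p + (p - π p) := by ring
    rw [h3]
    exact Submodule.add_mem_sup h1 h2
  · refine sup_le (polyVanishing_anti fun _ hz => hz.1.1) ?_
    rw [Ideal.span_singleton_le_iff_mem]
    intro z hz
    have h1 : 0 ≤ c ⬝ᵥ z := hz.1.2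
    have h2 : 0 ≤ -c ⬝ᵥ z := hz.2
    rw [neg_dotProduct] at h2
    rw [eval_linPoly]
    linarith

end Vanishing

/-! ### Finitely generated cones are intersections of half spaces -/

section MinkowskiWeyl

variable {n : ℕ}

/-- Fourier–Motzkin elimination. -/
theorem exists_halfSpaces_add_ray {T : Set (Fin n → ℝ)} (hT : T.Finite) (v : Fin n → ℝ) :
    ∃ T' : Set (Fin n → ℝ), T'.Finite ∧ ∀ z, (∀ h ∈ T', 0 ≤ h ⬝ᵥ z) ↔
      ∃ t : ℝ, 0 ≤ t ∧ ∀ h ∈ T, 0 ≤ h ⬝ᵥ (z - t • v) := by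
  -- The forms that are nonnegative on `v` are kept. Each pair of forms with opposite strict signs
  -- on `v` is combined, with positive coefficients, into a form that kills `v`.
  refine ⟨{h ∈ T | 0 ≤ h ⬝ᵥ v} ∪ Set.image2 (fun h k => (-(k ⬝ᵥ v)) • h + (h ⬝ᵥ v) • k)
    {h ∈ T | 0 < h ⬝ᵥ v} {k ∈ T | k ⬝ᵥ v < 0}, (hT.subset fun _ h => h.1).union
      (Set.Finite.image2 _ (hT.subset fun _ h => h.1) (hT.subset fun _ h => h.1)), fun z => ?_⟩
  have hsub : ∀ (h : Fin n → ℝ) (t : ℝ), h ⬝ᵥ (z - t • v) = h ⬝ᵥ z - t * (h ⬝ᵥ v) := fun h t => by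
    rw [dotProduct_sub, dotProduct_smul, smul_eq_mul]
  constructor
  · intro hz
    -- The lower bounds on t: 0, and one from each form negative on `v`. Their maximum serves as t,
    -- and the combined forms say that it respects the upper bounds.
    let L : Set ℝ := insert 0 ((fun k => (k ⬝ᵥ z) / (k ⬝ᵥ v)) '' {k ∈ T | k ⬝ᵥ v < 0})
    have hL : L.Finite := ((hT.subset fun _ h => h.1).image _).insert 0
    obtain ⟨t, htL, ht⟩ := Set.exists_max_image L id hL ⟨0, Set.mem_insert _ _⟩
    refine ⟨t, ht 0 (Set.mem_insert _ _), fun h hh => ?_⟩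
    rw [hsub]
    rcases lt_trichotomy (h ⬝ᵥ v) 0 with hv | hv | hv
    · have h1 : (h ⬝ᵥ z) / (h ⬝ᵥ v) ≤ t := ht _ (Or.inr ⟨h, ⟨hh, hv⟩, rfl⟩)
      rw [div_le_iff_of_neg hv] at h1
      linarith
    · have h1 := hz h (Or.inl ⟨hh, hv.ge⟩)
      rw [hv, mul_zero, sub_zero]
      exact h1
    · rcases htL with rfl | ⟨k, ⟨hk, hkv⟩, rfl⟩
      · have h1 := hz h (Or.inl ⟨hh, hv.le⟩)
        linarith
      · have h1 := hz _ (Or.inr ⟨h, ⟨hh, hv⟩, k, ⟨hk, hkv⟩, rfl⟩)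
        rw [add_dotProduct, smul_dotProduct, smul_dotProduct, smul_eq_mul, smul_eq_mul] at h1
        have h2 : (k ⬝ᵥ z) / (k ⬝ᵥ v) * (h ⬝ᵥ v) ≤ h ⬝ᵥ z := by
          rw [div_mul_eq_mul_div, div_le_iff_of_neg hkv]
          linarith
        simp only
        linarith
  · rintro ⟨t, ht, hz⟩ g (⟨hg, hgv⟩ | ⟨h, ⟨hh, hv⟩, k, ⟨hk, hkv⟩, rfl⟩)
    · have h1 := hz g hg
      rw [hsub] at h1
      have := mul_nonneg ht hgv
      linarith
    · have h1 := hz h hh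
      have h2 := hz k hk
      rw [hsub] at h1 h2
      simp only [add_dotProduct, smul_dotProduct, smul_eq_mul]
      nlinarith [mul_nonneg (neg_pos.mpr hkv).le h1, mul_nonneg hv.le h2]

/-- Induction on the generators: plus and minus the coordinate forms cut out the zero cone, and
adjoining a generator introduces a parameter t ≥ 0 that Fourier–Motzkin elimination removes. -/
theorem fg_exists_halfSpaces (C : PointedCone ℝ (Fin n → ℝ)) (hC : Submodule.FG C) :
    ∃ T : Set (Fin n → ℝ), T.Finite ∧ ∀ z, z ∈ C ↔ ∀ h ∈ T, 0 ≤ h ⬝ᵥ z := by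
  classical
  obtain ⟨S, rfl⟩ := hC
  induction S using Finset.induction_on with
  | empty =>
    refine ⟨Set.range (fun i : Fin n => Pi.single i (1 : ℝ)) ∪
      Set.range (fun i : Fin n => -Pi.single i (1 : ℝ)),
      (Set.finite_range _).union (Set.finite_range _), fun z => ?_⟩
    rw [Finset.coe_empty, Submodule.span_empty, Submodule.mem_bot]
    constructor
    · rintro rfl h -
      rw [dotProduct_zero]
    · intro hz
      funext i
      have h1 := hz _ (Or.inl ⟨i, rfl⟩)
      have h2 := hz _ (Or.inr ⟨i, rfl⟩)
      rw [neg_dotProduct, single_one_dotProduct] at h2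
      rw [single_one_dotProduct] at h1
      exact le_antisymm (neg_nonneg.mp h2) h1
  | insert v S _ ih =>
    obtain ⟨T, hT, hTz⟩ := ih
    obtain ⟨T', hT', hTz'⟩ := exists_halfSpaces_add_ray hT v
    refine ⟨T', hT', fun z => ?_⟩
    rw [hTz', Finset.coe_insert, Submodule.span_insert, Submodule.mem_sup]
    constructor
    · rintro ⟨y, hy, w, hw, rfl⟩
      obtain ⟨r, rfl⟩ := Submodule.mem_span_singleton.mp hy
      refine ⟨r.1, r.2, (hTz _).mp ?_⟩
      have h1 : r • v + w - r.1 • v = w := add_sub_cancel_left _ _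
      rwa [h1]
    · rintro ⟨t, ht, hz⟩
      exact ⟨t • v, Submodule.mem_span_singleton.mpr ⟨⟨t, ht⟩, rfl⟩, z - t • v, (hTz _).mpr hz,
        add_sub_cancel _ _⟩

end MinkowskiWeyl

/-! ### Cells of a hyperplane arrangement -/

section Cells

variable {n : ℕ}

/-- The linear forms in `H` which are nonnegative at `z`. -/
def nonnegForms (H : Set (Fin n → ℝ)) (z : Fin n → ℝ) : Set (Fin n → ℝ) := {h ∈ H | 0 ≤ h ⬝ᵥ z}

/-- The poset of the cells of the arrangement `H`, encoded by the sets of linear forms which are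
nonnegative on them, ordered by inclusion of the cells. -/
abbrev CellPoset (H : Set (Fin n → ℝ)) : Type := (Set.range (nonnegForms H))ᵒᵈ

/-- The smallest closed cell which contains `z`. -/
def cellOf (H : Set (Fin n → ℝ)) (z : Fin n → ℝ) : CellPoset H :=
  OrderDual.toDual ⟨nonnegForms H z, z, rfl⟩

variable {H : Set (Fin n → ℝ)}

theorem cellOf_le_iff {z y : Fin n → ℝ} :
    cellOf H z ≤ cellOf H y ↔ ∀ h ∈ H, 0 ≤ h ⬝ᵥ y → 0 ≤ h ⬝ᵥ z :=
  ⟨fun hzy h hh hy => (hzy ⟨hh, hy⟩ : h ∈ nonnegForms H z).2, fun hzy h hh => ⟨hh.1, hzy h hh.1 hh.2⟩⟩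

theorem exists_cellOf (s : CellPoset H) : ∃ z, cellOf H z = s := by
  obtain ⟨_, z, rfl⟩ := s
  exact ⟨z, rfl⟩

theorem finite_cellPoset (hH : H.Finite) : Finite (CellPoset H) :=
  (hH.finite_subsets.subset (by rintro _ ⟨z, rfl⟩ h hh; exact hh.1) :
    (Set.range (nonnegForms H)).Finite).to_subtype

/-- The ideal of the polynomials vanishing on a cell. -/
def cellIdeal (s : CellPoset H) : Ideal (MvPolynomial (Fin n) ℝ) :=
  polyVanishing {z | cellOf H z ≤ s}

theorem cellIdeal_mono (s t : CellPoset H) (h : t ≤ s) : cellIdeal s ≤ cellIdeal t :=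
  polyVanishing_anti fun _ hz => le_trans hz h

variable (H) in
/-- A set which is a union of closed cells. -/
def Saturated (K : Set (Fin n → ℝ)) : Prop := ∀ y ∈ K, ∀ z, cellOf H z ≤ cellOf H y → z ∈ K

theorem Saturated.isLowerSet {K : Set (Fin n → ℝ)} (hK : Saturated H K) :
    IsLowerSet (cellOf H '' K) := by
  rintro _ b hb ⟨y, hy, rfl⟩
  obtain ⟨z, rfl⟩ := exists_cellOf b
  exact ⟨z, hK y hy z hb, rfl⟩

theorem Saturated.cellOf_mem_image {K : Set (Fin n → ℝ)} (hK : Saturated H K) {z : Fin n → ℝ} :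
    cellOf H z ∈ cellOf H '' K ↔ z ∈ K :=
  ⟨fun ⟨y, hy, hyz⟩ => hK y hy z hyz.ge, fun h => ⟨z, h, rfl⟩⟩

theorem Saturated.inter_halfSpace {K : Set (Fin n → ℝ)} (hK : Saturated H K) {h : Fin n → ℝ}
    (hh : h ∈ H) : Saturated H (K ∩ (halfSpace h : Set (Fin n → ℝ))) := fun y hy z hzy =>
  ⟨hK y hy.1 z hzy, cellOf_le_iff.mp hzy h hh hy.2⟩

open PosetSystem in
/-- Sections of a locally free flabby system over a convex union of cells are projective over the
polynomial functions on it. -/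
theorem relProjective_secs (hH : H.Finite) (hneg : ∀ h ∈ H, -h ∈ H)
    (F : PosetSystem.{0, 0} (MvPolynomial (Fin n) ℝ) (CellPoset H)) (hF : F.Flabby)
    (hproj : ∀ s, RelProjective.{0, 0, 0} (cellIdeal s) (F.obj s))
    (K : PointedCone ℝ (Fin n → ℝ)) (hK : Saturated H (K : Set (Fin n → ℝ))) :
    RelProjective.{0, 0, 0} (polyVanishing (K : Set (Fin n → ℝ)))
      (F.secs (cellOf H '' (K : Set (Fin n → ℝ)))) := by
  have := finite_cellPoset hH
  induction hk : (cellOf H '' (K : Set (Fin n → ℝ))).ncard using Nat.strong_induction_on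
    generalizing K with
  | _ k ih =>
    by_cases hcut : ∃ h ∈ H, (∃ y ∈ K, 0 < h ⬝ᵥ y) ∧ ∃ y ∈ K, h ⬝ᵥ y < 0
    · obtain ⟨h, hh, ⟨y, hy, hhy⟩, y', hy', hhy'⟩ := hcut
      have hhy'' : 0 < -h ⬝ᵥ y' := by rw [neg_dotProduct]; linarith
      have sat₁ : Saturated H ((K ⊓ halfSpace h : PointedCone ℝ (Fin n → ℝ)) : Set (Fin n → ℝ)) :=
        hK.inter_halfSpace hh
      have sat₂ : Saturated H ((K ⊓ halfSpace (-h) : PointedCone ℝ (Fin n → ℝ)) :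
        Set (Fin n → ℝ)) := hK.inter_halfSpace (hneg h hh)
      have sat₀ : Saturated H ((K ⊓ halfSpace h ⊓ halfSpace (-h) : PointedCone ℝ (Fin n → ℝ)) :
        Set (Fin n → ℝ)) := sat₁.inter_halfSpace (hneg h hh)
      have lt₁ : (cellOf H '' ((K ⊓ halfSpace h : PointedCone ℝ (Fin n → ℝ)) :
          Set (Fin n → ℝ))).ncard < k := by
        rw [← hk]
        refine Set.ncard_lt_ncard ⟨Set.image_mono fun z hz => hz.1, fun hle => ?_⟩
          (Set.toFinite _)
        have h1 := sat₁.cellOf_mem_image.mp (hle ⟨y', hy', rfl⟩)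
        exact absurd (mem_halfSpace.mp h1.2) hhy'.not_ge
      have lt₂ : (cellOf H '' ((K ⊓ halfSpace (-h) : PointedCone ℝ (Fin n → ℝ)) :
          Set (Fin n → ℝ))).ncard < k := by
        rw [← hk]
        refine Set.ncard_lt_ncard ⟨Set.image_mono fun z hz => hz.1, fun hle => ?_⟩
          (Set.toFinite _)
        have h1 := mem_halfSpace.mp (sat₂.cellOf_mem_image.mp (hle ⟨y, hy, rfl⟩)).2
        rw [neg_dotProduct] at h1
        linarith
      have sub₀₁ : cellOf H '' ((K ⊓ halfSpace h ⊓ halfSpace (-h) : PointedCone ℝ (Fin n → ℝ)) :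
          Set (Fin n → ℝ)) ⊆ cellOf H '' ((K ⊓ halfSpace h : PointedCone ℝ (Fin n → ℝ)) :
          Set (Fin n → ℝ)) := Set.image_mono fun z hz => hz.1
      have sub₀₂ : cellOf H '' ((K ⊓ halfSpace h ⊓ halfSpace (-h) : PointedCone ℝ (Fin n → ℝ)) :
          Set (Fin n → ℝ)) ⊆ cellOf H '' ((K ⊓ halfSpace (-h) : PointedCone ℝ (Fin n → ℝ)) :
          Set (Fin n → ℝ)) := Set.image_mono fun z hz => ⟨hz.1.1, hz.2⟩
      have sub₁ : cellOf H '' ((K ⊓ halfSpace h : PointedCone ℝ (Fin n → ℝ)) :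
          Set (Fin n → ℝ)) ⊆ cellOf H '' (K : Set (Fin n → ℝ)) := Set.image_mono fun z hz => hz.1
      have sub₂ : cellOf H '' ((K ⊓ halfSpace (-h) : PointedCone ℝ (Fin n → ℝ)) :
          Set (Fin n → ℝ)) ⊆ cellOf H '' (K : Set (Fin n → ℝ)) := Set.image_mono fun z hz => hz.1
      have lt₀ := (Set.ncard_le_ncard sub₀₁ (Set.toFinite _)).trans_lt lt₁
      have p₁ := ih _ lt₁ _ sat₁ rfl
      have p₂ := ih _ lt₂ _ sat₂ rfl
      have p₀ := ih _ lt₀ _ sat₀ rfl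
      rw [polyVanishing_inf_halfSpace hy hhy] at p₁
      rw [polyVanishing_inf_halfSpace hy' hhy''] at p₂
      -- The Mayer–Vietoris sequence 0 → F(K) → F(K⁺) × F(K⁻) → F(K⁰) → 0. Flabbiness gives
      -- surjectivity on the right. The ideal of K⁰ is that of K plus one regular linear form.
      refine RelProjective.ker (linPoly_regular hy hhy) (polyVanishing_hyperplane hy hhy hy' hhy')
        (p₁.prod p₂) p₀ ((F.secsRes sub₁).prod (F.secsRes sub₂))
        (F.secsRes sub₀₁ ∘ₗ LinearMap.fst _ _ _ - F.secsRes sub₀₂ ∘ₗ LinearMap.snd _ _ _) ?_ ?_ ?_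
      · intro a b hab
        have h1 : F.secsRes sub₁ a = F.secsRes sub₁ b := congrArg Prod.fst hab
        have h2 : F.secsRes sub₂ a = F.secsRes sub₂ b := congrArg Prod.snd hab
        refine Subtype.ext (funext fun s => ?_)
        obtain ⟨_, z, hz, rfl⟩ := s
        rcases le_total 0 (h ⬝ᵥ z) with hz' | hz'
        · exact congrFun (congrArg Subtype.val h1) ⟨cellOf H z, z, ⟨hz, hz'⟩, rfl⟩
        · exact congrFun (congrArg Subtype.val h2) ⟨cellOf H z, z, ⟨hz, by
            change 0 ≤ -h ⬝ᵥ z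
            rw [neg_dotProduct]
            linarith⟩, rfl⟩
      · intro a
        obtain ⟨b, hb⟩ := hF.secsRes_surjective sub₀₁ sat₀.isLowerSet a
        refine ⟨(b, 0), ?_⟩
        simp [hb]
      · rintro ⟨a, b⟩
        constructor
        · intro hab
          have hab' : F.secsRes sub₀₁ a = F.secsRes sub₀₂ b := sub_eq_zero.mp hab
          have hab'' : ∀ s (h₁ : s ∈ _) (h₂ : s ∈ _), a.1 ⟨s, h₁⟩ = b.1 ⟨s, h₂⟩ := fun s h₁ h₂ => by
            obtain ⟨z, rfl⟩ := exists_cellOf s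
            have hz₁ := sat₁.cellOf_mem_image.mp h₁
            have hz₂ := sat₂.cellOf_mem_image.mp h₂
            exact congrFun (congrArg Subtype.val hab') ⟨cellOf H z, z, ⟨hz₁, hz₂.2⟩, rfl⟩
          have hcov : ∀ s ∈ cellOf H '' (K : Set (Fin n → ℝ)),
              s ∉ cellOf H '' ((K ⊓ halfSpace h : PointedCone ℝ (Fin n → ℝ)) : Set (Fin n → ℝ)) →
              s ∈ cellOf H '' ((K ⊓ halfSpace (-h) : PointedCone ℝ (Fin n → ℝ)) :
                Set (Fin n → ℝ)) := by
            rintro _ ⟨z, hz, rfl⟩ hn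
            refine ⟨z, ⟨hz, ?_⟩, rfl⟩
            have h1 : ¬ 0 ≤ h ⬝ᵥ z := fun h0 => hn ⟨z, ⟨hz, h0⟩, rfl⟩
            change 0 ≤ -h ⬝ᵥ z
            rw [neg_dotProduct]
            linarith
          classical
          refine ⟨⟨fun s => if h₁ : s.1 ∈ _ then a.1 ⟨s.1, h₁⟩ else b.1 ⟨s.1, hcov s.1 s.2 h₁⟩,
            fun s t hts => ?_⟩, ?_⟩
          · by_cases h₁ : s.1 ∈ cellOf H '' ((K ⊓ halfSpace h : PointedCone ℝ (Fin n → ℝ)) :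
                Set (Fin n → ℝ))
            · have h₂ := sat₁.isLowerSet hts h₁
              simp only [h₁, h₂, dif_pos]
              exact a.2 ⟨s.1, h₁⟩ ⟨t.1, h₂⟩ hts
            · have h₂ := hcov s.1 s.2 h₁
              have h₃ := sat₂.isLowerSet hts h₂
              have h₄ := b.2 ⟨s.1, h₂⟩ ⟨t.1, h₃⟩ hts
              simp only [h₁, dif_neg, not_false_iff]
              rw [h₄]
              split_ifs with h₅
              · exact (hab'' _ _ _).symm
              · rfl
          · refine Prod.ext (Subtype.ext (funext fun s => ?_)) (Subtype.ext (funext fun s => ?_))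
            · exact dif_pos s.2
            · change dite _ _ _ = _
              split_ifs with h₅
              · exact hab'' _ _ _
              · rfl
        · rintro ⟨e, he⟩
          obtain ⟨rfl, rfl⟩ := Prod.ext_iff.mp he
          exact sub_eq_zero.mpr rfl
    · push Not at hcut
      classical
      -- Now every form in `H` has a constant weak sign on K. A sum of points, one making each form
      -- negative where that is possible, lies in the relative interior, so K is the single closed
      -- cell of that sum and its sections are one stalk.
      have hw : ∀ h : Fin n → ℝ, ∃ y ∈ K, (∃ z ∈ K, h ⬝ᵥ z < 0) → h ⬝ᵥ y < 0 := fun h => by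
        by_cases hz : ∃ z ∈ K, h ⬝ᵥ z < 0
        · obtain ⟨z, hz, hz'⟩ := hz
          exact ⟨z, hz, fun _ => hz'⟩
        · exact ⟨0, K.zero_mem, fun h => absurd h hz⟩
      choose y hy hy' using hw
      let x : Fin n → ℝ := ∑ h ∈ hH.toFinset, y h
      have hx : x ∈ K := K.sum_mem fun h _ => hy h
      have hmax : ∀ z ∈ K, cellOf H z ≤ cellOf H x := fun z hz => by
        refine cellOf_le_iff.mpr fun h hh hhx => ?_
        by_contra hneg'
        rw [not_le] at hneg'
        have h1 : ∀ z ∈ K, h ⬝ᵥ z ≤ 0 := fun w hw => by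
          by_contra h0
          exact absurd hneg' (hcut h hh ⟨w, hw, not_le.mp h0⟩ z hz).not_gt
        have h2 : h ⬝ᵥ x < 0 := by
          rw [dotProduct_sum]
          exact Finset.sum_neg' (fun k _ => h1 _ (hy k))
            ⟨h, hH.mem_toFinset.mpr hh, hy' h ⟨z, hz, hneg'⟩⟩
        linarith
      have hKx : (K : Set (Fin n → ℝ)) = {z | cellOf H z ≤ cellOf H x} :=
        Set.ext fun z => ⟨fun hz => hmax z hz, fun hz => hK x hx z hz⟩
      have hI : polyVanishing (K : Set (Fin n → ℝ)) = cellIdeal (cellOf H x) := by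
        rw [hKx, cellIdeal]
      rw [hI]
      have hmaxs : ∀ s : cellOf H '' (K : Set (Fin n → ℝ)), s.1 ≤ cellOf H x := by
        rintro ⟨_, z, hz, rfl⟩
        exact hmax z hz
      refine (hproj (cellOf H x)).of_retract
        (LinearMap.proj (R := MvPolynomial (Fin n) ℝ) (φ := fun s : cellOf H '' (K : Set (Fin n → ℝ)) => F.obj s)
          ⟨cellOf H x, x, hx, rfl⟩ ∘ₗ Submodule.subtype _)
        ((LinearMap.pi fun s : cellOf H '' (K : Set (Fin n → ℝ)) => F.res (hmaxs s)).codRestrict _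
          fun e s t hts => F.res_res _ _ _)
        (LinearMap.ext fun e => Subtype.ext (funext fun s => e.2 ⟨cellOf H x, x, hx, rfl⟩ s _))

end Cells

/-! ### Locally free flabby systems on a fan -/

namespace ConvexFan

variable {n : ℕ} {Δ : ConvexFan n}

instance finite_cone : Finite Δ.Cone := Δ.finite.to_subtype

/-- For τ ⊆ σ the intersection is τ, which the fan axiom makes a face of σ. The fan space is thus
the finite poset of cones with lower sets as open sets, and `PosetSystem` applies. -/
theorem isFaceOf_iff_le {σ τ : Δ.Cone} : τ.1.IsFaceOf σ.1 ↔ τ ≤ σ :=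
  ⟨fun h => h.le, fun h => by
    have h1 := (Δ.inter_face τ.1 τ.2 σ.1 σ.2).2
    rwa [inf_eq_left.mpr (show τ.1 ≤ σ.1 from h)] at h1⟩

/-- The intersection of two cones of the fan. -/
def infCone (σ τ : Δ.Cone) : Δ.Cone :=
  ⟨σ.1 ⊓ τ.1, Δ.face_mem σ.1 σ.2 _ (Δ.inter_face σ.1 σ.2 τ.1 τ.2).1⟩

theorem infCone_le_left (σ τ : Δ.Cone) : infCone σ τ ≤ σ := inf_le_left (a := σ.1)

theorem infCone_le_right (σ τ : Δ.Cone) : infCone σ τ ≤ τ := inf_le_right (a := σ.1)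

theorem bot_isFaceOf (σ : Δ.Cone) : (⊥ : PointedCone ℝ (Fin n → ℝ)).IsFaceOf σ.1 where
  le := bot_le
  mem_of_smul_add_mem := fun {x y a} hx hy ha hxy => by
    by_contra hx0
    have h0 : a • x + y = 0 := hxy
    refine Δ.strictlyConvex σ.1 σ.2 x hx (fun h => hx0 h) ?_
    have h1 : -x = a⁻¹ • y := by
      rw [eq_neg_of_add_eq_zero_right h0, smul_neg, smul_smul, inv_mul_cancel₀ ha.ne', one_smul]
    rw [h1]
    exact PointedCone.smul_mem σ.1 (inv_nonneg.mpr ha.le) hy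

variable (Δ) in
/-- The zero cone of a fan. -/
def zeroCone : Δ.Cone := ⟨⊥, by
  obtain ⟨σ, hσ⟩ := Δ.nonempty
  exact Δ.face_mem σ hσ _ (bot_isFaceOf ⟨σ, hσ⟩)⟩

theorem zeroCone_le (σ : Δ.Cone) : Δ.zeroCone ≤ σ := bot_le (a := σ.1)

variable (Δ) in
-- Collect the inequalities defining all cones of Δ, together with their negatives. Membership in a
-- cone then depends only on the signs of these forms.
theorem exists_arrangement : ∃ H : Set (Fin n → ℝ), H.Finite ∧ (∀ h ∈ H, -h ∈ H) ∧
    ∀ σ : Δ.Cone, Saturated H (σ.1 : Set (Fin n → ℝ)) := by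
  choose T hT hTz using fun σ : Δ.Cone => fg_exists_halfSpaces σ.1 (Δ.polyhedral σ.1 σ.2)
  refine ⟨⋃ σ, (T σ ∪ -T σ), Set.finite_iUnion fun σ => (hT σ).union (hT σ).neg, fun h hh => ?_,
    fun σ y hy z hz => ?_⟩
  · obtain ⟨σ, hσ⟩ := Set.mem_iUnion.mp hh
    refine Set.mem_iUnion.mpr ⟨σ, ?_⟩
    rcases hσ with hσ | hσ
    · exact Or.inr (by simpa using hσ)
    · exact Or.inl hσ
  · refine (hTz σ z).mpr fun h hh => cellOf_le_iff.mp hz h (Set.mem_iUnion.mpr ⟨σ, Or.inl hh⟩) ?_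
    exact (hTz σ y).mp hy h hh

section Pushforward

variable {H : Set (Fin n → ℝ)} (F : PosetSystem.{0, 0} (MvPolynomial (Fin n) ℝ) (CellPoset H))

variable (Δ) in
/-- The direct image on `Δ` of a system on the cells of an arrangement which refines `Δ`. -/
noncomputable def pushforward : PosetSystem.{0, 0} (MvPolynomial (Fin n) ℝ) Δ.Cone where
  obj σ := F.secs (cellOf H '' (σ.1 : Set (Fin n → ℝ)))
  res {σ τ} h := F.secsRes (Set.image_mono (show (τ.1 : Set (Fin n → ℝ)) ⊆ σ.1 from h))
  res_refl _ _ := rfl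
  res_res _ _ _ := rfl

variable {F}

/-- A cell lying in two cones lies in their intersection, which is again a cone of the fan, and both
values restrict to the value there. -/
theorem pushforward_apply_eq (hsat : ∀ σ : Δ.Cone, Saturated H (σ.1 : Set (Fin n → ℝ)))
    {y : ∀ σ, (Δ.pushforward F).obj σ} {S : Set Δ.Cone} (hy : (Δ.pushforward F).CompatOn S y)
    {σ τ : Δ.Cone} (hσ : σ ∈ S) (hτ : τ ∈ S) (s : CellPoset H)
    (hsσ : s ∈ cellOf H '' (σ.1 : Set (Fin n → ℝ))) (hsτ : s ∈ cellOf H '' (τ.1 : Set (Fin n → ℝ))) :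
    (y σ).1 ⟨s, hsσ⟩ = (y τ).1 ⟨s, hsτ⟩ := by
  obtain ⟨z, rfl⟩ := exists_cellOf s
  have hz : cellOf H z ∈ cellOf H '' ((infCone σ τ).1 : Set (Fin n → ℝ)) :=
    ⟨z, ⟨(hsat σ).cellOf_mem_image.mp hsσ, (hsat τ).cellOf_mem_image.mp hsτ⟩, rfl⟩
  have h1 := congrFun (congrArg Subtype.val (hy σ hσ _ (infCone_le_left σ τ))) ⟨_, hz⟩
  have h2 := congrFun (congrArg Subtype.val (hy τ hτ _ (infCone_le_right σ τ))) ⟨_, hz⟩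
  exact h1.trans h2.symm

/-- Compatible sections on the proper faces of a cone glue to one section over the lower set of
cells in its boundary, which flabbiness on the cells extends to the cone. -/
theorem pushforward_flabby (hH : H.Finite) (hF : F.Flabby)
    (hsat : ∀ σ : Δ.Cone, Saturated H (σ.1 : Set (Fin n → ℝ))) : (Δ.pushforward F).Flabby := by
  intro σ y hy
  have := finite_cellPoset hH
  let D : Set (CellPoset H) := {s | ∃ τ < σ, s ∈ cellOf H '' (τ.1 : Set (Fin n → ℝ))}
  have hD : IsLowerSet D := fun s t hts ⟨τ, hτ, hs⟩ => ⟨τ, hτ, (hsat τ).isLowerSet hts hs⟩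
  have hDσ : D ⊆ cellOf H '' (σ.1 : Set (Fin n → ℝ)) := fun s ⟨τ, hτ, hs⟩ =>
    Set.image_mono (show (τ.1 : Set (Fin n → ℝ)) ⊆ σ.1 from hτ.le) hs
  choose τ hτ hsτ using fun s : D => s.2
  obtain ⟨z, hz⟩ := hF.secsRes_surjective hDσ hD ⟨fun s => (y (τ s)).1 ⟨s.1, hsτ s⟩,
    fun s t hts => by
      have ht : t.1 ∈ cellOf H '' ((τ s).1 : Set (Fin n → ℝ)) := (hsat _).isLowerSet hts (hsτ s)
      exact ((y (τ s)).2 ⟨s.1, hsτ s⟩ ⟨t.1, ht⟩ hts).trans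
        (pushforward_apply_eq hsat hy (hτ t) (hτ s) t.1 (hsτ t) ht).symm⟩
  refine ⟨z, fun ρ hρ => Subtype.ext (funext fun s => ?_)⟩
  have h1 := congrFun (congrArg Subtype.val hz) ⟨s.1, ρ, hρ, s.2⟩
  exact h1.trans (pushforward_apply_eq hsat hy (hτ _) hρ s.1 (hsτ _) s.2)

/-- By completeness every cell lies in some cone, so global sections on Δ are sections over all
cells. The whole space is a convex union of cells with vanishing ideal 0. -/
theorem pushforward_relProjective_secs (hΔ : Δ.IsComplete) (hH : H.Finite)
    (hneg : ∀ h ∈ H, -h ∈ H) (hF : F.Flabby)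
    (hproj : ∀ s, RelProjective.{0, 0, 0} (cellIdeal s) (F.obj s))
    (hsat : ∀ σ : Δ.Cone, Saturated H (σ.1 : Set (Fin n → ℝ))) :
    RelProjective.{0, 0, 0} (⊥ : Ideal (MvPolynomial (Fin n) ℝ))
      ((Δ.pushforward F).secs Set.univ) := by
  have h1 := relProjective_secs hH hneg F hF hproj ⊤ (fun _ _ _ _ => trivial)
  have h2 : polyVanishing ((⊤ : PointedCone ℝ (Fin n → ℝ)) : Set (Fin n → ℝ)) = ⊥ :=
    polyVanishing_univ
  rw [h2] at h1
  have hex : ∀ s : CellPoset H, ∃ σ : Δ.Cone, s ∈ cellOf H '' (σ.1 : Set (Fin n → ℝ)) := fun s => by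
    obtain ⟨z, rfl⟩ := exists_cellOf s
    obtain ⟨σ, hσ, hz⟩ := hΔ z
    exact ⟨⟨σ, hσ⟩, z, hz, rfl⟩
  choose c hc using hex
  have heq : ∀ (y : (Δ.pushforward F).secs Set.univ) (σ τ : Δ.Cone) (s : CellPoset H)
      (hσ : s ∈ cellOf H '' (σ.1 : Set (Fin n → ℝ))) (hτ : s ∈ cellOf H '' (τ.1 : Set (Fin n → ℝ))),
      (y.1 ⟨σ, trivial⟩).1 ⟨s, hσ⟩ = (y.1 ⟨τ, trivial⟩).1 ⟨s, hτ⟩ := fun y σ τ s hσ hτ =>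
    pushforward_apply_eq hsat (y := fun σ => y.1 ⟨σ, trivial⟩) (S := Set.univ)
      (fun σ _ τ h => y.2 ⟨σ, trivial⟩ ⟨τ, trivial⟩ h) trivial trivial s hσ hτ
  refine h1.of_retract
    { toFun := fun y => ⟨fun s => (y.1 ⟨c s.1, trivial⟩).1 ⟨s.1, hc s.1⟩, fun s t hts => ?_⟩
      map_add' := fun _ _ => rfl
      map_smul' := fun _ _ => rfl }
    { toFun := fun y => ⟨fun σ => F.secsRes (Set.image_mono (Set.subset_univ _)) y,
        fun _ _ _ => rfl⟩
      map_add' := fun _ _ => rfl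
      map_smul' := fun _ _ => rfl } ?_
  · have ht : t.1 ∈ cellOf H '' ((c s.1).1 : Set (Fin n → ℝ)) := (hsat _).isLowerSet hts (hc s.1)
    exact ((y.1 ⟨c s.1, trivial⟩).2 ⟨s.1, hc s.1⟩ ⟨t.1, ht⟩ hts).trans
      (heq y (c t.1) (c s.1) t.1 (hc t.1) ht).symm
  · refine LinearMap.ext fun y => Subtype.ext (funext fun σ => Subtype.ext (funext fun s => ?_))
    exact heq y (c s.1) σ.1 s.1 (hc s.1) s.2

/-- Because the zero cone is a union of cells, the cell of the origin is {0} and the stalk is a free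
module over the residue ring. The retract is one coordinate of it; the index 0 is an arbitrary
choice. -/
theorem pushforward_zeroCone_retract
    (hF0 : ∀ s, Nonempty (F.obj s ≃ₗ[MvPolynomial (Fin n) ℝ] MvPolynomial (Fin n) ℝ →₀
      MvPolynomial (Fin n) ℝ ⧸ cellIdeal s))
    (hsat : ∀ σ : Δ.Cone, Saturated H (σ.1 : Set (Fin n → ℝ))) :
    ∃ (i : (MvPolynomial (Fin n) ℝ ⧸ polyVanishing {(0 : Fin n → ℝ)}) →ₗ[MvPolynomial (Fin n) ℝ]
        (Δ.pushforward F).obj Δ.zeroCone)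
      (p : (Δ.pushforward F).obj Δ.zeroCone →ₗ[MvPolynomial (Fin n) ℝ]
        (MvPolynomial (Fin n) ℝ ⧸ polyVanishing {(0 : Fin n → ℝ)})), ∀ y, p (i y) = y := by
  obtain ⟨e⟩ := hF0 (cellOf H 0)
  have hI : polyVanishing {(0 : Fin n → ℝ)} = cellIdeal (cellOf H 0) := by
    refine congrArg polyVanishing (Set.ext fun z => ⟨?_, fun hz => ?_⟩)
    · rintro rfl
      exact le_refl (cellOf H 0)
    · exact hsat Δ.zeroCone 0 (Submodule.zero_mem _) z hz
  let q := Submodule.quotEquivOfEq _ _ hI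
  have hmem : ∀ s : cellOf H '' (Δ.zeroCone.1 : Set (Fin n → ℝ)), s.1 ≤ cellOf H 0 := by
    rintro ⟨_, z, hz, rfl⟩
    obtain rfl : z = 0 := hz
    exact le_refl (cellOf H 0)
  let a : F.obj (cellOf H 0) →ₗ[MvPolynomial (Fin n) ℝ] (Δ.pushforward F).obj Δ.zeroCone :=
    (LinearMap.pi fun s : cellOf H '' (Δ.zeroCone.1 : Set (Fin n → ℝ)) =>
      F.res (hmem s)).codRestrict _ fun e s t hts => F.res_res _ _ _
  have h0 : cellOf H 0 ∈ cellOf H '' (Δ.zeroCone.1 : Set (Fin n → ℝ)) :=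
    ⟨0, Submodule.zero_mem Δ.zeroCone.1, rfl⟩
  let b : (Δ.pushforward F).obj Δ.zeroCone →ₗ[MvPolynomial (Fin n) ℝ] F.obj (cellOf H 0) :=
    LinearMap.proj (R := MvPolynomial (Fin n) ℝ)
      (φ := fun s : cellOf H '' (Δ.zeroCone.1 : Set (Fin n → ℝ)) => F.obj s) ⟨cellOf H 0, h0⟩ ∘ₗ
      Submodule.subtype _
  have hba : ∀ y, b (a y) = y := fun y => F.res_refl _ _
  refine ⟨a ∘ₗ e.symm.toLinearMap ∘ₗ Finsupp.lsingle 0 ∘ₗ q.toLinearMap,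
    q.symm.toLinearMap ∘ₗ Finsupp.lapply 0 ∘ₗ e.toLinearMap ∘ₗ b, fun y => ?_⟩
  simp [hba]

end Pushforward

/-- On a complete fan there is a flabby system which is locally projective and whose module of
global sections is projective. -/
theorem exists_flabby_projective (hΔ : Δ.IsComplete) :
    ∃ N : PosetSystem.{0, 0} (MvPolynomial (Fin n) ℝ) Δ.Cone, N.Flabby ∧
      (∀ σ, RelProjective.{0, 0, 0} (polyVanishing (σ.1 : Set (Fin n → ℝ))) (N.obj σ)) ∧
      RelProjective.{0, 0, 0} (⊥ : Ideal (MvPolynomial (Fin n) ℝ)) (N.secs Set.univ) ∧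
      ∃ (i : (MvPolynomial (Fin n) ℝ ⧸ polyVanishing {(0 : Fin n → ℝ)})
          →ₗ[MvPolynomial (Fin n) ℝ] N.obj Δ.zeroCone)
        (p : N.obj Δ.zeroCone →ₗ[MvPolynomial (Fin n) ℝ]
          (MvPolynomial (Fin n) ℝ ⧸ polyVanishing {(0 : Fin n → ℝ)})), ∀ y, p (i y) = y := by
  obtain ⟨H, hH, hneg, hsat⟩ := Δ.exists_arrangement
  have := finite_cellPoset hH
  obtain ⟨F, hF, hF0⟩ := PosetSystem.exists_flabby_free (cellIdeal (H := H)) cellIdeal_mono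
  have hproj : ∀ s, RelProjective.{0, 0, 0} (cellIdeal s) (F.obj s) := fun s =>
    relProjective_finsupp _ _ (hF0 s).some
  exact ⟨Δ.pushforward F, pushforward_flabby hH hF hsat,
    fun σ => relProjective_secs hH hneg F hF hproj σ.1 (hsat σ),
    pushforward_relProjective_secs hΔ hH hneg hF hproj hsat,
    pushforward_zeroCone_retract hF0 hsat⟩

end ConvexFan

/-! ### Graded vector spaces -/

section Graded

variable {M : Type u} [AddCommGroup M] [Module ℝ M] {gr : ℕ → Submodule ℝ M}

/-- The projection to a homogeneous component. -/
noncomputable def grProj (h : DirectSum.IsInternal gr) (q : ℕ) : M →ₗ[ℝ] M :=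
  (gr q).subtype ∘ₗ DirectSum.component ℝ ℕ (fun i => gr i) q ∘ₗ
    (LinearEquiv.ofBijective (DirectSum.coeLinearMap gr) h).symm.toLinearMap

theorem grProj_mem (h : DirectSum.IsInternal gr) (q : ℕ) (s : M) : grProj h q s ∈ gr q :=
  Subtype.coe_prop _

theorem grProj_of_mem (h : DirectSum.IsInternal gr) {p : ℕ} (q : ℕ) {s : M} (hs : s ∈ gr p) :
    grProj h q s = if p = q then s else 0 := by
  have h1 : (LinearEquiv.ofBijective (DirectSum.coeLinearMap gr) h).symm s =
      DirectSum.lof ℝ ℕ (fun i => gr i) p ⟨s, hs⟩ :=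
    (LinearEquiv.symm_apply_eq _).mpr (DirectSum.coeLinearMap_lof gr p ⟨s, hs⟩).symm
  simp only [grProj, LinearMap.comp_apply, LinearEquiv.coe_coe, h1]
  split_ifs with hpq
  · subst hpq
    rw [DirectSum.component.lof_self, Submodule.subtype_apply]
  · rw [DirectSum.component.of, dif_neg hpq, map_zero]

theorem grProj_self (h : DirectSum.IsInternal gr) {q : ℕ} {s : M} (hs : s ∈ gr q) :
    grProj h q s = s := by rw [grProj_of_mem h q hs, if_pos rfl]

theorem mem_span_homogeneous (h : DirectSum.IsInternal gr) (s : M) :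
    s ∈ Submodule.span ℝ {y | ∃ p, y ∈ gr p} := by
  have h1 : s ∈ iSup gr := h.submodule_iSup_eq_top ▸ Submodule.mem_top
  refine (iSup_le fun p => ?_ : iSup gr ≤ _) h1
  exact fun y hy => Submodule.subset_span ⟨p, hy⟩

/-- A homogeneous combination of homogeneous elements is a combination of those of its degree. -/
theorem mem_span_inter_of_homogeneous (h : DirectSum.IsInternal gr) {Y : Set M}
    (hY : ∀ y ∈ Y, ∃ p, y ∈ gr p) {q : ℕ} {s : M} (hs : s ∈ gr q) (hsY : s ∈ Submodule.span ℝ Y) :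
    s ∈ Submodule.span ℝ (Y ∩ gr q) := by
  rw [← grProj_self h hs]
  clear hs
  induction hsY using Submodule.span_induction with
  | mem y hy =>
    obtain ⟨p, hp⟩ := hY y hy
    rw [grProj_of_mem h q hp]
    split_ifs with hpq
    · exact Submodule.subset_span ⟨hy, hpq ▸ hp⟩
    · exact Submodule.zero_mem _
  | zero => rw [map_zero]; exact Submodule.zero_mem _
  | add a b _ _ ha hb => rw [map_add]; exact Submodule.add_mem _ ha hb
  | smul r a _ ha => rw [map_smul]; exact Submodule.smul_mem _ _ ha

theorem eq_zero_of_mem_gr_of_mem_gr (h : DirectSum.IsInternal gr) {p q : ℕ} (hpq : p ≠ q) {s : M}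
    (hp : s ∈ gr p) (hq : s ∈ gr q) : s = 0 := by
  rw [← grProj_self h hq, grProj_of_mem h q hp, if_neg hpq]

end Graded

/-! ### Algebra near the origin: the maximal ideal, determinants, regular elements. -/

theorem mem_ker_constantCoeff_iff {n : ℕ} {p : MvPolynomial (Fin n) ℝ} :
    p ∈ RingHom.ker (MvPolynomial.constantCoeff (R := ℝ) (σ := Fin n)) ↔
      p ∈ Ideal.span (Set.range (MvPolynomial.X : Fin n → MvPolynomial (Fin n) ℝ)) := by
  rw [RingHom.mem_ker, ← Set.image_univ, MvPolynomial.mem_ideal_span_X_image]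
  constructor
  · intro h m hm
    by_contra! hc
    have h0 : m = 0 := Finsupp.ext fun i => hc i trivial
    rw [h0, MvPolynomial.mem_support_iff] at hm
    exact hm h
  · intro h
    by_contra hc
    obtain ⟨i, -, hi⟩ := h 0 (MvPolynomial.mem_support_iff.mpr hc)
    exact hi rfl

/-- An endomorphism of a finite free module is injective if a regular multiple of every element is in
its range. -/
theorem injective_of_forall_smul_mem_range {R : Type*} [CommRing R] {M : Type*} [AddCommGroup M]
    [Module R M] [Module.Free R M] [Module.Finite R M] (θ : M →ₗ[R] M) (d : R)
    (hd : ∀ v : M, d • v = 0 → v = 0) (h : ∀ v, ∃ w, θ w = d • v) : Function.Injective θ := by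
  classical
  rcases subsingleton_or_nontrivial R with hR | hR
  · have := Module.subsingleton R M
    exact Function.injective_of_subsingleton θ
  let b := Module.Free.chooseBasis R M
  choose g hg using h
  let ψ : M →ₗ[R] M := b.constr ℕ fun i => g (b i)
  -- Hence det θ · det ψ = d^rank. By the adjugate, det θ kills the kernel of θ, so d^rank does as
  -- well, and regularity of d finishes the argument.
  have h1 : θ ∘ₗ ψ = d • LinearMap.id := b.ext fun i => by simp [ψ, hg]
  have h2 : LinearMap.toMatrix b b θ * LinearMap.toMatrix b b ψ = d • 1 := by
    rw [← LinearMap.toMatrix_comp, h1, map_smul, LinearMap.toMatrix_id]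
  have h3 := congrArg Matrix.det h2
  rw [Matrix.det_mul, Matrix.det_smul, Matrix.det_one, mul_one] at h3
  have hpow : ∀ (k : ℕ) (v : M), d ^ k • v = 0 → v = 0 := fun k => by
    induction k with
    | zero => intro v hv; rwa [pow_zero, one_smul] at hv
    | succ k ih => intro v hv; rw [pow_succ, mul_smul] at hv; exact hd v (ih _ hv)
  rw [injective_iff_map_eq_zero]
  intro v hv
  refine hpow (Fintype.card (Module.Free.ChooseBasisIndex R M)) v (b.repr.injective ?_)
  rw [← h3, map_zero, map_smul, mul_comm, mul_smul]
  have h4 : (LinearMap.toMatrix b b θ).mulVec (b.repr v) = 0 := by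
    rw [LinearMap.toMatrix_mulVec_repr, hv, map_zero]
    rfl
  have h5 := congrArg (Matrix.mulVec (LinearMap.toMatrix b b θ).adjugate) h4
  rw [Matrix.mulVec_mulVec, Matrix.adjugate_mul, Matrix.smul_mulVec, Matrix.one_mulVec,
    Matrix.mulVec_zero] at h5
  have h6 : (LinearMap.toMatrix b b θ).det • b.repr v = 0 := by
    ext i
    exact congrFun h5 i
  rw [h6, smul_zero]

/-- A polynomial which does not vanish at the origin is regular modulo the ideal of a cone. -/
theorem mem_polyVanishing_of_mul {n : ℕ} {K : PointedCone ℝ (Fin n → ℝ)}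
    {d p : MvPolynomial (Fin n) ℝ} (hd : d.constantCoeff ≠ 0)
    (h : d * p ∈ polyVanishing (K : Set (Fin n → ℝ))) : p ∈ polyVanishing (K : Set (Fin n → ℝ)) := by
  intro z hz
  -- Restriction to the line through 0 and z lands in a domain, and d stays nonzero there because
  -- its value at the origin is nonzero.
  let ρ : MvPolynomial (Fin n) ℝ →ₐ[ℝ] Polynomial ℝ :=
    MvPolynomial.aeval fun i => Polynomial.X * Polynomial.C (z i)
  have hρ : ∀ q t, (ρ q).eval t = MvPolynomial.eval (t • z) q := fun q t => by
    have key : (Polynomial.evalRingHom t).comp ρ.toRingHom = MvPolynomial.eval (t • z) := by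
      ext
      · simp [ρ]
      · simp [ρ]
        ring
    exact RingHom.congr_fun key q
  have h1 : ρ d * ρ p = 0 := by
    refine Polynomial.eq_zero_of_infinite_isRoot _ ((Set.Ici_infinite (0 : ℝ)).mono fun t ht => ?_)
    rw [← map_mul]
    exact (hρ _ t).trans (h _ (PointedCone.smul_mem K ht hz))
  rcases mul_eq_zero.mp h1 with h2 | h2
  · have h3 := hρ d 0
    rw [h2, Polynomial.eval_zero, zero_smul, MvPolynomial.eval_zero] at h3
    exact absurd h3.symm hd
  · have h3 := hρ p 1
    rwa [h2, Polynomial.eval_zero, one_smul, eq_comm] at h3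

/-! ### Sheaves on a fan as systems of modules over the polynomial ring. -/

namespace ConvexFan

variable {n : ℕ} {Δ : ConvexFan n}

theorem affineFan_mono {σ τ : Δ.Cone} (h : τ ≤ σ) : affineFan τ ≤ affineFan σ :=
  fun _ hρ => hρ.trans (isFaceOf_iff_le.mpr h)

theorem mem_affineFan {σ τ : Δ.Cone} : τ ∈ affineFan σ ↔ τ ≤ σ := isFaceOf_iff_le

theorem mem_boundaryFan {σ τ : Δ.Cone} : τ ∈ boundaryFan σ ↔ τ < σ := by
  rw [lt_iff_le_and_ne, ← mem_affineFan]
  exact Iff.rfl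

theorem affineFan_le {Λ : Opens Δ.Cone} {σ : Δ.Cone} (h : σ ∈ Λ) : affineFan σ ≤ Λ :=
  fun τ hτ => Λ.isOpen σ h τ hτ

theorem support_affineFan (σ : Δ.Cone) : support (affineFan σ) = σ.1 :=
  Set.ext fun _ => ⟨fun ⟨_, hτ, hz⟩ => hτ.le hz,
    fun hz => ⟨σ, mem_affineFan.mpr le_rfl, hz⟩⟩

/-- With the kernel computed next, this identifies A_σ with A modulo the vanishing ideal of σ, so
freeness over A_σ can be used over A. -/
theorem ofPoly_affineFan_surjective (σ : Δ.Cone) : Function.Surjective (ofPoly (affineFan σ)) := by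
  rintro ⟨f, hf⟩
  obtain ⟨p, hp⟩ := hf σ (mem_affineFan.mpr le_rfl)
  refine ⟨p, Subtype.ext (funext fun z => (hp z ?_).symm)⟩
  exact (support_affineFan σ).le z.2

theorem ofPoly_affineFan_eq_zero_iff (σ : Δ.Cone) (p : MvPolynomial (Fin n) ℝ) :
    ofPoly (affineFan σ) p = 0 ↔ p ∈ polyVanishing (σ.1 : Set (Fin n → ℝ)) := by
  constructor
  · intro h z hz
    have hz' : z ∈ support (affineFan σ) := by rwa [support_affineFan]
    exact congrFun (congrArg Subtype.val h) ⟨z, hz'⟩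
  · intro h
    refine Subtype.ext (funext fun z => h z ?_)
    exact (support_affineFan σ).le z.2

theorem isHomogeneousPoly_ofPoly {Λ : Opens Δ.Cone} {p : MvPolynomial (Fin n) ℝ} {q : ℕ}
    (hp : p.IsWeightedHomogeneous (fun _ => 2) q) : IsHomogeneousPoly (ofPoly Λ p) q :=
  fun _ _ => ⟨p, hp, fun _ _ => rfl⟩

namespace GradedSheaf

variable (E : GradedSheaf.{u} Δ)

/-- The action of the polynomial ring on the sections of a sheaf of `𝒜`-modules. -/
noncomputable instance polyModule (Λ : Opens Δ.Cone) : Module (MvPolynomial (Fin n) ℝ) (E.Sec Λ) :=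
  Module.compHom _ (ofPoly Λ).toRingHom

variable {E}

theorem poly_smul_def {Λ : Opens Δ.Cone} (p : MvPolynomial (Fin n) ℝ) (s : E.Sec Λ) :
    p • s = ofPoly Λ p • s := rfl

instance polyScalarTower (Λ : Opens Δ.Cone) : IsScalarTower ℝ (MvPolynomial (Fin n) ℝ) (E.Sec Λ) where
  smul_assoc _ _ _ := by rw [poly_smul_def, map_smul, smul_assoc, poly_smul_def]

theorem C_smul {Λ : Opens Δ.Cone} (r : ℝ) (s : E.Sec Λ) :
    (MvPolynomial.C r : MvPolynomial (Fin n) ℝ) • s = r • s := by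
  rw [← MvPolynomial.algebraMap_eq, algebraMap_smul]

variable (E) in
/-- Restriction as a homomorphism of modules over the polynomial ring. -/
noncomputable def resPoly {Λ Λ' : Opens Δ.Cone} (h : Λ' ≤ Λ) :
    E.Sec Λ →ₗ[MvPolynomial (Fin n) ℝ] E.Sec Λ' where
  toFun := E.res h
  map_add' := map_add _
  map_smul' _ s := E.res_smul h _ s

theorem res_poly_smul {Λ Λ' : Opens Δ.Cone} (h : Λ' ≤ Λ) (p : MvPolynomial (Fin n) ℝ)
    (s : E.Sec Λ) : E.res h (p • s) = p • E.res h s := (E.resPoly h).map_smul p s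

variable (E) in
/-- The system of the modules of sections over the affine subfans. -/
noncomputable abbrev stalks : PosetSystem.{0, u} (MvPolynomial (Fin n) ℝ) Δ.Cone where
  obj σ := E.Sec (affineFan σ)
  res h := E.resPoly (affineFan_mono h)
  res_refl _ := E.res_id _
  res_res h h' := E.res_comp (affineFan_mono h) (affineFan_mono h')

theorem iSup_affineFan (Λ : Opens Δ.Cone) : (⨆ σ : {σ // σ ∈ Λ}, affineFan σ.1) = Λ :=
  le_antisymm (iSup_le fun σ => affineFan_le σ.2) fun σ hσ =>
    Opens.mem_iSup.mpr ⟨⟨σ, hσ⟩, mem_affineFan.mpr le_rfl⟩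

/-- The affine subfans of the cones in Λ cover Λ, and two of them overlap in the affine subfan of
the intersection cone. Compatibility along faces is therefore the full gluing condition. -/
theorem exists_glue (Λ : Opens Δ.Cone) (y : ∀ σ, E.Sec (affineFan σ))
    (hy : E.stalks.CompatOn {σ | σ ∈ Λ} y) :
    ∃ s : E.Sec Λ, ∀ σ (hσ : σ ∈ Λ), E.res (affineFan_le hσ) s = y σ := by
  obtain ⟨t, ht, -⟩ := E.glue (fun σ : {σ // σ ∈ Λ} => affineFan σ.1) (fun σ => y σ.1) fun σ τ => by
    have h : affineFan σ.1 ⊓ affineFan τ.1 ≤ affineFan (infCone σ.1 τ.1) := fun ρ hρ =>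
      mem_affineFan.mpr (show ρ.1 ≤ (infCone σ.1 τ.1).1 from le_inf
        (mem_affineFan.mp hρ.1 : ρ.1 ≤ σ.1.1) (mem_affineFan.mp hρ.2 : ρ.1 ≤ τ.1.1))
    have h1 := hy σ.1 σ.2 _ (infCone_le_left σ.1 τ.1)
    have h2 := hy τ.1 τ.2 _ (infCone_le_right σ.1 τ.1)
    have h3 : E.res h (E.res (affineFan_mono (infCone_le_left σ.1 τ.1)) (y σ.1)) =
        E.res h (E.res (affineFan_mono (infCone_le_right σ.1 τ.1)) (y τ.1)) :=
      congrArg (E.res h) (h1.trans h2.symm)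
    rwa [E.res_comp, E.res_comp] at h3
  refine ⟨E.res (iSup_affineFan Λ).ge t, fun σ hσ => ?_⟩
  rw [E.res_comp]
  exact ht ⟨σ, hσ⟩

theorem sec_ext {Λ : Opens Δ.Cone} {s t : E.Sec Λ}
    (h : ∀ σ (hσ : σ ∈ Λ), E.res (affineFan_le hσ) s = E.res (affineFan_le hσ) t) : s = t := by
  have hU := iSup_affineFan Λ
  obtain ⟨y, -, hy⟩ := E.glue (fun σ : {σ // σ ∈ Λ} => affineFan σ.1)
    (fun σ => E.res (affineFan_le σ.2) s) fun σ τ => by rw [E.res_comp, E.res_comp]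
  have h1 := hy (E.res hU.le s) fun σ => by rw [E.res_comp]
  have h2 := hy (E.res hU.le t) fun σ => by rw [E.res_comp, h σ.1 σ.2]
  have h3 := congrArg (E.res hU.ge) (h1.trans h2.symm)
  rwa [E.res_comp, E.res_comp, E.res_id, E.res_id] at h3

/-! ### Nakayama's lemma -/

theorem mem_maxSub_iff {Λ : Opens Δ.Cone} (s : E.Sec Λ) :
    s ∈ E.maxSub Λ ↔ s ∈ RingHom.ker (MvPolynomial.constantCoeff (R := ℝ) (σ := Fin n)) •
      (⊤ : Submodule (MvPolynomial (Fin n) ℝ) (E.Sec Λ)) := by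
  constructor
  · intro h
    induction h using Submodule.span_induction with
    | mem y hy =>
      obtain ⟨p, hp, t, rfl⟩ := hy
      exact Submodule.smul_mem_smul (M := E.Sec Λ) (r := p) hp (Submodule.mem_top (x := t))
    | zero => exact Submodule.zero_mem _
    | add a b _ _ ha hb => exact Submodule.add_mem _ ha hb
    | smul r a _ ha =>
      rw [← C_smul]
      exact Submodule.smul_mem _ _ ha
  · intro h
    induction h using Submodule.smul_induction_on' with
    | smul p hp t _ => exact Submodule.subset_span ⟨p, hp, t, rfl⟩
    | add a _ b _ ha hb => exact Submodule.add_mem _ ha hb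

theorem poly_smul_mem_maxSub {Λ : Opens Δ.Cone} {p : MvPolynomial (Fin n) ℝ}
    (hp : p.constantCoeff = 0) (s : E.Sec Λ) : p • s ∈ E.maxSub Λ :=
  Submodule.subset_span ⟨p, hp, s, rfl⟩

theorem poly_smul_sub_mem_maxSub {Λ : Opens Δ.Cone} (p : MvPolynomial (Fin n) ℝ) (s : E.Sec Λ) :
    p • s - p.constantCoeff • s ∈ E.maxSub Λ := by
  rw [← C_smul, ← sub_smul]
  exact poly_smul_mem_maxSub (by simp) s

theorem X_smul_mem_gr {Λ : Opens Δ.Cone} (i : Fin n) {s : E.Sec Λ} {q : ℕ} (hs : s ∈ E.gr Λ q) :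
    (MvPolynomial.X i : MvPolynomial (Fin n) ℝ) • s ∈ E.gr Λ (2 + q) :=
  E.smul_mem_gr Λ _ s 2 q (isHomogeneousPoly_ofPoly (MvPolynomial.isWeightedHomogeneous_X _ _ _)) hs

theorem monomial_smul_mem_gr {Λ : Opens Δ.Cone} (α : Fin n →₀ ℕ) {s : E.Sec Λ} {q : ℕ}
    (hs : s ∈ E.gr Λ q) :
    (MvPolynomial.monomial α 1 : MvPolynomial (Fin n) ℝ) • s ∈
      E.gr Λ (Finsupp.weight (fun _ => 2) α + q) :=
  E.smul_mem_gr Λ _ s _ q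
    (isHomogeneousPoly_ofPoly (MvPolynomial.isWeightedHomogeneous_monomial _ _ _ rfl)) hs

/-- Generators that are a variable times a homogeneous section make induction on the degree possible
in Nakayama's lemma. -/
theorem maxSub_le_span_X_smul (Λ : Opens Δ.Cone) : E.maxSub Λ ≤ Submodule.span ℝ
    {y | ∃ (i : Fin n) (q : ℕ) (s : E.Sec Λ), s ∈ E.gr Λ q ∧
      y = (MvPolynomial.X i : MvPolynomial (Fin n) ℝ) • s} := by
  have hX : ∀ (i : Fin n) (s : E.Sec Λ), (MvPolynomial.X i : MvPolynomial (Fin n) ℝ) • s ∈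
      Submodule.span ℝ {y | ∃ (i : Fin n) (q : ℕ) (s : E.Sec Λ), s ∈ E.gr Λ q ∧
        y = (MvPolynomial.X i : MvPolynomial (Fin n) ℝ) • s} := fun i s => by
    have h1 := mem_span_homogeneous (E.gr_internal Λ) s
    induction h1 using Submodule.span_induction with
    | mem y hy =>
      obtain ⟨q, hq⟩ := hy
      exact Submodule.subset_span ⟨i, q, y, hq, rfl⟩
    | zero => rw [smul_zero]; exact Submodule.zero_mem _
    | add a b _ _ ha hb => rw [smul_add]; exact Submodule.add_mem _ ha hb
    | smul r a _ ha => rw [smul_comm]; exact Submodule.smul_mem _ _ ha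
  refine Submodule.span_le.mpr ?_
  rintro _ ⟨p, hp, s, rfl⟩
  have hp' := mem_ker_constantCoeff_iff.mp (RingHom.mem_ker.mpr hp)
  clear hp
  change p • s ∈ _
  induction hp' using Submodule.span_induction generalizing s with
  | mem y hy =>
    obtain ⟨i, rfl⟩ := hy
    exact hX i s
  | zero => rw [zero_smul]; exact Submodule.zero_mem _
  | add a b _ _ ha hb => rw [add_smul]; exact Submodule.add_mem _ (ha s) (hb s)
  | smul r a _ ha => rw [smul_eq_mul, mul_comm, mul_smul]; exact ha _

theorem poly_smul_mem_span_monomial {Λ : Opens Δ.Cone} (p : MvPolynomial (Fin n) ℝ) (s : E.Sec Λ) :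
    p • s ∈ Submodule.span ℝ (Set.range fun α : Fin n →₀ ℕ =>
      (MvPolynomial.monomial α 1 : MvPolynomial (Fin n) ℝ) • s) := by
  induction p using MvPolynomial.induction_on' with
  | monomial α r =>
    have h1 : (MvPolynomial.monomial α r : MvPolynomial (Fin n) ℝ) =
        r • MvPolynomial.monomial α 1 := by rw [MvPolynomial.smul_monomial, smul_eq_mul, mul_one]
    rw [h1, smul_assoc]
    exact Submodule.smul_mem _ _ (Submodule.subset_span ⟨α, rfl⟩)
  | add p q hp hq => rw [add_smul]; exact Submodule.add_mem _ hp hq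

theorem span_poly_le {Λ : Opens Δ.Cone} (T : Set (E.Sec Λ)) {s : E.Sec Λ}
    (hs : s ∈ Submodule.span (MvPolynomial (Fin n) ℝ) T) : s ∈ Submodule.span ℝ
      {y | ∃ (α : Fin n →₀ ℕ), ∃ t ∈ T, y = (MvPolynomial.monomial α 1 : MvPolynomial (Fin n) ℝ) • t} := by
  have hmem : ∀ (p : MvPolynomial (Fin n) ℝ), ∀ t ∈ T, p • t ∈ Submodule.span ℝ
      {y | ∃ (α : Fin n →₀ ℕ), ∃ t ∈ T,
        y = (MvPolynomial.monomial α 1 : MvPolynomial (Fin n) ℝ) • t} := fun p t ht => by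
    refine Submodule.span_mono ?_ (poly_smul_mem_span_monomial p t)
    rintro _ ⟨α, rfl⟩
    exact ⟨α, t, ht, rfl⟩
  induction hs using Submodule.closure_induction with
  | zero => exact Submodule.zero_mem _
  | add a b _ _ ha hb => exact Submodule.add_mem _ ha hb
  | smul_mem p t ht => exact hmem p t ht

/-- Nakayama's lemma for homogeneous generators. -/
theorem span_eq_top_of_homogeneous {Λ : Opens Δ.Cone} (T : Set (E.Sec Λ))
    (hT : ∀ t ∈ T, ∃ q, t ∈ E.gr Λ q)
    (h : ∀ s, ∃ t ∈ Submodule.span (MvPolynomial (Fin n) ℝ) T, s - t ∈ E.maxSub Λ) :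
    Submodule.span (MvPolynomial (Fin n) ℝ) T = ⊤ := by
  let Y : Set (E.Sec Λ) :=
    {y | ∃ (α : Fin n →₀ ℕ), ∃ t ∈ T, y = (MvPolynomial.monomial α 1 : MvPolynomial (Fin n) ℝ) • t} ∪
    {y | ∃ (i : Fin n) (q : ℕ) (s : E.Sec Λ), s ∈ E.gr Λ q ∧
      y = (MvPolynomial.X i : MvPolynomial (Fin n) ℝ) • s}
  have hY : ∀ y ∈ Y, ∃ q, y ∈ E.gr Λ q := by
    rintro _ (⟨α, t, ht, rfl⟩ | ⟨i, q, s, hs, rfl⟩)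
    · obtain ⟨q, hq⟩ := hT t ht
      exact ⟨_, monomial_smul_mem_gr α hq⟩
    · exact ⟨_, X_smul_mem_gr i hs⟩
  have hYs : ∀ s, s ∈ Submodule.span ℝ Y := fun s => by
    obtain ⟨t, ht, hst⟩ := h s
    rw [← sub_add_cancel s t]
    exact Submodule.add_mem _ (Submodule.span_mono Set.subset_union_right
      (maxSub_le_span_X_smul Λ hst)) (Submodule.span_mono Set.subset_union_left (span_poly_le T ht))
  have key : ∀ q, ∀ s ∈ E.gr Λ q, s ∈ Submodule.span (MvPolynomial (Fin n) ℝ) T := fun q => by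
    induction q using Nat.strong_induction_on with
    | _ q ih =>
      intro s hs
      have h1 := mem_span_inter_of_homogeneous (E.gr_internal Λ) hY hs (hYs s)
      have h2 : Submodule.span ℝ (Y ∩ E.gr Λ q) ≤
          (Submodule.span (MvPolynomial (Fin n) ℝ) T).restrictScalars ℝ := by
        refine Submodule.span_le.mpr ?_
        rintro _ ⟨⟨α, t, ht, rfl⟩ | ⟨i, p, y, hy, rfl⟩, hq⟩
        · exact Submodule.smul_mem _ _ (Submodule.subset_span ht)
        -- Either the cofactor of the variable has degree q - 2 and induction applies, or the
        -- product lies in two different degrees and is 0.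
        · by_cases hpq : 2 + p = q
          · exact Submodule.smul_mem _ _ (ih p (by omega) y hy)
          · have h0 := eq_zero_of_mem_gr_of_mem_gr (E.gr_internal Λ) hpq (X_smul_mem_gr i hy) hq
            simp only [h0]
            exact Submodule.zero_mem _
      exact h2 h1
  rw [eq_top_iff]
  intro s _
  have h1 := mem_span_homogeneous (E.gr_internal Λ) s
  have h2 : Submodule.span ℝ {y | ∃ p, y ∈ E.gr Λ p} ≤
      (Submodule.span (MvPolynomial (Fin n) ℝ) T).restrictScalars ℝ :=
    Submodule.span_le.mpr fun y ⟨p, hp⟩ => key p y hp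
  exact h2 h1

end GradedSheaf

end ConvexFan

/-! ### Freeness of the module of global sections -/

theorem RelProjective.eq_zero_of_smul_eq_zero {n : ℕ} {K : PointedCone ℝ (Fin n → ℝ)} {M : Type w}
    [AddCommGroup M] [Module (MvPolynomial (Fin n) ℝ) M]
    (h : RelProjective.{0, w, x} (polyVanishing (K : Set (Fin n → ℝ))) M)
    {d : MvPolynomial (Fin n) ℝ} (hd : d.constantCoeff ≠ 0) {v : M} (hv : d • v = 0) : v = 0 := by
  obtain ⟨X, i, p, hip⟩ := h
  have h1 : i v = 0 := by
    ext y
    obtain ⟨a, ha⟩ := Ideal.Quotient.mk_surjective (i v y)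
    have h2 : d • i v = 0 := by rw [← map_smul, hv, map_zero]
    have h3 : d • i v y = 0 := DFunLike.congr_fun h2 y
    rw [← ha] at h3
    have h4 : Ideal.Quotient.mk (polyVanishing (K : Set (Fin n → ℝ))) (d * a) = 0 := h3
    rw [← ha, Finsupp.zero_apply, Ideal.Quotient.eq_zero_iff_mem]
    exact mem_polyVanishing_of_mul hd (Ideal.Quotient.eq_zero_iff_mem.mp h4)
  have h2 := LinearMap.congr_fun hip v
  rw [LinearMap.comp_apply, h1, map_zero] at h2
  exact h2.symm

/-- Nakayama's lemma at the origin. -/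
theorem exists_smul_mem_of_mem_sup {n : ℕ} {M : Type*} [AddCommGroup M]
    [Module (MvPolynomial (Fin n) ℝ) M] [Module.Finite (MvPolynomial (Fin n) ℝ) M]
    (W : Submodule (MvPolynomial (Fin n) ℝ) M)
    (h : ∀ x : M, ∃ d : MvPolynomial (Fin n) ℝ, d.constantCoeff ≠ 0 ∧ d • x ∈
      W ⊔ RingHom.ker (MvPolynomial.constantCoeff (R := ℝ) (σ := Fin n)) • (⊤ : Submodule _ M)) :
    ∃ r : MvPolynomial (Fin n) ℝ, r.constantCoeff ≠ 0 ∧ ∀ x : M, r • x ∈ W := by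
  set I := RingHom.ker (MvPolynomial.constantCoeff (R := ℝ) (σ := Fin n)) with hI
  have htop : ∀ x : M, x ∈ W ⊔ I • (⊤ : Submodule _ M) := fun x => by
    obtain ⟨d, hd, hx⟩ := h x
    -- Scaled to constant term 1, `d` differs from 1 by an element of the maximal ideal, so the
    -- factor `d` costs nothing modulo that ideal.
    have h1 : x = (MvPolynomial.C d.constantCoeff⁻¹ : MvPolynomial (Fin n) ℝ) • (d • x) +
        (1 - MvPolynomial.C d.constantCoeff⁻¹ * d) • x := by
      rw [smul_smul, ← add_smul, add_sub_cancel, one_smul]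
    rw [h1]
    refine Submodule.add_mem _ (Submodule.smul_mem _ _ hx) (Submodule.mem_sup_right ?_)
    refine Submodule.smul_mem_smul ?_ Submodule.mem_top
    rw [hI, RingHom.mem_ker]
    simp [hd]
  obtain ⟨r, hr, hr'⟩ := Submodule.exists_sub_one_mem_and_smul_eq_zero_of_fg_of_le_smul I
    (⊤ : Submodule (MvPolynomial (Fin n) ℝ) (M ⧸ W)) Module.Finite.fg_top (fun y _ => by
      obtain ⟨x, rfl⟩ := W.mkQ_surjective y
      obtain ⟨a, ha, b, hb, rfl⟩ := Submodule.mem_sup.mp (htop x)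
      have h0 : W.mkQ a = 0 := (Submodule.Quotient.mk_eq_zero W).mpr ha
      rw [map_add, h0, zero_add]
      have h2 := Submodule.mem_map_of_mem (f := W.mkQ) hb
      rw [Submodule.map_smul''] at h2
      exact Submodule.smul_mono le_rfl le_top h2)
  refine ⟨r, ?_, fun x => (Submodule.Quotient.mk_eq_zero W).mp (hr' (W.mkQ x) trivial)⟩
  have h3 := RingHom.mem_ker.mp hr
  rw [map_sub, map_one, sub_eq_zero] at h3
  rw [h3]
  exact one_ne_zero

namespace ConvexFan

variable {n : ℕ} {Δ : ConvexFan n}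

namespace GradedSheaf

variable {E : GradedSheaf.{u} Δ}

theorem red_finite {Λ : Opens Δ.Cone} [hfin : Module.Finite (MvPolynomial (Fin n) ℝ) (E.Sec Λ)] :
    Module.Finite ℝ (E.Red Λ) := by
  obtain ⟨S, hS⟩ := hfin.fg_top
  refine ⟨Submodule.fg_def.mpr ⟨(E.maxSub Λ).mkQ '' S, S.finite_toSet.image _, eq_top_iff.mpr ?_⟩⟩
  rintro y -
  obtain ⟨s, rfl⟩ := (E.maxSub Λ).mkQ_surjective y
  have hs : s ∈ Submodule.span (MvPolynomial (Fin n) ℝ) (S : Set (E.Sec Λ)) := hS ▸ trivial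
  induction hs using Submodule.closure_induction with
  | zero => rw [map_zero]; exact Submodule.zero_mem _
  | add a b _ _ ha hb => rw [map_add]; exact Submodule.add_mem _ ha hb
  | smul_mem p t ht =>
    have h1 : (E.maxSub Λ).mkQ (p • t) = p.constantCoeff • (E.maxSub Λ).mkQ t := by
      rw [← map_smul, ← sub_eq_zero, ← map_sub]
      exact (Submodule.Quotient.mk_eq_zero _).mpr (poly_smul_sub_mem_maxSub p t)
    rw [h1]
    exact Submodule.smul_mem _ _ (Submodule.subset_span ⟨t, ht, rfl⟩)

/-- Homogeneous lifts of a basis of `Ē_Λ` generate `E_Λ`. -/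
theorem exists_homogeneous_generators {Λ : Opens Δ.Cone} [Module.Finite ℝ (E.Red Λ)] :
    ∃ (k : ℕ) (t : Fin k → E.Sec Λ), (∀ i, ∃ q, t i ∈ E.gr Λ q) ∧
      LinearIndependent ℝ (fun i => (E.maxSub Λ).mkQ (t i)) ∧
      Submodule.span (MvPolynomial (Fin n) ℝ) (Set.range t) = ⊤ := by
  let S : Set (E.Red Λ) := (E.maxSub Λ).mkQ '' {s | ∃ q, s ∈ E.gr Λ q}
  obtain ⟨b, hbS, hb, hli⟩ := exists_linearIndependent ℝ S
  have hfin : Finite b := hli.setFinite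
  obtain ⟨k, ⟨e⟩⟩ := Finite.exists_equiv_fin b
  choose t ht htb using fun i : Fin k => hbS (e.symm i).2
  have hmk : (fun i => (E.maxSub Λ).mkQ (t i)) = fun i => ((e.symm i : b) : E.Red Λ) := funext htb
  refine ⟨k, t, ht, ?_, ?_⟩
  · rw [hmk]
    exact hli.comp _ e.symm.injective
  · refine span_eq_top_of_homogeneous _ (by rintro _ ⟨i, rfl⟩; exact ht i) fun s => ?_
    have h1 : (E.maxSub Λ).mkQ s ∈ Submodule.span ℝ S := by
      have h2 := Submodule.mem_map_of_mem (f := (E.maxSub Λ).mkQ)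
        (mem_span_homogeneous (E.gr_internal Λ) s)
      rwa [Submodule.map_span] at h2
    have h2 : b = (E.maxSub Λ).mkQ '' Set.range t := by
      rw [← Set.range_comp]
      change b = Set.range (fun i => (E.maxSub Λ).mkQ (t i))
      rw [hmk]
      ext y
      exact ⟨fun hy => ⟨e ⟨y, hy⟩, by simp⟩, by rintro ⟨i, rfl⟩; exact (e.symm i).2⟩
    rw [← hb, h2, ← Submodule.map_span] at h1
    obtain ⟨w, hw, hws⟩ := h1
    refine ⟨w, Submodule.span_le_restrictScalars ℝ (MvPolynomial (Fin n) ℝ) _ hw, ?_⟩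
    rw [← Submodule.Quotient.mk_eq_zero, Submodule.Quotient.mk_sub, sub_eq_zero]
    exact hws.symm

theorem finite_of_red_finite {Λ : Opens Δ.Cone} [Module.Finite ℝ (E.Red Λ)] :
    Module.Finite (MvPolynomial (Fin n) ℝ) (E.Sec Λ) := by
  obtain ⟨k, t, -, -, ht⟩ := exists_homogeneous_generators (E := E) (Λ := Λ)
  exact ⟨Submodule.fg_def.mpr ⟨_, Set.finite_range t, ht⟩⟩

/-- Sections embed in the finite product of their stalks, and the polynomial ring is Noetherian. -/
theorem finite_of_finite_stalks {Λ : Opens Δ.Cone}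
    (h : ∀ σ ∈ Λ, Module.Finite (MvPolynomial (Fin n) ℝ) (E.Sec (affineFan σ))) :
    Module.Finite (MvPolynomial (Fin n) ℝ) (E.Sec Λ) := by
  have := fun σ : {σ // σ ∈ Λ} => h σ.1 σ.2
  refine Module.Finite.of_injective
    (LinearMap.pi fun σ : {σ // σ ∈ Λ} => E.resPoly (affineFan_le σ.2)) fun s t hst => ?_
  exact sec_ext fun σ hσ => congrFun hst ⟨σ, hσ⟩

theorem zeroFan_le_affineFan : Δ.zeroFan ≤ affineFan Δ.zeroCone := fun σ hσ => by
  have h1 : σ = Δ.zeroCone := Subtype.ext hσ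
  exact mem_affineFan.mpr h1.le

theorem affineFan_le_zeroFan : affineFan Δ.zeroCone ≤ Δ.zeroFan := fun _ hσ =>
  le_bot_iff.mp (mem_affineFan.mp hσ)

/-! ### Stalks of a minimal extension sheaf: finiteness, flabbiness, projectivity. -/

namespace IsMinimalExtension

variable (hE : E.IsMinimalExtension)
include hE

theorem nonempty_zeroCone_equiv : Nonempty (E.Sec (affineFan Δ.zeroCone) ≃ₗ[ℝ] ℝ) := by
  obtain ⟨e⟩ := hE.zero_iso
  have e' : E.Sec (affineFan Δ.zeroCone) ≃ₗ[ℝ] E.Sec Δ.zeroFan :=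
    LinearEquiv.ofBijective (E.res zeroFan_le_affineFan)
      ⟨fun s t hst => by
        have h1 := congrArg (E.res affineFan_le_zeroFan) hst
        rwa [E.res_comp, E.res_comp, E.res_id, E.res_id] at h1,
      fun s => ⟨E.res affineFan_le_zeroFan s, (E.res_comp _ _ s).trans (E.res_id _ s)⟩⟩
  exact ⟨e'.trans e⟩

/-- Induction over faces: finiteness on the boundary makes Ē_∂σ finite-dimensional, hence also Ē_σ,
and graded Nakayama lifts this to E_σ. -/
theorem finite_stalk (σ : Δ.Cone) :
    Module.Finite (MvPolynomial (Fin n) ℝ) (E.Sec (affineFan σ)) := by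
  induction σ using WellFoundedLT.induction with
  | _ σ ih =>
    by_cases hσ : σ.1 = ⊥
    · obtain rfl : σ = Δ.zeroCone := Subtype.ext hσ
      obtain ⟨e⟩ := hE.nonempty_zeroCone_equiv
      have : Module.Finite ℝ (E.Sec (affineFan Δ.zeroCone)) := Module.Finite.equiv e.symm
      exact Module.Finite.of_restrictScalars_finite ℝ _ _
    · have h1 : Module.Finite (MvPolynomial (Fin n) ℝ) (E.Sec (boundaryFan σ)) :=
        finite_of_finite_stalks fun τ hτ => ih τ (mem_boundaryFan.mp hτ)
      have h2 : Module.Finite ℝ (E.Red (boundaryFan σ)) := red_finite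
      have h3 : Module.Finite ℝ (E.Red (affineFan σ)) :=
        Module.Finite.equiv (LinearEquiv.ofBijective _ (hE.red_bijective σ hσ)).symm
      exact finite_of_red_finite

theorem finite_sec (Λ : Opens Δ.Cone) : Module.Finite (MvPolynomial (Fin n) ℝ) (E.Sec Λ) :=
  finite_of_finite_stalks fun σ _ => hE.finite_stalk σ

/-- Graded Nakayama: the images of homogeneous sections over σ generate E_∂σ modulo the maximal
ideal, because Ē_σ → Ē_∂σ is onto. -/
theorem res_boundaryFan_surjective {σ : Δ.Cone} (hσ : σ.1 ≠ ⊥) :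
    Function.Surjective (E.res (boundaryFan_le σ)) := by
  let T : Set (E.Sec (boundaryFan σ)) :=
    E.res (boundaryFan_le σ) '' {s | ∃ q, s ∈ E.gr (affineFan σ) q}
  have h1 : Submodule.span (MvPolynomial (Fin n) ℝ) T = ⊤ := by
    refine span_eq_top_of_homogeneous T ?_ fun s => ?_
    · rintro _ ⟨s, ⟨q, hs⟩, rfl⟩
      exact ⟨q, E.res_mem_gr _ q s hs⟩
    · obtain ⟨y, hy⟩ := (hE.red_bijective σ hσ).2 ((E.maxSub _).mkQ s)
      obtain ⟨t, rfl⟩ := (E.maxSub _).mkQ_surjective y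
      refine ⟨E.res (boundaryFan_le σ) t, ?_, ?_⟩
      · have h2 := Submodule.mem_map_of_mem (f := E.res (boundaryFan_le σ))
          (mem_span_homogeneous (E.gr_internal _) t)
        rw [Submodule.map_span] at h2
        exact Submodule.span_le_restrictScalars ℝ (MvPolynomial (Fin n) ℝ) _ h2
      · rw [← Submodule.Quotient.mk_eq_zero, Submodule.Quotient.mk_sub, sub_eq_zero]
        exact hy.symm
  have h2 : Submodule.span (MvPolynomial (Fin n) ℝ) T ≤
      LinearMap.range (E.resPoly (boundaryFan_le σ)) :=
    Submodule.span_le.mpr (by rintro _ ⟨s, -, rfl⟩; exact ⟨s, rfl⟩)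
  intro s
  exact h2 (h1 ▸ Submodule.mem_top)

theorem stalks_flabby : E.stalks.Flabby := by
  intro σ y hy
  by_cases hσ : σ.1 = ⊥
  · obtain rfl : σ = Δ.zeroCone := Subtype.ext hσ
    exact ⟨0, fun τ hτ => absurd hτ (zeroCone_le τ).not_gt⟩
  · obtain ⟨s, hs⟩ := exists_glue (boundaryFan σ) y fun τ hτ ρ hρ =>
      hy τ (mem_boundaryFan.mp hτ) ρ hρ
    obtain ⟨t, rfl⟩ := hE.res_boundaryFan_surjective hσ s
    refine ⟨t, fun τ hτ => ?_⟩
    have h1 := hs τ (mem_boundaryFan.mpr hτ)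
    rwa [E.res_comp] at h1

/-- This is the minimality of E, in the form of injectivity of Ē_σ → Ē_∂σ. It supplies the error
term for Nakayama's lemma in `endo_regular`. -/
theorem mem_maxSub_of_res_eq_zero {σ : Δ.Cone} (hσ : σ.1 ≠ ⊥) {s : E.Sec (affineFan σ)}
    (hs : ∀ τ (h : τ < σ), E.res (affineFan_mono h.le) s = 0) : s ∈ E.maxSub (affineFan σ) := by
  have h1 : E.res (boundaryFan_le σ) s = 0 := sec_ext fun τ hτ => by
    rw [E.res_comp, map_zero]
    exact hs τ (mem_boundaryFan.mp hτ)
  have h2 : E.redRes (boundaryFan_le σ) ((E.maxSub _).mkQ s) = E.redRes (boundaryFan_le σ) 0 := by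
    rw [map_zero, ← map_zero (E.maxSub (boundaryFan σ)).mkQ, ← h1]
    rfl
  exact (Submodule.Quotient.mk_eq_zero _).mp ((hE.red_bijective σ hσ).1 h2)

/-- A basis over A_σ, with coordinates transported along A_σ ≅ A/I(σ), gives the retraction. The
chosen polynomial lifts `g` are not additive, but their classes modulo I are. -/
theorem stalk_relProjective (σ : Δ.Cone) : RelProjective.{0, u, u}
    (polyVanishing (σ.1 : Set (Fin n → ℝ))) (E.Sec (affineFan σ)) := by
  have := hE.free σ
  let B := conewisePoly (affineFan σ)
  let b := Module.Free.chooseBasis B (E.Sec (affineFan σ))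
  set I := polyVanishing (σ.1 : Set (Fin n → ℝ)) with hI
  have hker : ∀ p, ofPoly (affineFan σ) p = 0 ↔ p ∈ I := ofPoly_affineFan_eq_zero_iff σ
  have hsurj := ofPoly_affineFan_surjective σ
  choose g hg using hsurj
  let ψ : B → MvPolynomial (Fin n) ℝ ⧸ I := fun c => Ideal.Quotient.mk I (g c)
  have hψ : ∀ p, ψ (ofPoly _ p) = Ideal.Quotient.mk I p := fun p => by
    rw [Ideal.Quotient.eq, ← hker, map_sub, hg, sub_self]
  have hψ0 : ψ 0 = 0 := by rw [← map_zero (ofPoly (affineFan σ)), hψ, map_zero]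
  have hkill : ∀ a ∈ I, ∀ y : E.Sec (affineFan σ), a • y = 0 := fun a ha y => by
    rw [poly_smul_def, (hker a).mpr ha, zero_smul]
  let i : E.Sec (affineFan σ) →ₗ[MvPolynomial (Fin n) ℝ]
      (Module.Free.ChooseBasisIndex B (E.Sec (affineFan σ)) →₀ MvPolynomial (Fin n) ℝ ⧸ I) :=
    { toFun := fun s => (b.repr s).mapRange ψ hψ0
      map_add' := fun s t => by
        ext y
        obtain ⟨c, hc⟩ := ofPoly_affineFan_surjective σ (b.repr s y)
        obtain ⟨d, hd⟩ := ofPoly_affineFan_surjective σ (b.repr t y)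
        simp only [map_add, Finsupp.mapRange_apply, Finsupp.add_apply]
        rw [← hc, ← hd, ← map_add, hψ, hψ, hψ, map_add]
      map_smul' := fun p s => by
        ext y
        obtain ⟨c, hc⟩ := ofPoly_affineFan_surjective σ (b.repr s y)
        rw [poly_smul_def, map_smul]
        simp only [Finsupp.mapRange_apply, Finsupp.smul_apply, RingHom.id_apply, smul_eq_mul]
        rw [← hc, ← map_mul, hψ, hψ]
        rfl }
  refine ⟨_, i, finsuppQuotientLift hkill b, LinearMap.ext fun s => ?_⟩
  have key : ∀ c : Module.Free.ChooseBasisIndex B (E.Sec (affineFan σ)) →₀ B,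
      finsuppQuotientLift hkill b (i (b.repr.symm c)) = b.repr.symm c := fun c => by
    induction c using Finsupp.induction_linear with
    | zero => rw [map_zero, map_zero, map_zero]
    | add c d hc hd => rw [map_add, map_add, map_add, hc, hd]
    | single y a =>
      obtain ⟨p, rfl⟩ := ofPoly_affineFan_surjective σ a
      have h1 : b.repr.symm (Finsupp.single y (ofPoly (affineFan σ) p)) = p • b y := by
        rw [Module.Basis.repr_symm_single, poly_smul_def]
      have h2 : i (b y) = Finsupp.single y 1 := by
        change (b.repr (b y)).mapRange ψ hψ0 = _
        rw [Module.Basis.repr_self, Finsupp.mapRange_single, ← map_one (ofPoly (affineFan σ)), hψ,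
          map_one]
      rw [h1, map_smul, map_smul, h2, finsuppQuotientLift_single]
  have h1 := key (b.repr s)
  rwa [LinearEquiv.symm_apply_apply] at h1

/-- E_σ is finite free over A_σ, so the determinant criterion applies there, and d is regular on it
because d does not vanish at the origin. -/
theorem endo_injective {σ : Δ.Cone}
    (θ : E.Sec (affineFan σ) →ₗ[MvPolynomial (Fin n) ℝ] E.Sec (affineFan σ))
    {d : MvPolynomial (Fin n) ℝ} (hd : d.constantCoeff ≠ 0) (h : ∀ v, ∃ w, θ w = d • v) :
    Function.Injective θ := by
  have := hE.free σ
  have hfin := hE.finite_stalk σ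
  let B := conewisePoly (affineFan σ)
  have : Module.Finite B (E.Sec (affineFan σ)) := by
    obtain ⟨S, hS⟩ := hfin.fg_top
    refine ⟨S, eq_top_iff.mpr fun s _ => ?_⟩
    have hs : s ∈ Submodule.span (MvPolynomial (Fin n) ℝ) (S : Set (E.Sec (affineFan σ))) :=
      hS ▸ trivial
    induction hs using Submodule.closure_induction with
    | zero => exact Submodule.zero_mem _
    | add a b _ _ ha hb => exact Submodule.add_mem _ (ha trivial) (hb trivial)
    | smul_mem p t ht => exact Submodule.smul_mem _ _ (Submodule.subset_span ht)
  let θB : E.Sec (affineFan σ) →ₗ[B] E.Sec (affineFan σ) :=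
    { toFun := θ
      map_add' := map_add θ
      map_smul' := fun c s => by
        obtain ⟨p, rfl⟩ := ofPoly_affineFan_surjective σ c
        exact θ.map_smul p s }
  exact injective_of_forall_smul_mem_range θB (ofPoly (affineFan σ) d)
    (fun v hv => (hE.stalk_relProjective σ).eq_zero_of_smul_eq_zero hd hv) h

end IsMinimalExtension

end GradedSheaf

end ConvexFan

/-! ### Endomorphisms that are invertible near the origin. -/

namespace PosetSystem

variable {n : ℕ} {P : Type*} [PartialOrder P] {M : PosetSystem.{0, w} (MvPolynomial (Fin n) ℝ) P}

/-- If an endomorphism is invertible near the origin at every element of a lower set, it is so on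
the sections over that set. -/
theorem Hom.exists_denominator [Finite P] (θ : Hom M M) {S : Set P} (hS : IsLowerSet S)
    (h : ∀ s ∈ S, Function.Injective (θ.app s) ∧ ∃ d : MvPolynomial (Fin n) ℝ,
      d.constantCoeff ≠ 0 ∧ ∀ v, ∃ w, θ.app s w = d • v) :
    ∃ d : MvPolynomial (Fin n) ℝ, d.constantCoeff ≠ 0 ∧ ∀ y, M.CompatOn S y →
      ∃ z, M.CompatOn S z ∧ ∀ s ∈ S, θ.app s (z s) = d • y s := by
  classical
  have := Fintype.ofFinite P
  choose d hd hw using fun s : S => (h s s.2).2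
  refine ⟨∏ s, d s, ?_, fun y hy => ?_⟩
  · rw [map_prod]
    exact Finset.prod_ne_zero_iff.mpr fun s _ => hd s
  have h1 : ∀ s, ∃ z : M.obj s, s ∈ S → θ.app s z = (∏ s, d s) • y s := fun s => by
    by_cases hs : s ∈ S
    -- The common denominator is the product of all local ones. The remaining factors are moved into
    -- the argument.
    · obtain ⟨z, hz⟩ := hw ⟨s, hs⟩ ((∏ t ∈ Finset.univ.erase ⟨s, hs⟩, d t) • y s)
      refine ⟨z, fun _ => ?_⟩
      rw [hz, smul_smul, Finset.mul_prod_erase _ _ (Finset.mem_univ _)]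
    · exact ⟨0, fun h => absurd h hs⟩
  choose z hz using h1
  -- The local preimages are compatible because they become so after applying the injective maps
  -- `θ.app t`.
  refine ⟨z, fun s hs t hts => (h t (hS hts hs)).1 ?_, hz⟩
  rw [← θ.res_app, hz s hs, hz t (hS hts hs), map_smul, hy s hs t hts]

end PosetSystem

namespace ConvexFan

variable {n : ℕ} {Δ : ConvexFan n}

namespace GradedSheaf

variable {E : GradedSheaf.{u} Δ}

namespace IsMinimalExtension

variable (hE : E.IsMinimalExtension)
include hE

/-- An endomorphism which is the identity on `E_0` is injective, and invertible near the origin. -/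
theorem endo_regular (θ : PosetSystem.Hom E.stalks E.stalks)
    (h0 : ∀ s, θ.app Δ.zeroCone s = s) (σ : Δ.Cone) :
    Function.Injective (θ.app σ) ∧ ∃ d : MvPolynomial (Fin n) ℝ,
      d.constantCoeff ≠ 0 ∧ ∀ v, ∃ w, θ.app σ w = d • v := by
  classical
  induction σ using WellFoundedLT.induction with
  | _ σ ih =>
    by_cases hσ : σ.1 = ⊥
    · obtain rfl : σ = Δ.zeroCone := Subtype.ext hσ
      refine ⟨fun s t hst => by rwa [h0, h0] at hst, 1, by simp, fun v => ⟨v, ?_⟩⟩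
      rw [h0, one_smul]
    obtain ⟨d, hd, hdz⟩ := θ.exists_denominator (S := Set.Iio σ)
      (fun s t hts hs => lt_of_le_of_lt hts hs) ih
    have hfin := hE.finite_stalk σ
    -- By induction d·s has a preimage under θ on the boundary. Extend it to `t` over σ by
    -- flabbiness; then d·s - θ(t) vanishes on the boundary and so lies in 𝔪E_σ by minimality.
    obtain ⟨r, hr, hrW⟩ := exists_smul_mem_of_mem_sup (LinearMap.range (θ.app σ)) fun s => by
      refine ⟨d, hd, ?_⟩
      obtain ⟨z, hzc, hz⟩ := hdz (fun τ => if h : τ ≤ σ then E.res (affineFan_mono h) s else 0)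
        fun τ hτ ρ hρ => by
          have h1 : τ ≤ σ := le_of_lt hτ
          simp only [h1, hρ.trans h1, dif_pos]
          exact E.res_comp _ _ s
      obtain ⟨t, ht⟩ := hE.stalks_flabby σ z hzc
      have h1 : d • s = θ.app σ t + (d • s - θ.app σ t) := by rw [add_sub_cancel]
      rw [h1]
      refine Submodule.add_mem_sup ⟨t, rfl⟩ ((mem_maxSub_iff _).mp ?_)
      refine hE.mem_maxSub_of_res_eq_zero hσ fun τ hτ => ?_
      have h2 : E.res (affineFan_mono hτ.le) (θ.app σ t) = θ.app τ (z τ) := by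
        rw [← ht τ hτ]
        exact θ.res_app hτ.le t
      rw [map_sub, res_poly_smul, h2, hz τ hτ, dif_pos hτ.le, sub_self]
    exact ⟨hE.endo_injective (θ.app σ) hr hrW, r, hr, hrW⟩

/-- Polynomials act on E_0 through their constant term, so E_0 is the residue ring at the origin. -/
theorem exists_zeroCone_retract :
    ∃ (a : E.Sec (affineFan Δ.zeroCone) →ₗ[MvPolynomial (Fin n) ℝ]
        (MvPolynomial (Fin n) ℝ ⧸ polyVanishing {(0 : Fin n → ℝ)}))
      (r : (MvPolynomial (Fin n) ℝ ⧸ polyVanishing {(0 : Fin n → ℝ)}) →ₗ[MvPolynomial (Fin n) ℝ]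
        E.Sec (affineFan Δ.zeroCone)), ∀ s, r (a s) = s := by
  obtain ⟨e⟩ := hE.nonempty_zeroCone_equiv
  have hkill : ∀ p ∈ polyVanishing {(0 : Fin n → ℝ)}, ∀ s : E.Sec (affineFan Δ.zeroCone),
      p • s = 0 := fun p hp s => (hE.stalk_relProjective Δ.zeroCone).smul_eq_zero hp s
  have hC : ∀ p : MvPolynomial (Fin n) ℝ,
      p - MvPolynomial.C p.constantCoeff ∈ polyVanishing {(0 : Fin n → ℝ)} := fun p z hz => by
    rw [Set.mem_singleton_iff.mp hz, MvPolynomial.eval_zero]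
    simp
  have hsmul : ∀ (p : MvPolynomial (Fin n) ℝ) (s : E.Sec (affineFan Δ.zeroCone)),
      p • s = p.constantCoeff • s := fun p s => by
    rw [← sub_eq_zero, ← C_smul, ← sub_smul]
    exact hkill _ (hC p) s
  refine ⟨{ toFun := fun s => Ideal.Quotient.mk _ (MvPolynomial.C (e s))
            map_add' := fun s t => by rw [map_add, map_add, map_add]
            map_smul' := fun p s => ?_ },
    Submodule.liftQ _ (LinearMap.toSpanSingleton _ _ (e.symm 1)) fun p hp => hkill p hp _,
    fun s => ?_⟩
  · rw [hsmul, map_smul, smul_eq_mul, map_mul, map_mul, RingHom.id_apply]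
    have h1 : Ideal.Quotient.mk (polyVanishing {(0 : Fin n → ℝ)})
        (MvPolynomial.C p.constantCoeff) = Ideal.Quotient.mk _ p :=
      ((Ideal.Quotient.mk_eq_mk_iff_sub_mem _ _).mpr (hC p)).symm
    rw [h1]
    rfl
  · change (MvPolynomial.C (e s) : MvPolynomial (Fin n) ℝ) • e.symm 1 = s
    rw [C_smul, ← map_smul, smul_eq_mul, mul_one, e.symm_apply_apply]

open Classical in
/-- There are morphisms between `E` and a flabby locally projective system whose composite is the
identity on `E_0`. -/
theorem exists_homs {N : PosetSystem.{0, 0} (MvPolynomial (Fin n) ℝ) Δ.Cone} (hN : N.Flabby)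
    (hNp : ∀ σ, RelProjective.{0, 0, 0} (polyVanishing (σ.1 : Set (Fin n → ℝ))) (N.obj σ))
    (i : (MvPolynomial (Fin n) ℝ ⧸ polyVanishing {(0 : Fin n → ℝ)})
      →ₗ[MvPolynomial (Fin n) ℝ] N.obj Δ.zeroCone)
    (p : N.obj Δ.zeroCone →ₗ[MvPolynomial (Fin n) ℝ]
      (MvPolynomial (Fin n) ℝ ⧸ polyVanishing {(0 : Fin n → ℝ)})) (hip : ∀ y, p (i y) = y) :
    ∃ (f : PosetSystem.Hom E.stalks N) (g : PosetSystem.Hom N E.stalks),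
      ∀ s, g.app Δ.zeroCone (f.app Δ.zeroCone s) = s := by
  obtain ⟨a, r, har⟩ := hE.exists_zeroCone_retract
  have hD : IsLowerSet {Δ.zeroCone} := fun s t hts hs => by
    rw [Set.mem_singleton_iff.mp hs] at hts
    exact le_antisymm hts (zeroCone_le t)
  -- Over the zero cone f and g are prescribed through the residue ring, so that g ∘ f is the
  -- identity there. Elsewhere any extension will do.
  obtain ⟨f, hf⟩ := PosetSystem.exists_hom_extension.{0, u, 0, u} (M := E.stalks) (N := N)
    (fun σ => polyVanishing (σ.1 : Set (Fin n → ℝ))) hE.stalk_relProjective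
    (fun σ a ha y => (hNp σ).smul_eq_zero ha y) hN {Δ.zeroCone} hD
    (Function.update (fun _ => 0) Δ.zeroCone (i ∘ₗ a)) (by
      rintro s rfl t hts y
      obtain rfl := hD hts rfl
      rw [N.res_refl, E.stalks.res_refl])
  obtain ⟨g, hg⟩ := PosetSystem.exists_hom_extension.{0, 0, u, 0} (M := N) (N := E.stalks)
    (fun σ => polyVanishing (σ.1 : Set (Fin n → ℝ))) hNp
    (fun σ a ha y => (hE.stalk_relProjective σ).smul_eq_zero ha y) hE.stalks_flabby
    {Δ.zeroCone} hD (Function.update (fun _ => 0) Δ.zeroCone (r ∘ₗ p)) (by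
      rintro s rfl t hts y
      obtain rfl := hD hts rfl
      rw [N.res_refl, E.stalks.res_refl])
  refine ⟨f, g, fun s => ?_⟩
  rw [hf _ rfl, hg _ rfl, Function.update_self, Function.update_self]
  change r (p (i (a s))) = s
  rw [hip, har]

/-- The global sections of a minimal extension sheaf on a complete fan form a free module. -/
theorem exists_equiv_top (hΔ : Δ.IsComplete) : ∃ k : ℕ,
    Nonempty (E.Sec ⊤ ≃ₗ[MvPolynomial (Fin n) ℝ] (Fin k → MvPolynomial (Fin n) ℝ)) := by
  obtain ⟨N, hN, hNp, hNtop, i, p', hip⟩ := exists_flabby_projective hΔ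
  obtain ⟨f, g, hfg⟩ := hE.exists_homs hN hNp i p' hip
  let θ : PosetSystem.Hom E.stalks E.stalks :=
    ⟨fun σ => g.app σ ∘ₗ f.app σ, fun h y => by
      rw [LinearMap.comp_apply, LinearMap.comp_apply, g.res_app, f.res_app]⟩
  have hfin := hE.finite_sec ⊤
  have : Module.Finite ℝ (E.Red ⊤) := red_finite
  obtain ⟨k, t, -, hli, ht⟩ := exists_homogeneous_generators (E := E) (Λ := ⊤)
  let p : (Fin k → MvPolynomial (Fin n) ℝ) →ₗ[MvPolynomial (Fin n) ℝ] E.Sec ⊤ :=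
    Fintype.linearCombination _ t
  have hp : Function.Surjective p := LinearMap.range_eq_top.mp
    ((Fintype.range_linearCombination _ t).trans ht)
  -- The generators are linearly independent in Ē_Δ, so relations among them have coefficients
  -- without constant term.
  have hker : ∀ c, p c = 0 → c ∈ RingHom.ker (MvPolynomial.constantCoeff (R := ℝ) (σ := Fin n)) •
      (⊤ : Submodule (MvPolynomial (Fin n) ℝ) (Fin k → MvPolynomial (Fin n) ℝ)) := fun c hc => by
    have h1 : ∑ i, (c i).constantCoeff • (E.maxSub ⊤).mkQ (t i) = 0 := by
      have h2 : ∑ i, (c i).constantCoeff • (E.maxSub ⊤).mkQ (t i) =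
          (E.maxSub ⊤).mkQ (∑ i, (c i).constantCoeff • t i) := by simp
      have h3 : p c = ∑ i, c i • t i := Fintype.linearCombination_apply _ _ _
      rw [h2, ← neg_eq_zero, ← map_neg, ← zero_sub, ← hc, h3, ← Finset.sum_sub_distrib]
      exact (Submodule.Quotient.mk_eq_zero _).mpr
        (Submodule.sum_mem _ fun i _ => poly_smul_sub_mem_maxSub _ _)
    rw [pi_eq_sum_univ' c]
    exact Submodule.sum_mem _ fun i _ => Submodule.smul_mem_smul
      (RingHom.mem_ker.mpr (Fintype.linearIndependent_iff.mp hli _ h1 i)) Submodule.mem_top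
  let F : E.Sec ⊤ →ₗ[MvPolynomial (Fin n) ℝ] N.secs Set.univ := LinearMap.codRestrict _
    (LinearMap.pi fun σ : (Set.univ : Set Δ.Cone) =>
      f.app σ.1 ∘ₗ E.resPoly (affineFan_le (Λ := ⊤) trivial)) fun s σ τ h => by
      change N.res h (f.app _ (E.res _ s)) = f.app _ (E.res _ s)
      rw [f.res_app]
      exact congrArg (f.app _) (E.res_comp _ _ s)
  let q : (Fin k → MvPolynomial (Fin n) ℝ) →ₗ[MvPolynomial (Fin n) ℝ]
      ∀ σ : Δ.Cone, E.Sec (affineFan σ) :=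
    LinearMap.pi fun σ => E.resPoly (affineFan_le (Λ := ⊤) trivial) ∘ₗ p
  let φ : N.secs Set.univ →ₗ[MvPolynomial (Fin n) ℝ] ∀ σ : Δ.Cone, E.Sec (affineFan σ) :=
    LinearMap.pi fun σ => g.app σ ∘ₗ LinearMap.proj (⟨σ, trivial⟩ : (Set.univ : Set Δ.Cone)) ∘ₗ (N.secs Set.univ).subtype
  have hlift : ∀ y : ∀ σ, E.Sec (affineFan σ), E.stalks.CompatOn Set.univ y →
      ∃ c, ∀ σ, E.res (affineFan_le (Λ := ⊤) (σ := σ) trivial) (p c) = y σ := fun y hy => by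
    obtain ⟨s, hs⟩ := exists_glue ⊤ y fun σ _ τ hτ => hy σ trivial τ hτ
    obtain ⟨c, rfl⟩ := hp s
    exact ⟨c, fun σ => hs σ trivial⟩
  -- Projectivity of the global sections of `N` lifts the map induced by `g` through the surjection
  -- `p` onto E_Δ.
  obtain ⟨l, hl⟩ := hNtop.exists_lift (Q := Fin k → MvPolynomial (Fin n) ℝ)
    (fun a ha y => by rw [(Submodule.mem_bot _).mp ha, zero_smul]) q φ fun y => by
      obtain ⟨c, hc⟩ := hlift (φ y) fun σ _ τ h => by
        change E.stalks.res h (g.app σ (y.1 ⟨σ, trivial⟩)) = g.app τ (y.1 ⟨τ, trivial⟩)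
        rw [g.res_app, y.2 ⟨σ, trivial⟩ ⟨τ, trivial⟩ h]
      exact ⟨c, funext hc⟩
  let h := l ∘ₗ F ∘ₗ p
  have hh : ∀ c σ, E.res (affineFan_le (Λ := ⊤) (σ := σ) trivial) (p (h c)) =
      θ.app σ (E.res (affineFan_le (Λ := ⊤) (σ := σ) trivial) (p c)) := fun c σ => congrFun (hl (F (p c))) σ
  obtain ⟨d, hd, hdz⟩ := θ.exists_denominator (S := Set.univ) isLowerSet_univ
    fun σ _ => hE.endo_regular θ hfg σ
  -- Since p ∘ h acts as θ after p, and θ is invertible up to d on global sections, d·c lies in the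
  -- range of `h` up to ker p, hence up to the maximal ideal.
  obtain ⟨r, hr, hrW⟩ := exists_smul_mem_of_mem_sup (LinearMap.range h) fun c => by
    refine ⟨d, hd, ?_⟩
    obtain ⟨z, hzc, hz⟩ := hdz (fun σ => E.res (affineFan_le (Λ := ⊤) trivial) (p c))
      fun σ _ τ _ => E.res_comp _ _ _
    obtain ⟨c', hc'⟩ := hlift z hzc
    have h1 : d • c = h c' + (d • c - h c') := by rw [add_sub_cancel]
    rw [h1]
    refine Submodule.add_mem_sup ⟨c', rfl⟩ (hker _ ?_)
    rw [map_sub, sub_eq_zero, map_smul]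
    refine sec_ext fun σ _ => ?_
    rw [res_poly_smul, hh, hc', hz σ trivial]
  have hinj : Function.Injective h := injective_of_forall_smul_mem_range h r (fun v hv => by
    have hr0 : r ≠ 0 := fun h0 => hr (by rw [h0, map_zero])
    exact (smul_eq_zero.mp hv).resolve_left hr0) hrW
  -- The injective map `h` factors through `p`, so `p` is injective.
  refine ⟨k, ⟨(LinearEquiv.ofBijective p ⟨?_, hp⟩).symm⟩⟩
  rw [injective_iff_map_eq_zero]
  intro c hc
  refine hinj ?_
  change l (F (p c)) = h 0
  rw [hc, map_zero, map_zero, map_zero]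

end IsMinimalExtension

end GradedSheaf

end ConvexFan

/-! ### The trace of an involution -/

section EigenTrace

variable {M N : Type*} [AddCommGroup M] [Module ℝ M] [AddCommGroup N] [Module ℝ N]

theorem finrank_inf_ker_add_finrank_map (U : Submodule ℝ M) [FiniteDimensional ℝ U]
    (f : M →ₗ[ℝ] N) : Module.finrank ℝ (U ⊓ LinearMap.ker f : Submodule ℝ M) +
      Module.finrank ℝ (U.map f) = Module.finrank ℝ U := by
  have h1 := LinearMap.finrank_range_add_finrank_ker (f.domRestrict U)
  have h2 : (LinearMap.ker (f.domRestrict U)).map U.subtype = U ⊓ LinearMap.ker f := by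
    rw [← Submodule.map_comap_subtype]
    rfl
  rw [← h2, Submodule.finrank_map_subtype_eq, ← LinearMap.range_domRestrict]
  omega

/-- The trace of an involution on an invariant subspace: the difference of the dimensions of its
eigenspaces. -/
noncomputable def eigenTrace (T : Module.End ℝ M) (W : Submodule ℝ M) : ℤ :=
  Module.finrank ℝ (W ⊓ T.eigenspace 1 : Submodule ℝ M) -
    Module.finrank ℝ (W ⊓ T.eigenspace (-1) : Submodule ℝ M)

theorem eigenTrace_bot (T : Module.End ℝ M) : eigenTrace T ⊥ = 0 := by
  rw [eigenTrace, bot_inf_eq, bot_inf_eq, sub_self]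

variable {T : Module.End ℝ M} {W : Submodule ℝ M}

/-- Averaging, y ↦ (y + sTy)/2, lifts an eigenvector of the image to an eigenvector. The sign ε
treats commuting and anticommuting maps together. -/
theorem map_inf_eigenspace (hT : ∀ y, T (T y) = y) (hW : ∀ y ∈ W, T y ∈ W) {T' : Module.End ℝ N}
    (f : M →ₗ[ℝ] N) {ε s : ℝ} (hε : ε * ε = 1) (hs : s * s = 1) (hf : ∀ y, f (T y) = ε • T' (f y)) :
    (W ⊓ T.eigenspace s).map f = W.map f ⊓ T'.eigenspace (ε * s) := by
  have hf' : ∀ y, T' (f y) = ε • f (T y) := fun y => by rw [hf, smul_smul, hε, one_smul]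
  apply le_antisymm
  · rintro _ ⟨y, ⟨hy, hys⟩, rfl⟩
    refine ⟨⟨y, hy, rfl⟩, Module.End.mem_eigenspace_iff.mpr ?_⟩
    rw [hf', Module.End.mem_eigenspace_iff.mp hys, map_smul, smul_smul]
  · rintro _ ⟨⟨y, hy, rfl⟩, hys⟩
    have h1 : f (T y) = s • f y := by
      rw [hf, Module.End.mem_eigenspace_iff.mp hys, smul_smul, ← mul_assoc, hε, one_mul]
    refine ⟨(2⁻¹ : ℝ) • (y + s • T y), ⟨Submodule.smul_mem _ _ (Submodule.add_mem _ hy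
      (Submodule.smul_mem _ _ (hW y hy))), Module.End.mem_eigenspace_iff.mpr ?_⟩, ?_⟩
    · rw [map_smul, map_add, map_smul, hT, smul_comm s, smul_add s, smul_smul s s, hs, one_smul,
        add_comm]
    · rw [map_smul, map_add, map_smul, h1, smul_smul s s, hs, one_smul, ← two_smul ℝ (f y),
        smul_smul]
      norm_num

theorem eigenTrace_eq_add_map [FiniteDimensional ℝ W] (hT : ∀ y, T (T y) = y)
    (hW : ∀ y ∈ W, T y ∈ W) {T' : Module.End ℝ N} (f : M →ₗ[ℝ] N) (hf : ∀ y, f (T y) = T' (f y)) :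
    eigenTrace T W = eigenTrace T (W ⊓ LinearMap.ker f) + eigenTrace T' (W.map f) := by
  have hdim : ∀ s : ℝ, s * s = 1 → Module.finrank ℝ (W ⊓ T.eigenspace s : Submodule ℝ M) =
      Module.finrank ℝ (W ⊓ LinearMap.ker f ⊓ T.eigenspace s : Submodule ℝ M) +
        Module.finrank ℝ (W.map f ⊓ T'.eigenspace s : Submodule ℝ N) := fun s hs => by
    have : FiniteDimensional ℝ (W ⊓ T.eigenspace s : Submodule ℝ M) :=
      Submodule.finiteDimensional_of_le inf_le_left
    rw [← finrank_inf_ker_add_finrank_map (W ⊓ T.eigenspace s) f,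
      map_inf_eigenspace hT hW f (one_mul 1) hs (by simpa using hf), one_mul, inf_right_comm]
  rw [eigenTrace, eigenTrace, eigenTrace, hdim 1 (by norm_num), hdim (-1) (by norm_num)]
  push_cast
  ring

/-- An injective map which anticommutes with the involutions changes the sign of the trace. -/
theorem eigenTrace_map_of_anticommute [FiniteDimensional ℝ W] (hT : ∀ y, T (T y) = y)
    (hW : ∀ y ∈ W, T y ∈ W) {T' : Module.End ℝ N} {f : M →ₗ[ℝ] N} (hf : ∀ y, f (T y) = -T' (f y))
    (hinj : Function.Injective f) : eigenTrace T' (W.map f) = -eigenTrace T W := by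
  have hdim : ∀ s : ℝ, s * s = 1 → Module.finrank ℝ (W.map f ⊓ T'.eigenspace (-1 * s) :
      Submodule ℝ N) = Module.finrank ℝ (W ⊓ T.eigenspace s : Submodule ℝ M) := fun s hs => by
    rw [← map_inf_eigenspace (T' := T') (ε := -1) hT hW f (by norm_num) hs (by simpa using hf)]
    exact (Submodule.equivMapOfInjective f hinj _).finrank_eq.symm
  have h1 := hdim 1 (by norm_num)
  have h2 := hdim (-1) (by norm_num)
  rw [mul_one] at h1
  rw [neg_mul_neg, mul_one] at h2
  rw [eigenTrace, eigenTrace, h1, h2]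
  ring

/-- The eigencomponents of a + b are sums of those of a and b, so intersecting with an eigenspace
commutes with this sum and the dimension formula applies in each eigenspace. -/
theorem eigenTrace_sup (hT : ∀ y, T (T y) = y) {W₁ W₂ : Submodule ℝ M} [FiniteDimensional ℝ W₁]
    [FiniteDimensional ℝ W₂] (h₁ : ∀ y ∈ W₁, T y ∈ W₁) (h₂ : ∀ y ∈ W₂, T y ∈ W₂) :
    eigenTrace T (W₁ ⊔ W₂) + eigenTrace T (W₁ ⊓ W₂) = eigenTrace T W₁ + eigenTrace T W₂ := by
  have hdim : ∀ s : ℝ, s * s = 1 →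
      Module.finrank ℝ ((W₁ ⊔ W₂) ⊓ T.eigenspace s : Submodule ℝ M) +
        Module.finrank ℝ (W₁ ⊓ W₂ ⊓ T.eigenspace s : Submodule ℝ M) =
      Module.finrank ℝ (W₁ ⊓ T.eigenspace s : Submodule ℝ M) +
        Module.finrank ℝ (W₂ ⊓ T.eigenspace s : Submodule ℝ M) := fun s hs => by
    have : FiniteDimensional ℝ (W₁ ⊓ T.eigenspace s : Submodule ℝ M) :=
      Submodule.finiteDimensional_of_le inf_le_left
    have : FiniteDimensional ℝ (W₂ ⊓ T.eigenspace s : Submodule ℝ M) :=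
      Submodule.finiteDimensional_of_le inf_le_left
    suffices key : (W₁ ⊔ W₂) ⊓ T.eigenspace s = W₁ ⊓ T.eigenspace s ⊔ W₂ ⊓ T.eigenspace s by
      rw [key, inf_inf_distrib_right, Submodule.finrank_sup_add_finrank_inf_eq]
    apply le_antisymm
    · rintro y ⟨hy, hys⟩
      obtain ⟨a, ha, b, hb, rfl⟩ := Submodule.mem_sup.mp hy
      have hproj : ∀ {V : Submodule ℝ M}, (∀ y ∈ V, T y ∈ V) → ∀ a ∈ V,
          (2⁻¹ : ℝ) • (a + s • T a) ∈ V ⊓ T.eigenspace s := fun hV a ha => by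
        refine ⟨Submodule.smul_mem _ _ (Submodule.add_mem _ ha
          (Submodule.smul_mem _ _ (hV a ha))), Module.End.mem_eigenspace_iff.mpr ?_⟩
        rw [map_smul, map_add, map_smul, hT, smul_comm s, smul_add s, smul_smul s s, hs, one_smul,
          add_comm]
      have h1 : a + b = (2⁻¹ : ℝ) • (a + s • T a) + (2⁻¹ : ℝ) • (b + s • T b) := by
        have h2 : s • T (a + b) = a + b := by
          rw [Module.End.mem_eigenspace_iff.mp hys, smul_smul, hs, one_smul]
        have h3 : a + s • T a + (b + s • T b) = (2 : ℝ) • (a + b) := by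
          rw [two_smul, add_add_add_comm, ← smul_add, ← map_add, h2]
        rw [← smul_add, h3, smul_smul]
        norm_num
      rw [h1]
      exact Submodule.add_mem_sup (hproj h₁ a ha) (hproj h₂ b hb)
    · exact sup_le (inf_le_inf_right _ le_sup_left) (inf_le_inf_right _ le_sup_right)
  have h1 := hdim 1 (by norm_num)
  have h2 := hdim (-1) (by norm_num)
  simp only [eigenTrace]
  omega

/-- If an involution swaps two subspaces then its traces on their sum and intersection agree. -/
theorem eigenTrace_sup_of_swap (hT : ∀ y, T (T y) = y) {W₁ W₂ : Submodule ℝ M}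
    [FiniteDimensional ℝ W₁] (h₁ : ∀ y ∈ W₁, T y ∈ W₂) (h₂ : ∀ y ∈ W₂, T y ∈ W₁) :
    eigenTrace T (W₁ ⊔ W₂) = eigenTrace T (W₁ ⊓ W₂) := by
  have hdim : ∀ s : ℝ, s * s = 1 →
      Module.finrank ℝ (W₁ ⊓ W₂ ⊓ T.eigenspace (-s) : Submodule ℝ M) +
        Module.finrank ℝ ((W₁ ⊔ W₂) ⊓ T.eigenspace s : Submodule ℝ M) =
      Module.finrank ℝ W₁ := fun s hs => by
    -- On W₁ this map has the (-s)-eigenspace of the intersection as kernel and the s-eigenspace of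
    -- the sum as image. Comparing s = 1 with s = -1 eliminates dim W₁.
    let f : M →ₗ[ℝ] M := LinearMap.id + s • T
    have hf : ∀ y, f y = y + s • T y := fun y => rfl
    have hfs : ∀ y, T (f y) = s • f y := fun y => by
      rw [hf, map_add, map_smul, hT, smul_add, smul_smul, hs, one_smul, add_comm]
    have hker : W₁ ⊓ W₂ ⊓ T.eigenspace (-s) = W₁ ⊓ LinearMap.ker f := by
      ext y
      simp only [Submodule.mem_inf, Module.End.mem_eigenspace_iff, LinearMap.mem_ker, hf]
      constructor
      · rintro ⟨⟨hy, -⟩, hys⟩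
        refine ⟨hy, ?_⟩
        rw [hys, smul_smul, mul_neg, hs, neg_one_smul, add_neg_cancel]
      · rintro ⟨hy, hys⟩
        have h1 : T y = (-s) • y := by
          have h2 : s • (y + s • T y) = 0 := by rw [hys, smul_zero]
          rw [smul_add, smul_smul, hs, one_smul] at h2
          rw [neg_smul]
          exact (neg_eq_of_add_eq_zero_right h2).symm
        refine ⟨⟨hy, ?_⟩, h1⟩
        have h3 := h₁ y hy
        rw [h1] at h3
        have h4 := W₂.smul_mem (-s) h3
        rwa [smul_smul, neg_mul_neg, hs, one_smul] at h4
    have hmap : (W₁ ⊔ W₂) ⊓ T.eigenspace s = W₁.map f := by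
      apply le_antisymm
      · rintro y ⟨hy, hys⟩
        obtain ⟨a, ha, b, hb, rfl⟩ := Submodule.mem_sup.mp hy
        refine ⟨(2⁻¹ : ℝ) • (a + s • T b), Submodule.smul_mem _ _ (Submodule.add_mem _ ha
          (Submodule.smul_mem _ _ (h₂ b hb))), ?_⟩
        have h2 : s • T (a + b) = a + b := by
          rw [Module.End.mem_eigenspace_iff.mp hys, smul_smul, hs, one_smul]
        have h3 : f (a + s • T b) = (2 : ℝ) • (a + b) := by
          rw [hf, map_add, map_smul, hT, smul_add, smul_smul, hs, one_smul, two_smul]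
          rw [map_add, smul_add] at h2
          rw [← add_assoc, add_right_comm a, add_assoc (a + s • T a), add_comm (s • T b),
            add_assoc a, add_left_comm _ b, ← add_assoc a, h2]
        rw [map_smul, h3, smul_smul]
        norm_num
      · rintro _ ⟨y, hy, rfl⟩
        exact ⟨Submodule.add_mem_sup hy (Submodule.smul_mem _ _ (h₁ y hy)),
          Module.End.mem_eigenspace_iff.mpr (hfs y)⟩
    rw [hker, hmap, finrank_inf_ker_add_finrank_map]
  have h1 := hdim 1 (by norm_num)
  have h2 := hdim (-1) (by norm_num)
  rw [neg_neg] at h2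
  simp only [eigenTrace]
  omega

end EigenTrace

/-! ### The action of -id on cones and on global sections. -/

namespace ConvexFan

variable {n : ℕ} {Δ : ConvexFan n}

theorem negCone_mono (hs : Δ.IsCentrallySymmetric) {σ τ : Δ.Cone} (h : τ ≤ σ) :
    negCone hs τ ≤ negCone hs σ :=
  isFaceOf_iff_le.mp (isFaceOf_neg (isFaceOf_iff_le.mpr h))

/-- If σ = -σ, a nonzero vector of σ would have its negative in σ, against strict convexity. -/
theorem negCone_ne (hs : Δ.IsCentrallySymmetric) {σ : Δ.Cone} (hσ : σ ≠ Δ.zeroCone) :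
    negCone hs σ ≠ σ := fun h => hσ <| Subtype.ext <| (Submodule.eq_bot_iff _).mpr fun y hy => by
  by_contra h0
  refine Δ.strictlyConvex σ.1 σ.2 y hy h0 ?_
  have h1 : -σ.1 = σ.1 := congrArg Subtype.val h
  change -y ∈ σ.1
  rwa [← h1, Submodule.mem_neg, neg_neg]

namespace GradedSheaf

variable {E : GradedSheaf.{u} Δ}

theorem res_grProj {Λ Λ' : Opens Δ.Cone} (h : Λ' ≤ Λ) (q : ℕ) (s : E.Sec Λ) :
    E.res h (grProj (E.gr_internal Λ) q s) = grProj (E.gr_internal Λ') q (E.res h s) := by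
  have h1 := mem_span_homogeneous (E.gr_internal Λ) s
  induction h1 using Submodule.span_induction with
  | mem y hy =>
    obtain ⟨p, hp⟩ := hy
    rw [grProj_of_mem _ q hp, grProj_of_mem _ q (E.res_mem_gr h p y hp)]
    split_ifs with hpq
    · rfl
    · exact map_zero _
  | zero => rw [map_zero, map_zero, map_zero]
  | add a b _ _ ha hb => rw [map_add, map_add, map_add, map_add, ha, hb]
  | smul r a _ ha => rw [map_smul, map_smul, map_smul, map_smul, ha]

theorem finiteDimensional_gr {Λ : Opens Δ.Cone} [Module.Finite ℝ (E.Red Λ)] (q : ℕ) :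
    FiniteDimensional ℝ (E.gr Λ q) := by
  obtain ⟨k, t, ht, -, hspan⟩ := exists_homogeneous_generators (E := E) (Λ := Λ)
  choose d hd using ht
  let g : (Fin n →₀ ℕ) × Fin k → E.Sec Λ := fun α =>
    (MvPolynomial.monomial α.1 1 : MvPolynomial (Fin n) ℝ) • t α.2
  -- A crude bound: a monomial contributes twice its degree to q, and only finiteness of the list
  -- matters.
  let S : Set ((Fin n →₀ ℕ) × Fin k) := {α | Finsupp.degree α ≤ q} ×ˢ Set.univ
  have hS : (g '' S).Finite :=
    ((Finsupp.finite_of_degree_le q).prod Set.finite_univ).image _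
  have hle : E.gr Λ q ≤ Submodule.span ℝ (g '' S) := fun s hs => by
    have h1 := span_poly_le (Set.range t) (hspan ▸ Submodule.mem_top (x := s))
    have h2 := mem_span_inter_of_homogeneous (E.gr_internal Λ) (by
      rintro _ ⟨α, _, ⟨i, rfl⟩, rfl⟩
      exact ⟨_, monomial_smul_mem_gr α (hd i)⟩) hs h1
    refine Submodule.span_le.mpr ?_ h2
    rintro _ ⟨⟨α, _, ⟨i, rfl⟩, rfl⟩, hq⟩
    have h3 := monomial_smul_mem_gr α (hd i)
    by_cases hαq : Finsupp.weight (fun _ => 2) α + d i = q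
    · refine Submodule.subset_span ⟨(α, i), ⟨?_, trivial⟩, rfl⟩
      have h4 : Finsupp.weight (fun _ : Fin n => 2) α = Finsupp.degree α * 2 := by
        rw [Finsupp.weight_apply, Finsupp.degree_apply, Finsupp.sum, Finset.sum_mul]
        rfl
      change Finsupp.degree α ≤ q
      omega
    · rw [eq_zero_of_mem_gr_of_mem_gr (E.gr_internal Λ) hαq h3 hq]
      exact Submodule.zero_mem _
  have : FiniteDimensional ℝ (Submodule.span ℝ (g '' S)) :=
    FiniteDimensional.span_of_finite ℝ hS
  exact Submodule.finiteDimensional_of_le hle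

end GradedSheaf

namespace CentralAction

open GradedSheaf

variable {hs : Δ.IsCentrallySymmetric} {E : GradedSheaf.{u} Δ} (φ : CentralAction hs E)

theorem actTop_actTop (s : E.Sec ⊤) : φ.actTop (φ.actTop s) = s := by
  have h1 := φ.act_act ⊤ s
  have h2 := φ.act_res (top_le_negOpen_top hs) (φ.act ⊤ s)
  simp only [actTop, LinearMap.comp_apply]
  rw [h2, E.res_comp]
  exact h1

theorem actTop_mem_gr {q : ℕ} {s : E.Sec ⊤} (h : s ∈ E.gr ⊤ q) : φ.actTop s ∈ E.gr ⊤ q :=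
  E.res_mem_gr _ q _ (φ.act_mem_gr ⊤ q s h)

/-- Linear forms are odd under -id. This sign turns the factor 1 - t² of the usual Hilbert series
into 1 + t². -/
theorem actTop_X_smul (i : Fin n) (s : E.Sec ⊤) :
    φ.actTop ((MvPolynomial.X i : MvPolynomial (Fin n) ℝ) • s) =
      -((MvPolynomial.X i : MvPolynomial (Fin n) ℝ) • φ.actTop s) := by
  rw [← neg_smul, poly_smul_def, poly_smul_def]
  simp only [actTop, LinearMap.comp_apply, φ.act_smul, E.res_smul]
  congr 1
  refine Subtype.ext (funext fun z => ?_)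
  change MvPolynomial.eval (-z.1) (MvPolynomial.X i) = MvPolynomial.eval z.1 (-MvPolynomial.X i)
  simp

theorem res_actTop_zeroFan (s : E.Sec ⊤) :
    E.res (le_top : Δ.zeroFan ≤ ⊤) (φ.actTop s) = E.res le_top s := by
  have h1 := φ.act_zero (E.res le_top s)
  rw [φ.act_res, E.res_comp] at h1
  rw [← h1]
  exact E.res_comp _ _ _

theorem res_actTop_eq_zero {σ : Δ.Cone} {s : E.Sec ⊤}
    (h : E.res (le_top : affineFan (negCone hs σ) ≤ ⊤) s = 0) :
    E.res (le_top : affineFan σ ≤ ⊤) (φ.actTop s) = 0 := by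
  have hle : affineFan σ ≤ negOpen hs (affineFan (negCone hs σ)) := fun τ hτ =>
    isFaceOf_neg hτ
  have h1 := φ.act_res (le_top : affineFan (negCone hs σ) ≤ ⊤) s
  rw [h, map_zero] at h1
  have h2 := congrArg (E.res hle) h1
  rw [map_zero, E.res_comp] at h2
  rw [h2]
  exact E.res_comp _ _ _

end CentralAction

end ConvexFan

theorem finrank_eq_add_eigenspace {M : Type*} [AddCommGroup M] [Module ℝ M] {T : Module.End ℝ M}
    (hT : ∀ y, T (T y) = y) {W : Submodule ℝ M} [FiniteDimensional ℝ W] (hW : ∀ y ∈ W, T y ∈ W) :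
    Module.finrank ℝ W = Module.finrank ℝ (W ⊓ T.eigenspace 1 : Submodule ℝ M) +
      Module.finrank ℝ (W ⊓ T.eigenspace (-1) : Submodule ℝ M) := by
  let f : M →ₗ[ℝ] M := LinearMap.id - T
  have hf : ∀ y, f y = y - T y := fun y => rfl
  have hker : W ⊓ LinearMap.ker f = W ⊓ T.eigenspace 1 := by
    ext y
    rw [Submodule.mem_inf, Submodule.mem_inf, LinearMap.mem_ker, Module.End.mem_eigenspace_iff, hf,
      one_smul, sub_eq_zero, eq_comm (a := y)]
  have hmap : W.map f = W ⊓ T.eigenspace (-1) := by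
    apply le_antisymm
    · rintro _ ⟨y, hy, rfl⟩
      refine ⟨Submodule.sub_mem _ hy (hW y hy), Module.End.mem_eigenspace_iff.mpr ?_⟩
      rw [hf, map_sub, hT, neg_one_smul, neg_sub]
    · rintro y ⟨hy, hyT⟩
      refine ⟨(2⁻¹ : ℝ) • y, Submodule.smul_mem _ _ hy, ?_⟩
      rw [map_smul, hf, Module.End.mem_eigenspace_iff.mp hyT, neg_one_smul, sub_neg_eq_add,
        ← two_smul ℝ y, smul_smul]
      norm_num
  rw [← finrank_inf_ker_add_finrank_map W f, hker, hmap]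

/-- Membership in an ideal generated by variables is tested on each monomial, and multiplying by a
variable outside S does not affect the test. -/
theorem mem_span_X_of_X_mul {σ R : Type*} [CommRing R] {S : Set σ} {j : σ} (hj : j ∉ S)
    {p : MvPolynomial σ R} (h : MvPolynomial.X j * p ∈ Ideal.span (MvPolynomial.X '' S)) :
    p ∈ Ideal.span (MvPolynomial.X '' S : Set (MvPolynomial σ R)) := by
  rw [MvPolynomial.mem_ideal_span_X_image] at h ⊢
  intro m hm
  obtain ⟨i, hi, him⟩ := h (Finsupp.single j 1 + m) (by
    rwa [MvPolynomial.mem_support_iff, MvPolynomial.coeff_X_mul, ← MvPolynomial.mem_support_iff])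
  refine ⟨i, hi, ?_⟩
  have hij : j ≠ i := fun h => hj (h ▸ hi)
  rwa [Finsupp.add_apply, Finsupp.single_eq_of_ne hij.symm, zero_add] at him

theorem coeff_one_add_X_sq_pow_succ (k q : ℕ) :
    ((1 + Polynomial.X ^ 2 : Polynomial ℤ) ^ (k + 1)).coeff (q + 2) =
      ((1 + Polynomial.X ^ 2 : Polynomial ℤ) ^ k).coeff (q + 2) +
        ((1 + Polynomial.X ^ 2 : Polynomial ℤ) ^ k).coeff q := by
  rw [pow_succ, mul_add, mul_one, Polynomial.coeff_add, Polynomial.coeff_mul_X_pow]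

theorem coeff_one_add_X_sq_pow_of_lt (k : ℕ) {q : ℕ} (hq : q < 2) :
    ((1 + Polynomial.X ^ 2 : Polynomial ℤ) ^ k).coeff q = if q = 0 then 1 else 0 := by
  induction k with
  | zero => rw [pow_zero, Polynomial.coeff_one]
  | succ k ih =>
    rw [pow_succ, mul_add, mul_one, Polynomial.coeff_add, Polynomial.coeff_mul_X_pow',
      if_neg (by omega), add_zero, ih]

/-! ### Computation of the trace: filtrations by subfans and by variables. -/

namespace ConvexFan

variable {n : ℕ} {Δ : ConvexFan n}

namespace GradedSheaf

variable (E : GradedSheaf.{u} Δ)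

/-- The homogeneous global sections which vanish on the given cones. -/
def vanishing (S : Set Δ.Cone) (q : ℕ) : Submodule ℝ (E.Sec ⊤) where
  carrier := {s | s ∈ E.gr ⊤ q ∧ ∀ σ ∈ S, E.res (le_top : affineFan σ ≤ ⊤) s = 0}
  add_mem' := fun ⟨ha, ha'⟩ ⟨hb, hb'⟩ => ⟨Submodule.add_mem _ ha hb, fun σ hσ => by
    rw [map_add, ha' σ hσ, hb' σ hσ, add_zero]⟩
  zero_mem' := ⟨Submodule.zero_mem _, fun _ _ => map_zero _⟩
  smul_mem' := fun r _ ⟨ha, ha'⟩ => ⟨Submodule.smul_mem _ r ha, fun σ hσ => by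
    rw [map_smul, ha' σ hσ, smul_zero]⟩

/-- The global sections divisible by some of the variables. -/
def varSub (S : Finset (Fin n)) : Submodule ℝ (E.Sec ⊤) :=
  Submodule.span ℝ {y | ∃ i ∈ S, ∃ s : E.Sec ⊤,
    y = (MvPolynomial.X i : MvPolynomial (Fin n) ℝ) • s}

/-- Multiplication by a variable. -/
noncomputable def mulX (i : Fin n) : E.Sec ⊤ →ₗ[ℝ] E.Sec ⊤ :=
  (LinearMap.lsmul (MvPolynomial (Fin n) ℝ) (E.Sec ⊤) (MvPolynomial.X i)).restrictScalars ℝ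

variable {E}

theorem mulX_apply (i : Fin n) (s : E.Sec ⊤) :
    E.mulX i s = (MvPolynomial.X i : MvPolynomial (Fin n) ℝ) • s := rfl

/-- Prescribe s on τ and 0 on σ and S. This is compatible because s vanishes on S, which contains
all proper faces of τ. Extend by flabbiness and take the degree q part. -/
theorem IsMinimalExtension.exists_split (hE : E.IsMinimalExtension) {S : Set Δ.Cone}
    (hS : IsLowerSet S) {σ τ : Δ.Cone} (hτ : τ ∉ S) (hτS : ∀ ρ < τ, ρ ∈ S)
    (hτσ : ¬ τ ≤ σ) (hσS : ∀ ρ < σ, ρ ∈ S) {q : ℕ} {s : E.Sec ⊤} (hs : s ∈ E.vanishing S q) :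
    ∃ t ∈ E.vanishing (insert σ S) q,
      E.res (le_top : affineFan τ ≤ ⊤) t = E.res (le_top : affineFan τ ≤ ⊤) s := by
  classical
  let y : ∀ ρ, E.Sec (affineFan ρ) := Function.update (fun _ => 0) τ (E.res le_top s)
  have hy0 : ∀ ρ, ρ ≠ τ → y ρ = 0 := fun ρ h => Function.update_of_ne h _ _
  have hyτ : y τ = E.res le_top s := Function.update_self _ _ _
  have hD : IsLowerSet (insert τ (insert σ S)) := by
    rintro a b hab (rfl | rfl | ha)
    · rcases hab.lt_or_eq with h | rfl
      · exact Or.inr (Or.inr (hτS _ h))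
      · exact Or.inl rfl
    · rcases hab.lt_or_eq with h | rfl
      · exact Or.inr (Or.inr (hσS _ h))
      · exact Or.inr (Or.inl rfl)
    · exact Or.inr (Or.inr (hS hab ha))
  obtain ⟨z, hz, hzc⟩ := hE.stalks_flabby.exists_extension (insert τ (insert σ S)) hD y (by
    intro a ha b hba
    by_cases haτ : a = τ
    · subst haτ
      rw [hyτ]
      rcases hba.lt_or_eq with h | rfl
      · rw [hy0 b h.ne]
        exact (E.res_comp _ _ s).trans (hs.2 b (hτS b h))
      · rw [hyτ]
        exact E.res_id _ _
    · rw [hy0 a haτ, map_zero]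
      refine (hy0 b fun hb => ?_).symm
      subst hb
      rcases ha with rfl | rfl | ha
      · exact haτ rfl
      · exact hτσ hba
      · exact hτ (hS hba ha))
  obtain ⟨t, ht⟩ := exists_glue ⊤ z fun ρ _ => hzc ρ trivial
  have ht' : ∀ ρ, E.res (le_top : affineFan ρ ≤ ⊤) (grProj (E.gr_internal ⊤) q t) =
      grProj (E.gr_internal _) q (z ρ) := fun ρ => by
    rw [res_grProj]
    exact congrArg _ (ht ρ trivial)
  refine ⟨grProj (E.gr_internal ⊤) q t, ⟨grProj_mem _ q t, fun ρ hρ => ?_⟩, ?_⟩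
  · have h1 : y ρ = 0 := hy0 ρ (by
      rintro rfl
      rcases hρ with rfl | hρ
      · exact hτσ le_rfl
      · exact hτ hρ)
    rw [ht', hz ρ (Or.inr hρ), h1, map_zero]
  · rw [ht', hz τ (Or.inl rfl), hyτ]
    exact grProj_self _ (E.res_mem_gr _ q s hs.1)

theorem mem_varSub_iff {k : ℕ}
    (e : E.Sec ⊤ ≃ₗ[MvPolynomial (Fin n) ℝ] (Fin k → MvPolynomial (Fin n) ℝ)) {S : Finset (Fin n)}
    {s : E.Sec ⊤} : s ∈ E.varSub S ↔ ∀ j, e s j ∈ Ideal.span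
      (MvPolynomial.X '' (S : Set (Fin n)) : Set (MvPolynomial (Fin n) ℝ)) := by
  constructor
  · intro h j
    induction h using Submodule.span_induction with
    | mem y hy =>
      obtain ⟨i, hi, t, rfl⟩ := hy
      rw [map_smul, Pi.smul_apply, smul_eq_mul]
      exact Ideal.mul_mem_right _ _ (Ideal.subset_span ⟨i, hi, rfl⟩)
    | zero => rw [map_zero]; exact Submodule.zero_mem _
    | add a b _ _ ha hb => rw [map_add]; exact Submodule.add_mem _ ha hb
    | smul r a _ ha =>
      rw [← C_smul, map_smul]
      exact Ideal.mul_mem_left _ _ ha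
  · intro h
    have h1 : ∀ p ∈ Ideal.span
        (MvPolynomial.X '' (S : Set (Fin n)) : Set (MvPolynomial (Fin n) ℝ)),
        ∀ t : E.Sec ⊤, p • t ∈ E.varSub S := fun p hp => by
      induction hp using Submodule.span_induction with
      | mem y hy =>
        obtain ⟨i, hi, rfl⟩ := hy
        exact fun t => Submodule.subset_span ⟨i, hi, t, rfl⟩
      | zero => intro t; rw [zero_smul]; exact Submodule.zero_mem _
      | add a b _ _ ha hb => intro t; rw [add_smul]; exact Submodule.add_mem _ (ha t) (hb t)
      | smul r a _ ha => intro t; rw [smul_eq_mul, mul_comm, mul_smul]; exact ha _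
    rw [← e.symm_apply_apply s, pi_eq_sum_univ' (e s), map_sum]
    refine Submodule.sum_mem _ fun j _ => ?_
    rw [map_smul]
    exact h1 _ (h j) _

theorem varSub_mono {S S' : Finset (Fin n)} (h : S ⊆ S') : E.varSub S ≤ E.varSub S' :=
  Submodule.span_mono fun _ ⟨i, hi, s, hs⟩ => ⟨i, h hi, s, hs⟩

theorem mulX_mem_varSub {S : Finset (Fin n)} {s : E.Sec ⊤} (hs : s ∈ E.varSub S) (j : Fin n) :
    E.mulX j s ∈ E.varSub S := by
  induction hs using Submodule.span_induction with
  | mem y hy =>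
    obtain ⟨i, hi, t, rfl⟩ := hy
    rw [mulX_apply, smul_smul, mul_comm, mul_smul]
    exact Submodule.subset_span ⟨i, hi, _, rfl⟩
  | zero => rw [map_zero]; exact Submodule.zero_mem _
  | add a b _ _ ha hb => rw [map_add]; exact Submodule.add_mem _ ha hb
  | smul r a _ ha => rw [map_smul]; exact Submodule.smul_mem _ _ ha

theorem varSub_univ : E.varSub Finset.univ = E.maxSub ⊤ := by
  apply le_antisymm
  · refine Submodule.span_le.mpr ?_
    rintro _ ⟨i, -, s, rfl⟩
    exact poly_smul_mem_maxSub (MvPolynomial.constantCoeff_X ℝ i) s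
  · refine (maxSub_le_span_X_smul ⊤).trans (Submodule.span_mono ?_)
    rintro _ ⟨i, q, s, -, rfl⟩
    exact ⟨i, Finset.mem_univ i, s, rfl⟩

theorem mem_span_of_mem_varSub {S : Finset (Fin n)} {q : ℕ} {s : E.Sec ⊤}
    (hs : s ∈ E.varSub S ⊓ E.gr ⊤ q) : s ∈ Submodule.span ℝ
      {y | ∃ i ∈ S, ∃ (p : ℕ), ∃ t ∈ E.gr ⊤ p, 2 + p = q ∧ y = E.mulX i t} := by
  have h1 : s ∈ Submodule.span ℝ {y | ∃ i ∈ S, ∃ (p : ℕ), ∃ t ∈ E.gr ⊤ p, y = E.mulX i t} := by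
    refine Submodule.span_le.mpr ?_ hs.1
    rintro _ ⟨i, hi, t, rfl⟩
    have h2 := mem_span_homogeneous (E.gr_internal ⊤) t
    rw [← mulX_apply]
    induction h2 using Submodule.span_induction with
    | mem y hy =>
      obtain ⟨p, hp⟩ := hy
      exact Submodule.subset_span ⟨i, hi, p, y, hp, rfl⟩
    | zero => rw [map_zero]; exact Submodule.zero_mem _
    | add a b _ _ ha hb => rw [map_add]; exact Submodule.add_mem _ ha hb
    | smul r a _ ha => rw [map_smul]; exact Submodule.smul_mem _ _ ha
  have h2 := mem_span_inter_of_homogeneous (E.gr_internal ⊤) (by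
    rintro _ ⟨i, hi, p, t, ht, rfl⟩
    exact ⟨_, X_smul_mem_gr i ht⟩) hs.2 h1
  refine Submodule.span_le.mpr ?_ h2
  rintro _ ⟨⟨i, hi, p, t, ht, rfl⟩, hq⟩
  by_cases hpq : 2 + p = q
  · exact Submodule.subset_span ⟨i, hi, p, t, ht, hpq, rfl⟩
  · have h0 : E.mulX i t = 0 :=
      eq_zero_of_mem_gr_of_mem_gr (E.gr_internal ⊤) hpq (X_smul_mem_gr i ht) hq
    rw [h0]
    exact Submodule.zero_mem _

theorem varSub_inf_gr_of_lt (S : Finset (Fin n)) {q : ℕ} (hq : q < 2) :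
    E.varSub S ⊓ E.gr ⊤ q = ⊥ := by
  rw [eq_bot_iff]
  intro s hs
  refine Submodule.span_le.mpr ?_ (mem_span_of_mem_varSub hs)
  rintro _ ⟨i, hi, p, t, ht, hpq, rfl⟩
  omega

theorem varSub_insert_inf_gr [DecidableEq (Fin n)] (S : Finset (Fin n)) (j : Fin n) (q : ℕ) :
    E.varSub (insert j S) ⊓ E.gr ⊤ (q + 2) =
      E.varSub S ⊓ E.gr ⊤ (q + 2) ⊔ (E.gr ⊤ q).map (E.mulX j) := by
  apply le_antisymm
  · intro s hs
    refine Submodule.span_le.mpr ?_ (mem_span_of_mem_varSub hs)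
    rintro _ ⟨i, hi, p, t, ht, hpq, rfl⟩
    obtain rfl : p = q := by omega
    rcases Finset.mem_insert.mp hi with rfl | hi
    · exact Submodule.mem_sup_right ⟨t, ht, rfl⟩
    · refine Submodule.mem_sup_left ⟨Submodule.subset_span ⟨i, hi, t, rfl⟩, ?_⟩
      rw [add_comm]
      exact X_smul_mem_gr i ht
  · refine sup_le (inf_le_inf_right _ (varSub_mono (Finset.subset_insert j S))) ?_
    rintro _ ⟨t, ht, rfl⟩
    refine ⟨Submodule.subset_span ⟨j, Finset.mem_insert_self j S, t, rfl⟩, ?_⟩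
    rw [add_comm]
    exact X_smul_mem_gr j ht

/-- Regularity of the next variable modulo the previous ones, read off in coordinates with respect
to a basis of E_Δ. -/
theorem varSub_inf_map_mulX {k : ℕ}
    (e : E.Sec ⊤ ≃ₗ[MvPolynomial (Fin n) ℝ] (Fin k → MvPolynomial (Fin n) ℝ)) {S : Finset (Fin n)}
    {j : Fin n} (hj : j ∉ S) (q : ℕ) :
    E.varSub S ⊓ E.gr ⊤ (q + 2) ⊓ (E.gr ⊤ q).map (E.mulX j) =
      (E.varSub S ⊓ E.gr ⊤ q).map (E.mulX j) := by
  apply le_antisymm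
  · rintro _ ⟨⟨hS, -⟩, t, ht, rfl⟩
    refine ⟨t, ⟨(mem_varSub_iff e).mpr fun i => ?_, ht⟩, rfl⟩
    have h1 := (mem_varSub_iff e).mp hS i
    rw [mulX_apply, map_smul] at h1
    exact mem_span_X_of_X_mul hj h1
  · rintro _ ⟨t, ⟨hS, ht⟩, rfl⟩
    refine ⟨⟨mulX_mem_varSub hS j, ?_⟩, t, ht, rfl⟩
    rw [add_comm]
    exact X_smul_mem_gr j ht

theorem mulX_injective {k : ℕ}
    (e : E.Sec ⊤ ≃ₗ[MvPolynomial (Fin n) ℝ] (Fin k → MvPolynomial (Fin n) ℝ)) (j : Fin n) :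
    Function.Injective (E.mulX j) := fun s t hst => e.injective (funext fun i => by
  have h1 := congrFun (congrArg e hst) i
  rw [mulX_apply, mulX_apply, map_smul, map_smul] at h1
  exact mul_left_cancel₀ (MvPolynomial.X_ne_zero j) h1)

end GradedSheaf

namespace CentralAction

open GradedSheaf

variable {hs : Δ.IsCentrallySymmetric} {E : GradedSheaf.{u} Δ} (φ : CentralAction hs E)

theorem actTop_mem_vanishing {S S' : Set Δ.Cone} (h : ∀ σ ∈ S', negCone hs σ ∈ S) {q : ℕ}
    {s : E.Sec ⊤} (hs' : s ∈ E.vanishing S q) : φ.actTop s ∈ E.vanishing S' q :=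
  ⟨φ.actTop_mem_gr hs'.1, fun σ hσ => φ.res_actTop_eq_zero (hs'.2 _ (h σ hσ))⟩

theorem actTop_mem_varSub {S : Finset (Fin n)} {s : E.Sec ⊤} (h : s ∈ E.varSub S) :
    φ.actTop s ∈ E.varSub S := by
  induction h using Submodule.span_induction with
  | mem y hy =>
    obtain ⟨i, hi, t, rfl⟩ := hy
    rw [actTop_X_smul]
    exact Submodule.neg_mem _ (Submodule.subset_span ⟨i, hi, _, rfl⟩)
  | zero => rw [map_zero]; exact Submodule.zero_mem _
  | add a b _ _ ha hb => rw [map_add]; exact Submodule.add_mem _ ha hb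
  | smul r a _ ha => rw [map_smul]; exact Submodule.smul_mem _ _ ha

theorem redAct_redAct (y : E.Red ⊤) : φ.redAct (φ.redAct y) = y := by
  obtain ⟨s, rfl⟩ := (E.maxSub ⊤).mkQ_surjective y
  exact congrArg (E.maxSub ⊤).mkQ (φ.actTop_actTop s)

theorem redAct_mem_redGr {q : ℕ} {y : E.Red ⊤} (hy : y ∈ E.redGr ⊤ q) :
    φ.redAct y ∈ E.redGr ⊤ q := by
  obtain ⟨s, hs', rfl⟩ := hy
  exact ⟨φ.actTop s, φ.actTop_mem_gr hs', rfl⟩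

variable (hE : E.IsMinimalExtension)
include hE

theorem finiteDimensional_gr_top (q : ℕ) : FiniteDimensional ℝ (E.gr ⊤ q) := by
  have := hE.finite_sec ⊤
  have : Module.Finite ℝ (E.Red ⊤) := red_finite
  exact finiteDimensional_gr q

/-- Choose σ minimal outside S. Then -σ is also minimal outside S and different from σ, as S
contains the zero cone. By `exists_split` the space is the sum of the subspaces vanishing also on σ
and on -σ, which `φ` swaps, so the trace is unchanged on passing to S ∪ {σ, -σ}. Once S is
everything the space is 0. -/
theorem eigenTrace_vanishing (q : ℕ) {S : Set Δ.Cone} (hS : IsLowerSet S)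
    (hneg : ∀ σ ∈ S, negCone hs σ ∈ S) (h0 : Δ.zeroCone ∈ S) :
    eigenTrace φ.actTop (E.vanishing S q) = 0 := by
  have hgr := finiteDimensional_gr_top hE q
  have hV : ∀ S, FiniteDimensional ℝ (E.vanishing S q) := fun S =>
    Submodule.finiteDimensional_of_le (S₂ := E.gr ⊤ q) fun s hs => hs.1
  induction hk : Sᶜ.ncard using Nat.strong_induction_on generalizing S with
  | _ k ih =>
    by_cases hne : (Sᶜ).Nonempty
    · obtain ⟨σ, hσ⟩ := (Set.toFinite Sᶜ).exists_minimal hne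
      have hσS : ∀ ρ < σ, ρ ∈ S := fun ρ hρ => by
        by_contra h
        exact hρ.not_ge (hσ.2 h hρ.le)
      set τ := negCone hs σ with hτdef
      have hτσ : negCone hs τ = σ := negCone_negCone hs σ
      have hτ : τ ∉ S := fun h => hσ.1 (hτσ ▸ hneg τ h)
      have hne' : τ ≠ σ := negCone_ne hs fun h => hσ.1 (h ▸ h0)
      have hτS : ∀ ρ < τ, ρ ∈ S := fun ρ hρ => by
        have h1 : negCone hs ρ ≤ σ := hτσ ▸ negCone_mono hs hρ.le
        rcases h1.lt_or_eq with h2 | h2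
        · rw [← negCone_negCone hs ρ]
          exact hneg _ (hσS _ h2)
        · exact absurd (by rw [hτdef, ← h2, negCone_negCone]) hρ.ne
      have hτσ' : ¬ τ ≤ σ := fun h => hτ (hσS τ (lt_of_le_of_ne h hne'))
      have hστ' : ¬ σ ≤ τ := fun h => hσ.1 (hτS σ (lt_of_le_of_ne h hne'.symm))
      have hsup : E.vanishing S q = E.vanishing (insert σ S) q ⊔ E.vanishing (insert τ S) q := by
        apply le_antisymm
        · intro s hs'
          obtain ⟨t, ht, hts⟩ := hE.exists_split hS hτ hτS hτσ' hσS hs'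
          rw [← add_sub_cancel t s]
          refine Submodule.add_mem_sup ht ⟨Submodule.sub_mem _ hs'.1 ht.1, ?_⟩
          rintro ρ (rfl | hρ)
          · rw [map_sub, hts, sub_self]
          · rw [map_sub, hs'.2 ρ hρ, ht.2 ρ (Or.inr hρ), sub_self]
        · exact sup_le (fun s hs' => ⟨hs'.1, fun ρ hρ => hs'.2 ρ (Or.inr hρ)⟩)
            fun s hs' => ⟨hs'.1, fun ρ hρ => hs'.2 ρ (Or.inr hρ)⟩
      have hinf : E.vanishing (insert σ S) q ⊓ E.vanishing (insert τ S) q =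
          E.vanishing (insert σ (insert τ S)) q := by
        ext s
        constructor
        · rintro ⟨h1, h2⟩
          refine ⟨h1.1, ?_⟩
          rintro ρ (rfl | hρ)
          · exact h1.2 ρ (Or.inl rfl)
          · exact h2.2 ρ hρ
        · intro h
          exact ⟨⟨h.1, fun ρ hρ => h.2 ρ (hρ.imp_right Or.inr)⟩, h.1, fun ρ hρ => h.2 ρ (Or.inr hρ)⟩
      rw [hsup, eigenTrace_sup_of_swap φ.actTop_actTop
        (fun y hy => φ.actTop_mem_vanishing (by
          rintro ρ (rfl | hρ)
          · exact Or.inl hτσ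
          · exact Or.inr (hneg ρ hρ)) hy)
        (fun y hy => φ.actTop_mem_vanishing (by
          rintro ρ (rfl | hρ)
          · exact Or.inl rfl
          · exact Or.inr (hneg ρ hρ)) hy), hinf]
      refine ih _ ?_ ?_ ?_ (Or.inr (Or.inr h0)) rfl
      · rw [← hk]
        refine Set.ncard_lt_ncard ⟨Set.compl_subset_compl.mpr
          ((Set.subset_insert _ _).trans (Set.subset_insert _ _)), fun h => ?_⟩ (Set.toFinite _)
        exact h hσ.1 (Or.inl rfl)
      · rintro a b hab (rfl | rfl | ha)
        · rcases hab.lt_or_eq with h | rfl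
          · exact Or.inr (Or.inr (hσS _ h))
          · exact Or.inl rfl
        · rcases hab.lt_or_eq with h | rfl
          · exact Or.inr (Or.inr (hτS _ h))
          · exact Or.inr (Or.inl rfl)
        · exact Or.inr (Or.inr (hS hab ha))
      · rintro ρ (rfl | rfl | hρ)
        · exact Or.inr (Or.inl rfl)
        · exact Or.inl hτσ
        · exact Or.inr (Or.inr (hneg ρ hρ))
    · rw [Set.not_nonempty_iff_eq_empty, Set.compl_empty_iff] at hne
      have h1 : E.vanishing S q = ⊥ := by
        rw [eq_bot_iff]
        intro s hs'
        refine (Submodule.mem_bot ℝ).mpr (sec_ext fun σ _ => ?_)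
        rw [map_zero]
        exact hs'.2 σ (hne ▸ trivial)
      rw [h1, eigenTrace_bot]

/-- Restrict to E_0: the kernel has trace 0, and on the image, which is all of E_0 in degree 0, `φ`
acts as the identity. -/
theorem eigenTrace_gr (q : ℕ) : eigenTrace φ.actTop (E.gr ⊤ q) = if q = 0 then 1 else 0 := by
  have hgr := finiteDimensional_gr_top hE q
  let f := E.res (le_top : Δ.zeroFan ≤ ⊤)
  have hf0 : ∀ s, f s = 0 ↔ E.res (le_top : affineFan Δ.zeroCone ≤ ⊤) s = 0 := fun s => by
    constructor
    · intro h
      have h1 := congrArg (E.res affineFan_le_zeroFan) h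
      rwa [map_zero, E.res_comp] at h1
    · intro h
      have h1 := congrArg (E.res zeroFan_le_affineFan) h
      rwa [map_zero, E.res_comp] at h1
  have hker : E.gr ⊤ q ⊓ LinearMap.ker f = E.vanishing {Δ.zeroCone} q := by
    ext s
    constructor
    · rintro ⟨h1, h2⟩
      exact ⟨h1, by rintro _ rfl; exact (hf0 s).mp h2⟩
    · rintro ⟨h1, h2⟩
      exact ⟨h1, (hf0 s).mpr (h2 _ rfl)⟩
  have hD : IsLowerSet {Δ.zeroCone} := fun s t hts hs => by
    rw [Set.mem_singleton_iff.mp hs] at hts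
    exact le_antisymm hts (zeroCone_le t)
  rw [eigenTrace_eq_add_map φ.actTop_actTop (fun s hs => φ.actTop_mem_gr hs)
    (T' := (LinearMap.id : Module.End ℝ (E.Sec Δ.zeroFan))) f φ.res_actTop_zeroFan, hker,
    φ.eigenTrace_vanishing hE q hD (by
      rintro _ rfl
      exact Subtype.ext (le_bot_iff.mp fun y hy => neg_eq_zero.mp hy)) rfl, zero_add]
  have hid : ∀ W : Submodule ℝ (E.Sec Δ.zeroFan),
      eigenTrace (LinearMap.id : Module.End ℝ (E.Sec Δ.zeroFan)) W = Module.finrank ℝ W := fun W => by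
    have h1 : W ⊓ Module.End.eigenspace (LinearMap.id : Module.End ℝ (E.Sec Δ.zeroFan)) 1 = W :=
      inf_eq_left.mpr fun y _ => Module.End.mem_eigenspace_iff.mpr (one_smul ℝ y).symm
    have h2 : W ⊓ Module.End.eigenspace (LinearMap.id : Module.End ℝ (E.Sec Δ.zeroFan)) (-1) = ⊥ := by
      rw [eq_bot_iff]
      rintro y ⟨-, hy⟩
      have h3 : y = (-1 : ℝ) • y := Module.End.mem_eigenspace_iff.mp hy
      rw [neg_one_smul] at h3
      have h4 : (2 : ℝ) • y = 0 := by
        rw [two_smul]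
        exact add_eq_zero_iff_eq_neg.mpr h3
      exact (Submodule.mem_bot ℝ).mpr ((smul_eq_zero.mp h4).resolve_left two_ne_zero)
    rw [eigenTrace, h1, h2, finrank_bot, Nat.cast_zero, sub_zero]
  rw [hid]
  split_ifs with hq
  · subst hq
    have h1 : (E.gr ⊤ 0).map f = ⊤ := by
      rw [eq_top_iff]
      intro y _
      classical
      obtain ⟨z, hz, hzc⟩ := hE.stalks_flabby.exists_extension {Δ.zeroCone} hD
        (Function.update (fun _ => 0) Δ.zeroCone (E.res affineFan_le_zeroFan y)) (by
          rintro _ rfl t hts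
          obtain rfl := hD hts rfl
          exact E.res_id _ _)
      obtain ⟨t, ht⟩ := exists_glue ⊤ z fun ρ _ => hzc ρ trivial
      have h2 : f t = y := by
        have h3 := congrArg (E.res zeroFan_le_affineFan) (ht Δ.zeroCone trivial)
        rw [hz _ rfl, Function.update_self, E.res_comp, E.res_comp, E.res_id] at h3
        exact h3
      refine ⟨grProj (E.gr_internal ⊤) 0 t, grProj_mem _ 0 t, ?_⟩
      rw [res_grProj]
      refine (grProj_self _ ?_).trans h2
      rw [hE.zero_gr]
      trivial
    obtain ⟨e⟩ := hE.zero_iso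
    rw [h1, finrank_top, e.finrank_eq, Module.finrank_self, Nat.cast_one]
  · have h1 : (E.gr ⊤ q).map f = ⊥ := by
      rw [eq_bot_iff]
      rintro _ ⟨s, hs', rfl⟩
      refine (Submodule.mem_bot ℝ).mpr (eq_zero_of_mem_gr_of_mem_gr (E.gr_internal _) hq
        (E.res_mem_gr _ q s hs') ?_)
      rw [hE.zero_gr]
      trivial
    rw [h1, finrank_bot, Nat.cast_zero]

/-- The left side is the trace on E_Δ modulo the variables in S. Adjoining X_j removes a copy of
this quotient shifted by 2, on which the trace has changed sign, so the trace is added. This is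
Pascal's rule for (1 + t²)^k; degrees below 2 are not affected by any variable. -/
theorem eigenTrace_varSub (hΔ : Δ.IsComplete) (S : Finset (Fin n)) (q : ℕ) :
    eigenTrace φ.actTop (E.gr ⊤ q) - eigenTrace φ.actTop (E.varSub S ⊓ E.gr ⊤ q) =
      ((1 + Polynomial.X ^ 2 : Polynomial ℤ) ^ S.card).coeff q := by
  classical
  obtain ⟨k, ⟨e⟩⟩ := hE.exists_equiv_top hΔ
  have hgr := finiteDimensional_gr_top hE
  have hfin : ∀ S q, FiniteDimensional ℝ (E.varSub S ⊓ E.gr ⊤ q : Submodule ℝ (E.Sec ⊤)) :=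
    fun S q => Submodule.finiteDimensional_of_le inf_le_right
  have hT : ∀ S q, ∀ y ∈ E.varSub S ⊓ E.gr ⊤ q, φ.actTop y ∈ E.varSub S ⊓ E.gr ⊤ q :=
    fun S q y hy => ⟨φ.actTop_mem_varSub hy.1, φ.actTop_mem_gr hy.2⟩
  induction S using Finset.induction_on generalizing q with
  | empty =>
    have h1 : E.varSub ∅ ⊓ E.gr ⊤ q = ⊥ := by
      rw [eq_bot_iff]
      intro s hs'
      refine Submodule.span_le.mpr ?_ hs'.1
      rintro _ ⟨i, hi, -⟩
      exact absurd hi (Finset.notMem_empty i)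
    rw [h1, eigenTrace_bot, sub_zero, φ.eigenTrace_gr hE, Finset.card_empty, pow_zero,
      Polynomial.coeff_one]
  | insert j S hj ih =>
    rcases lt_or_ge q 2 with hq | hq
    · rw [varSub_inf_gr_of_lt _ hq, eigenTrace_bot, sub_zero, φ.eigenTrace_gr hE,
        coeff_one_add_X_sq_pow_of_lt _ hq]
    obtain ⟨q, rfl⟩ := Nat.exists_eq_add_of_le' hq
    have hanti : ∀ y, E.mulX j (φ.actTop y) = -φ.actTop (E.mulX j y) := fun y => by
      rw [mulX_apply, mulX_apply, φ.actTop_X_smul, neg_neg]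
    have h1 := eigenTrace_sup φ.actTop_actTop (hT S (q + 2))
      (W₂ := (E.gr ⊤ q).map (E.mulX j)) (by
        rintro _ ⟨y, hy, rfl⟩
        refine ⟨-φ.actTop y, Submodule.neg_mem _ (φ.actTop_mem_gr hy), ?_⟩
        rw [map_neg, hanti, neg_neg])
    rw [← varSub_insert_inf_gr, varSub_inf_map_mulX e hj,
      eigenTrace_map_of_anticommute φ.actTop_actTop (hT S q) hanti (mulX_injective e j),
      eigenTrace_map_of_anticommute φ.actTop_actTop (fun y hy => φ.actTop_mem_gr hy) hanti
        (mulX_injective e j)] at h1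
    rw [Finset.card_insert_of_notMem hj, coeff_one_add_X_sq_pow_succ, ← ih, ← ih]
    linarith

theorem finrank_redEigen_sub (hΔ : Δ.IsComplete) (q : ℕ) :
    (Module.finrank ℝ (φ.redEigen 1 q) : ℤ) - Module.finrank ℝ (φ.redEigen (-1) q) =
      ((1 + Polynomial.X ^ 2 : Polynomial ℤ) ^ n).coeff q := by
  have hgr := finiteDimensional_gr_top hE q
  have h1 := φ.eigenTrace_varSub hE hΔ Finset.univ q
  rw [varSub_univ, inf_comm, Finset.card_univ, Fintype.card_fin,
    eigenTrace_eq_add_map φ.actTop_actTop (fun y hy => φ.actTop_mem_gr hy) (T' := φ.redAct)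
      (E.maxSub ⊤).mkQ (fun y => rfl), Submodule.ker_mkQ, add_sub_cancel_left] at h1
  exact h1

theorem finrank_redEigen_add (q : ℕ) :
    Module.finrank ℝ (φ.redEigen 1 q) + Module.finrank ℝ (φ.redEigen (-1) q) =
      Module.finrank ℝ (E.redGr ⊤ q) := by
  have hgr := finiteDimensional_gr_top hE q
  have : FiniteDimensional ℝ (E.redGr ⊤ q) :=
    inferInstanceAs (FiniteDimensional ℝ ((E.gr ⊤ q).map (E.maxSub ⊤).mkQ))
  exact (finrank_eq_add_eigenspace φ.redAct_redAct fun y hy => φ.redAct_mem_redGr hy).symm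

end CentralAction

end ConvexFan

/-! ### Passage from dimensions to Poincaré polynomials. -/

theorem coeff_finsum_monomial {R : Type*} [Semiring R] {a : ℕ → R} {D : Finset ℕ}
    (h : ∀ q ∉ D, a q = 0) (k : ℕ) : (∑ᶠ q, Polynomial.monomial q (a q)).coeff k = a k := by
  -- The finite set `D` makes this a genuine sum; `finsum` would be 0 on infinite support.
  rw [finsum_eq_sum_of_support_subset (s := D) _ fun q hq => by
    by_contra hqD
    exact hq (by simp only [h q hqD, map_zero]), Polynomial.finsetSum_coeff]
  simp only [Polynomial.coeff_monomial]
  rw [Finset.sum_ite_eq']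
  split_ifs with hk
  · rfl
  · exact (h k hk).symm

namespace ConvexFan

variable {n : ℕ} {Δ : ConvexFan n}

namespace GradedSheaf

variable {E : GradedSheaf.{u} Δ}

/-- Only the degrees of the homogeneous generators occur in Ē_Λ, since a generator times a
nonconstant monomial lies in 𝔪E_Λ. -/
theorem exists_redGr_eq_bot {Λ : Opens Δ.Cone} [Module.Finite ℝ (E.Red Λ)] :
    ∃ D : Finset ℕ, ∀ q ∉ D, E.redGr Λ q = ⊥ := by
  classical
  obtain ⟨k, t, ht, -, hspan⟩ := exists_homogeneous_generators (E := E) (Λ := Λ)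
  choose d hd using ht
  refine ⟨Finset.univ.image d, fun q hq => ?_⟩
  rw [eq_bot_iff]
  rintro _ ⟨s, hs, rfl⟩
  refine (Submodule.mem_bot ℝ).mpr ((Submodule.Quotient.mk_eq_zero _).mpr ?_)
  have h1 := span_poly_le (Set.range t) (hspan ▸ Submodule.mem_top (x := s))
  have h2 := mem_span_inter_of_homogeneous (E.gr_internal Λ) (by
    rintro _ ⟨α, _, ⟨i, rfl⟩, rfl⟩
    exact ⟨_, monomial_smul_mem_gr α (hd i)⟩) hs h1
  refine Submodule.span_le.mpr ?_ h2
  rintro _ ⟨⟨α, _, ⟨i, rfl⟩, rfl⟩, hαq⟩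
  by_cases hα : α = 0
  · subst hα
    have h3 : t i ∈ E.gr Λ q := by
      have h4 : (MvPolynomial.monomial 0 1 : MvPolynomial (Fin n) ℝ) = 1 := rfl
      simpa only [h4, one_smul, SetLike.mem_coe] using hαq
    rw [eq_zero_of_mem_gr_of_mem_gr (E.gr_internal Λ)
      (fun h => hq (Finset.mem_image.mpr ⟨i, Finset.mem_univ i, h⟩)) (hd i) h3, smul_zero]
    exact Submodule.zero_mem _
  · refine poly_smul_mem_maxSub ?_ _
    rw [MvPolynomial.constantCoeff_eq, MvPolynomial.coeff_monomial, if_neg hα]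

end GradedSheaf

end ConvexFan

theorem proposition3p1 {n : ℕ} (Δ : ConvexFan n) (hΔ : Δ.IsComplete)
    (hs : Δ.IsCentrallySymmetric) (E : ConvexFan.GradedSheaf.{u} Δ)
    (hE : E.IsMinimalExtension) (φ : ConvexFan.CentralAction hs E) :
    Module.Finite ℝ (E.Red ⊤) ∧
    φ.refinedPoincarePoly.map (MonoidAlgebra.mapRingHom ℤˣ (Int.castRingHom ℚ)) =
      Polynomial.C (MonoidAlgebra.single 1 (1 / 2)) *
        ((ConvexFan.poincarePoly (E.redGr ⊤)).map (Int.castRingHom (MonoidAlgebra ℚ ℤˣ)) +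
          (1 + Polynomial.X ^ 2) ^ n) +
      Polynomial.C (MonoidAlgebra.single 1 (1 / 2) * ConvexFan.chi ℚ) *
        ((ConvexFan.poincarePoly (E.redGr ⊤)).map (Int.castRingHom (MonoidAlgebra ℚ ℤˣ)) -
          (1 + Polynomial.X ^ 2) ^ n) ∧
    (ConvexFan.poincarePoly (φ.redEigen (-1))).map (Int.castRingHom ℚ) =
      Polynomial.C (1 / 2) *
        ((ConvexFan.poincarePoly (E.redGr ⊤)).map (Int.castRingHom ℚ) -
          (1 + Polynomial.X ^ 2) ^ n) := by
  have := hE.finite_sec ⊤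
  have hfin : Module.Finite ℝ (E.Red ⊤) := ConvexFan.GradedSheaf.red_finite
  obtain ⟨D, hD⟩ := ConvexFan.GradedSheaf.exists_redGr_eq_bot (E := E) (Λ := ⊤)
  have hsum := φ.finrank_redEigen_add hE
  have hsub := φ.finrank_redEigen_sub hE hΔ
  have hr0 : ∀ q ∉ D, Module.finrank ℝ (E.redGr ⊤ q) = 0 := fun q hq => by
    rw [hD q hq, finrank_bot]
  have hp0 : ∀ q ∉ D, Module.finrank ℝ (φ.redEigen 1 q) = 0 := fun q hq => by
    have h1 := hsum q
    have h2 := hr0 q hq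
    omega
  have hm0 : ∀ q ∉ D, Module.finrank ℝ (φ.redEigen (-1) q) = 0 := fun q hq => by
    have h1 := hsum q
    have h2 := hr0 q hq
    omega
  have hpoly : ∀ R : Type, ∀ [CommRing R], (1 + Polynomial.X ^ 2 : Polynomial R) ^ n =
      ((1 + Polynomial.X ^ 2 : Polynomial ℤ) ^ n).map (Int.castRingHom R) := fun R _ => by
    simp
  have hR : ∀ k, (ConvexFan.poincarePoly (E.redGr ⊤)).coeff k = Module.finrank ℝ (E.redGr ⊤ k) :=
    coeff_finsum_monomial fun q hq => by rw [hr0 q hq, Nat.cast_zero]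
  have hM : ∀ k, (ConvexFan.poincarePoly (φ.redEigen (-1))).coeff k =
      Module.finrank ℝ (φ.redEigen (-1) k) :=
    coeff_finsum_monomial fun q hq => by rw [hm0 q hq, Nat.cast_zero]
  have hU : ∀ k, φ.refinedPoincarePoly.coeff k =
      (Module.finrank ℝ (φ.redEigen 1 k) : MonoidAlgebra ℤ ℤˣ) +
        (Module.finrank ℝ (φ.redEigen (-1) k) : MonoidAlgebra ℤ ℤˣ) * ConvexFan.chi ℤ :=
    coeff_finsum_monomial fun q hq => by
      rw [hp0 q hq, hm0 q hq, Nat.cast_zero, zero_mul, add_zero]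
  refine ⟨hfin, ?_, ?_⟩
  · ext1 k
    have hchi : MonoidAlgebra.mapRingHom ℤˣ (Int.castRingHom ℚ) (ConvexFan.chi ℤ) =
        ConvexFan.chi ℚ := by
      simp [ConvexFan.chi]
    have hhalf : (MonoidAlgebra.single 1 (1 / 2) : MonoidAlgebra ℚ ℤˣ) * 2 = 1 := by
      rw [mul_two, ← MonoidAlgebra.single_add, MonoidAlgebra.one_def]
      norm_num
    rw [hpoly, Polynomial.coeff_add, Polynomial.coeff_C_mul, Polynomial.coeff_C_mul,
      Polynomial.coeff_add, Polynomial.coeff_sub, Polynomial.coeff_map, Polynomial.coeff_map,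
      Polynomial.coeff_map, hU, hR, ← hsub, ← hsum, map_add, map_mul, hchi, map_natCast,
      map_natCast, eq_intCast, eq_intCast]
    push_cast
    -- Sum and difference of the eigenspace dimensions are already substituted, so only the relation
    -- ½·2 = 1 in the group ring is needed.
    linear_combination
      (-(Module.finrank ℝ (φ.redEigen 1 k) : MonoidAlgebra ℚ ℤˣ) -
        (Module.finrank ℝ (φ.redEigen (-1) k) : MonoidAlgebra ℚ ℤˣ) * ConvexFan.chi ℚ) * hhalf
  · ext1 k
    rw [hpoly, Polynomial.coeff_C_mul, Polynomial.coeff_sub, Polynomial.coeff_map,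
      Polynomial.coeff_map, Polynomial.coeff_map, hM, hR, ← hsub, ← hsum, eq_intCast, eq_intCast,
      eq_intCast]
    push_cast
    ring
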